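/- **Setting.** Let $n,m\ge 1$, $f,g_1,\dots,g_m:\mathbb R^n\to\mathbb R$, $g=\max_i g_i$, let $\mathcal F=\{x: g(x)\le 0\}$ be the feasible set, and consider the problem $p_\star=\inf\{f(x): g(x)\le 0\}$. Assume that $p_\star$ is finite, that for some $M>0$ and $\Delta>0$ the functions $f$ and all $g_i$ are $M$-Lipschitz on the set of points at distance less than $\Delta$ from $\mathcal F$, and that a point $x_0\in\mathcal F$ is given. Let $\epsilon>0$, $0<\delta<\Delta$. Put $h_x(z)=\max\{f(z)-f(x),g(z)\}$, let $B(x,\delta)$ be the closed ball, and write $\hat\zeta=\zeta/\|\zeta\|$. For a subdifferential $\partial$ put $\partial_\delta h(x)=\mathrm{conv}\bigcup_{y\in B(x,\delta)}\partial h(y)$. A feasible $x$ is *$(\delta,\epsilon,\eta)$-Goldstein Fritz–John (GFJ) stationary* if there are $\gamma_0,\gamma\ge 0$ with $\gamma_0+\gamma=1$, $\mathrm{dist}(0,\gamma_0\partial_\delta f(x)+\gamma\,\partial_\delta g(x))\le\epsilon$ and $|\gamma g(y)|\le\eta$ for all $y\in B(x,\delta)$. **Method.** For $k=0,1,\dots$: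 a subroutine called at $x_k$ returns $\zeta_k$; if $\|\zeta_k\|\le\epsilon$, return $x_k$; otherwise $x_{k+1}=x_k-\delta\hat\zeta_k$. **(a) General subroutines.** Let oracles $\mathcal G_f(z)\in\partial f(z)$, $\mathcal G_g(z)\in\partial g(z)$ and $\mathcal G_{h_x}(z)$ be given, possibly depending on an additional argument such as a direction, with $\mathcal G_{h_x}(z)=\mathcal G_f(z)$ if $f(z)-f(x)>g(z)$, $\mathcal G_{h_x}(z)=\mathcal G_g(z)$ if $f(z)-f(x)<g(z)$, and one of the two in case of equality. Suppose that, for some $C>0$, the subroutine called at any feasible $x$ returns a finite convex combination $\zeta$ of values $\mathcal G_{h_x}(z_i)$, $z_i\in B(x,\delta)$, with $\|\zeta\|\le\epsilon$ or $h_x(x)-h_x(x-\delta\hat\zeta)\ge C\delta\epsilon$. Then the method terminates, after at most $\lceil (f(x_0)-p_\star)/(C\delta\epsilon)\rceil$ steps $x_k\mapsto x_{k+1}$, and the point it returns is $(\delta,\epsilon,3M\delta)$-GFJ stationary. **(b) Randomized subroutine.** Let oracles with $\mathcal G_f=\nabla f$, $\mathcal G_g=\nabla g$ almost everywhere (where these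 gradients exist) be given. Let $\mathcal G_{h_z}(s)=\mathcal G_f(s)$ if $f(s)-f(z)\ge g(s)$ and $\mathcal G_g(s)$ otherwise. *RandSearch* at $z$: draw $y$ uniformly from $B(z,\delta)$ and set $\zeta_0=\mathcal G_{h_z}(y)$. While $\|\zeta_t\|>\epsilon$ and $\delta\|\zeta_t\|/4\ge h_z(z)-h_z(z-\delta\hat\zeta_t)$: choose any $r$ with $0<r<\|\zeta_t\|\sqrt{1-(1-\|\zeta_t\|^2/128M^2)^2}$ (on the basis of the past), draw $y_t$ uniformly from $B(\zeta_t,r)$ and $s_t$ uniformly from the segment $[z,z-\delta y_t/\|y_t\|]$, and let $\zeta_{t+1}$ be the shortest vector of the segment $[\zeta_t,\mathcal G_{h_z}(s_t)]$. Return the last $\zeta_t$. With this subroutine the method terminates almost surely, at a point that is $(\delta,\epsilon,3M\delta)$-GFJ stationary for the Clarke subdifferential; and for every $\tau\in(0,1)$, with $X=\max\{1,\,4(f(x_0)-p_\star)/(\delta\epsilon)\}$, with probability at least $1-\tau$ it does so after at most $$\lceil X\rceil\left\lceil\frac{64M^2}{\epsilon^2}\right\rceil\left\lceil 2\log\frac{X}{\tau}\right\rceil$$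 first-order oracle calls. **(c) Deterministic subroutine.** Let $f,g$ be directionally differentiable, with oracles $F,G$ satisfying $\langle F(x,v),v\rangle=\nabla_vf(x)$, $\langle G(x,v),v\rangle=\nabla_vg(x)$ for all $x,v$, where $\nabla_v$ is the one-sided directional derivative, and $\|F(x,v)\|,\|G(x,v)\|\le M$ for $\|v\|=1$ and $x$ at distance less than $\Delta$ from $\mathcal F$. Let $\Lambda_f(\delta),\Lambda_g(\delta)$ be finite, where $\Lambda_h(\delta)$ is the supremum over $\|x-y\|\le\delta$ of the infimum of all $K\ge 0$ for which some convex $K$-Lipschitz $s:[0,\delta]\to\mathbb R$ makes $r\mapsto h(x+r(y-x)/\delta)+s(r)$ convex on $[0,\delta]$. Let $H_z(w,v)=F(w,v)$ if $f(w)-f(z)>g(w)$, or if equality holds and $\nabla_vf(w)\ge\nabla_vg(w)$; otherwise $H_z(w,v)=G(w,v)$. *BisecSearch* at $z$: $\zeta_0=H_z(z,v_0)$ for some unit vector $v_0$. While $\|\zeta_t\|>\epsilon$ and $\delta\epsilon/3>h_z(z)-h_z(z-\delta\hat\zeta_t)$: put $z(r)=z+(r-\delta)\hat\zeta_t$ and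 $l(r)=h_z(z(r))-\epsilon r/2$ on $[0,\delta]$; test the inequality $\langle H_z(z(r),\hat\zeta_t),\hat\zeta_t\rangle<\epsilon/2$ first at $r=0$ and then at the midpoints of successively halved intervals, starting with $[0,\delta]$ and always keeping the half on which $l$ decreases more (the left one in case of equality), until it holds for some $r$ (one oracle call per test); let $\zeta_{t+1}$ be the shortest vector of the segment $[\zeta_t,H_z(z(r),\hat\zeta_t)]$. Return the last $\zeta_t$. With this subroutine the method terminates after at most $$\left\lceil \max\left\{1,\frac{3(f(x_0)-p_\star)}{\delta\epsilon}\right\}\right\rceil\left\lceil\frac{16M^2}{\epsilon^2}\right\rceil\left(1+\left\lfloor\frac{12(\Lambda_f(\delta)+\Lambda_g(\delta))}{\epsilon}\right\rfloor\right)$$ oracle calls, at a point that is $(\delta,\epsilon,3M\delta)$-GFJ stationary for the directional subdifferential $\partial h(x)=\{\zeta:\exists v\ne 0,\ \langle\zeta,v\rangle=\nabla_vh(x)\}$, and even with the smaller sets of oracle values $\{F(y,v):\|v\|=1\}$, $\{G(y,v):\|v\|=1\}$ in place of $\partial f(y)$, $\partial g(y)$. -/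

import Mathlib

open Set Filter Topology MeasureTheory ProbabilityTheory
open scoped NNReal ENNReal Pointwise

noncomputable section

/-- Euclidean space `ℝⁿ`. -/
abbrev Vec (n : ℕ) := EuclideanSpace ℝ (Fin n)

/-! ### The constrained problem -/

/-- The feasible region `{x | gᵢ(x) ≤ 0 for all i}`. -/
def feasibleSet {n m : ℕ} (g : Fin m → Vec n → ℝ) : Set (Vec n) :=
  {x | ∀ i, g i x ≤ 0}

/-- The combined constraint `g(x) = maxᵢ gᵢ(x)` (used for `m ≥ 1` only). -/
def maxConstraint {n m : ℕ} (g : Fin m → Vec n → ℝ) (x : Vec n) : ℝ :=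
  ⨆ i, g i x

/-- The function `h_x(z) = max {f(z) - f(x), g(z)}`. -/
def subproblem {n : ℕ} (f g : Vec n → ℝ) (x z : Vec n) : ℝ :=
  max (f z - f x) (g z)

/-! ### Goldstein stationarity -/

/-- The Goldstein subdifferential at `x`: the convex hull of the union of the subdifferentials
`D y`, `y` in the closed ball of radius `δ` about `x`. -/
def goldstein {n : ℕ} (D : Vec n → Set (Vec n)) (δ : ℝ) (x : Vec n) : Set (Vec n) :=
  convexHull ℝ (⋃ y ∈ Metric.closedBall x δ, D y)

/-- `x` is `(δ, ε, η)`-Goldstein Fritz-John stationary; `Df` and `Dg i` are the subdifferentials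
of the objective and of the constraint functions `g i`.  The extended distance to an empty set
is infinite. -/
def IsGFJ {n m : ℕ} (Df : Vec n → Set (Vec n)) (Dg : Fin m → Vec n → Set (Vec n))
    (g : Fin m → Vec n → ℝ) (δ ε η : ℝ) (x : Vec n) : Prop :=
  x ∈ feasibleSet g ∧
  ∃ (γ₀ : ℝ) (γ : Fin m → ℝ), 0 ≤ γ₀ ∧ (∀ i, 0 ≤ γ i) ∧ γ₀ + ∑ i, γ i = 1 ∧
    Metric.infEDist (0 : Vec n) (γ₀ • goldstein Df δ x + ∑ i, γ i • goldstein (Dg i) δ x)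
      ≤ ENNReal.ofReal ε ∧
    ∀ i, ∀ y ∈ Metric.closedBall x δ, |γ i * g i y| ≤ η

/-- The Clarke subdifferential: the convex hull of all limits of gradients at points of
differentiability converging to `x`. -/
def clarke {n : ℕ} (h : Vec n → ℝ) (x : Vec n) : Set (Vec n) :=
  convexHull ℝ {u | ∃ y : ℕ → Vec n, Tendsto y atTop (𝓝 x) ∧
    (∀ i, DifferentiableAt ℝ h (y i)) ∧ Tendsto (fun i => gradient h (y i)) atTop (𝓝 u)}

/-- The one-sided directional derivative of `h` at `x` in direction `v` exists and equals `d`. -/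
def HasDirDeriv {n : ℕ} (h : Vec n → ℝ) (x v : Vec n) (d : ℝ) : Prop :=
  Tendsto (fun t : ℝ => (h (x + t • v) - h x) / t) (𝓝[>] 0) (𝓝 d)

/-- The set of directional subgradients of `h` at `x`. -/
def dirSubdiff {n : ℕ} (h : Vec n → ℝ) (x : Vec n) : Set (Vec n) :=
  {ζ | ∃ v : Vec n, v ≠ 0 ∧ HasDirDeriv h x v (inner ℝ ζ v)}

/-! ### The outer loop -/

/-- The outer loop of the method.  `A k x ζ c` says that the `k`-th call of the subroutine, made
at the point `x`, returns the vector `ζ` after `c` oracle calls.  `OuterReaches A δ ε x₀ k x N`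
says that after `k` completed steps the current iterate is `x` and `N` oracle calls have been
made. -/
inductive OuterReaches {n : ℕ} (A : ℕ → Vec n → Vec n → ℕ → Prop) (δ ε : ℝ) (x₀ : Vec n) :
    ℕ → Vec n → ℕ → Prop
  | start : OuterReaches A δ ε x₀ 0 x₀ 0
  | step (k : ℕ) (x ζ : Vec n) (N c : ℕ) (hx : OuterReaches A δ ε x₀ k x N)
      (hA : A k x ζ c) (hζ : ε < ‖ζ‖) :
      OuterReaches A δ ε x₀ (k + 1) (x - δ • (‖ζ‖⁻¹ • ζ)) (N + c)

/-- The method terminates and returns `x`, having made `N` oracle calls in total. -/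
def OuterReturns {n : ℕ} (A : ℕ → Vec n → Vec n → ℕ → Prop) (δ ε : ℝ) (x₀ x : Vec n)
    (N : ℕ) : Prop :=
  ∃ (k N' c : ℕ) (ζ : Vec n),
    OuterReaches A δ ε x₀ k x N' ∧ A k x ζ c ∧ ‖ζ‖ ≤ ε ∧ N = N' + c

/-! ### General subroutines -/

/-- The selection rule of the subgradient-type oracles.  A query at a point `z` may carry an
additional argument `v : Q` (a direction, say). -/
def IsOracleSelection {n : ℕ} {Q : Type} (f g : Vec n → ℝ) (Gf Gg : Vec n → Q → Vec n)
    (Gh : Vec n → Vec n → Q → Vec n) : Prop :=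
  ∀ x z v,
    (g z < f z - f x → Gh x z v = Gf z v) ∧
    (f z - f x = g z → Gh x z v = Gf z v ∨ Gh x z v = Gg z v) ∧
    (f z - f x < g z → Gh x z v = Gg z v)

/-- What is required of a subroutine: called at a point `x` of `S` it returns, and each vector
`ζ` that it may return is a convex combination of oracle values of `h_x` at points of the ball
`B(x, δ)` and is either short or a direction of sufficient decrease. -/
def IsMinNormSubroutine {n : ℕ} {Q : Type} (f g : Vec n → ℝ) (Gh : Vec n → Vec n → Q → Vec n)
    (S : Set (Vec n)) (δ ε C : ℝ) (A : ℕ → Vec n → Vec n → ℕ → Prop) : Prop :=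
  ∀ k, ∀ x ∈ S, (∃ ζ c, A k x ζ c) ∧
    ∀ ζ c, A k x ζ c →
      (‖ζ‖ ≤ ε ∨
        C * δ * ε ≤ subproblem f g x x - subproblem f g x (x - δ • (‖ζ‖⁻¹ • ζ))) ∧
      ζ ∈ convexHull ℝ {u | ∃ z ∈ Metric.closedBall x δ, ∃ v, u = Gh x z v}

/-! ### The point of least norm of a segment -/

/-- The point of least norm of the segment `[a, b]`, see `segMin_spec`. -/
def segMin {n : ℕ} (a b : Vec n) : Vec n :=
  a + max 0 (min 1 (inner ℝ a (a - b) / ‖a - b‖ ^ 2)) • (b - a)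

theorem segMin_spec {n : ℕ} (a b : Vec n) :
    segMin a b ∈ segment ℝ a b ∧ ∀ y ∈ segment ℝ a b, ‖segMin a b‖ ≤ ‖y‖ := by
  have key : ∀ t : ℝ, ‖a + t • (b - a)‖ ^ 2
      = ‖a‖ ^ 2 - 2 * t * inner ℝ a (a - b) + t ^ 2 * ‖a - b‖ ^ 2 := by
    intro t
    have h1 : a + t • (b - a) = a - t • (a - b) := by
      module
    rw [h1, norm_sub_sq_real, inner_smul_right, norm_smul, mul_pow, Real.norm_eq_abs, sq_abs]
    ring
  set p : ℝ := inner ℝ a (a - b) with hp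
  set s : ℝ := max 0 (min 1 (p / ‖a - b‖ ^ 2)) with hs
  have hs0 : 0 ≤ s := le_max_left _ _
  have hs1 : s ≤ 1 := max_le zero_le_one (min_le_left _ _)
  refine ⟨?_, ?_⟩
  · rw [segment_eq_image']
    exact ⟨s, ⟨hs0, hs1⟩, rfl⟩
  · intro y hy
    rw [segment_eq_image'] at hy
    obtain ⟨t, ⟨ht0, ht1⟩, rfl⟩ := hy
    refine le_of_sq_le_sq ?_ (norm_nonneg _)
    change ‖a + s • (b - a)‖ ^ 2 ≤ ‖a + t • (b - a)‖ ^ 2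
    rw [key, key]
    rcases eq_or_ne (‖a - b‖) 0 with h0 | h0
    · have : p = 0 := by
        rw [hp, norm_eq_zero.mp h0, inner_zero_right]
      rw [this, h0]; simp
    · have hq : 0 < ‖a - b‖ ^ 2 := by positivity
      set q := ‖a - b‖ ^ 2 with hqd
      have hpq : p = (p / q) * q := by field_simp
      set w := p / q with hw
      rw [hpq]
      have hmain : (s - w) ^ 2 ≤ (t - w) ^ 2 := by
        rcases le_total w 0 with hw0 | hw0
        · have : s = 0 := by
            rw [hs]; exact max_eq_left ((min_le_right _ _).trans hw0)
          rw [this]; nlinarith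
        · rcases le_total w 1 with hw1 | hw1
          · have : s = w := by
              rw [hs, min_eq_right hw1, max_eq_right hw0]
            rw [this]; nlinarith [sq_nonneg (t - w)]
          · have : s = 1 := by
              rw [hs, min_eq_left hw1, max_eq_right zero_le_one]
            rw [this]; nlinarith
      nlinarith

/-! ### The randomized subroutine -/

/-- The gradient oracle for `h_x` built from oracles `Gf` and `Gg`; it makes one oracle call. -/
def gradOracle {n : ℕ} (f g : Vec n → ℝ) (Gf Gg : Vec n → Vec n) (x z : Vec n) : Vec n :=
  open Classical in if g z ≤ f z - f x then Gf z else Gg z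

/-- The condition under which the loop of the randomized subroutine, called at `z`, goes on. -/
def RandContinue {n : ℕ} (f g : Vec n → ℝ) (δ ε : ℝ) (z ζ : Vec n) : Prop :=
  ε < ‖ζ‖ ∧
    subproblem f g z z - subproblem f g z (z - δ • (‖ζ‖⁻¹ • ζ)) ≤ δ * ‖ζ‖ / 4

/-- The vectors `ζ₀, ζ₁, …` of the randomized subroutine called at `z` (before the stopping test
is applied), where `G` is the gradient oracle of `h_z`.  With `U t` uniform in the unit ball and
`θ t` uniform in `[0, 1]`, the point `z + δ U 0` is uniform in `B(z, δ)`, the point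
`ζ + r (t + 1) U (t + 1)` is uniform in `B(ζ, r (t + 1))`, and the point queried next is uniform
on a segment of length `δ` that starts at `z`. -/
def randIter {n : ℕ} (G : Vec n → Vec n) (δ : ℝ) (z : Vec n) (U : ℕ → Vec n) (θ r : ℕ → ℝ) :
    ℕ → Vec n
  | 0 => G (z + δ • U 0)
  | t + 1 =>
    let ζ := randIter G δ z U θ r t
    let y := ζ + r (t + 1) • U (t + 1)
    segMin ζ (G (z - (θ (t + 1) * δ) • (‖y‖⁻¹ • y)))

/-- The randomized subroutine called at `z` returns `ζ` after `c` oracle calls: the loop ends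
after `c - 1` passes, and there is one oracle call before the loop. -/
def RandSearchReturns {n : ℕ} (f g : Vec n → ℝ) (Gf Gg : Vec n → Vec n) (δ ε : ℝ)
    (U : ℕ → Vec n) (θ r : ℕ → ℝ) (z ζ : Vec n) (c : ℕ) : Prop :=
  ∃ T : ℕ, c = T + 1 ∧
    (∀ t < T, RandContinue f g δ ε z (randIter (gradOracle f g Gf Gg z) δ z U θ r t)) ∧
    ¬ RandContinue f g δ ε z (randIter (gradOracle f g Gf Gg z) δ z U θ r T) ∧
    ζ = randIter (gradOracle f g Gf Gg z) δ z U θ r T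

/-- The randomness of the method.  `U k t`, `θ k t` are the draws with number `t` within the
`k`-th call of the subroutine; `ℱ (k, t)` is the information available just before them.  The
draws are uniform, independent of each other and of that information; the radius `r k t` may be
chosen in any way that depends on that information only. -/
structure IsSearchRandomness {n : ℕ} {Ω : Type*} {mΩ : MeasurableSpace Ω} (P : Measure Ω)
    (ℱ : Filtration (ℕ ×ₗ ℕ) mΩ) (U : ℕ → ℕ → Ω → Vec n) (θ r : ℕ → ℕ → Ω → ℝ) : Prop where
  measurable_U : ∀ k t, Measurable[ℱ (toLex (k, t + 1))] (U k t)
  measurable_θ : ∀ k t, Measurable[ℱ (toLex (k, t + 1))] (θ k t)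
  measurable_r : ∀ k t, Measurable[ℱ (toLex (k, t))] (r k t)
  uniform_U : ∀ k t, pdf.IsUniform (U k t) (Metric.closedBall 0 1) P volume
  uniform_θ : ∀ k t, pdf.IsUniform (θ k t) (Icc 0 1) P volume
  indep_draws : ∀ k t, IndepFun (U k t) (θ k t) P
  indep_past : ∀ k t,
    Indep (MeasurableSpace.comap (fun ω => (U k t ω, θ k t ω)) inferInstance)
      (ℱ (toLex (k, t))) P

/-! ### The deterministic subroutine -/

/-- `F` is a directional subgradient map of `h`; in particular `h` is directionally
differentiable. -/
def IsDirSubgradMap {n : ℕ} (h : Vec n → ℝ) (F : Vec n → Vec n → Vec n) : Prop :=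
  ∀ x v, HasDirDeriv h x v (inner ℝ (F x v) v)

/-- The concave deviation of `l : [0, δ] → ℝ` (infinite if no `s` exists). -/
def concaveDeviation (δ : ℝ) (l : ℝ → ℝ) : ℝ≥0∞ :=
  ⨅ (K : ℝ≥0) (_ : ∃ s : ℝ → ℝ, ConvexOn ℝ (Icc 0 δ) s ∧ LipschitzOnWith K s (Icc 0 δ) ∧
    ConvexOn ℝ (Icc 0 δ) (fun r => l r + s r)), (K : ℝ≥0∞)

/-- The nonconvexity modulus `Λ_h(δ)`. -/
def nonconvexityModulus {n : ℕ} (h : Vec n → ℝ) (δ : ℝ) : ℝ≥0∞ :=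
  ⨆ (x : Vec n) (y : Vec n) (_ : ‖x - y‖ ≤ δ),
    concaveDeviation δ (fun r => h (x + (r / δ) • (y - x)))

/-- The directional subgradient map `H_x(z, v)` of `h_x`, built from directional subgradient maps
`F` of `f` and `G` of `g`, so that `⟪F z v, v⟫` and `⟪G z v, v⟫` are the directional
derivatives. -/
def dirOracle {n : ℕ} (f g : Vec n → ℝ) (F G : Vec n → Vec n → Vec n) (x z v : Vec n) : Vec n :=
  open Classical in
  if g z < f z - f x ∨ (f z - f x = g z ∧ inner ℝ (G z v) v ≤ inner ℝ (F z v) v) then F z v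
  else G z v

/-- The intervals of the bisection for `l : [0, δ] → ℝ`: each is halved, and a half is kept on
which the average rate of decrease of `l` is at least that on the other half. -/
def bisectInterval (l : ℝ → ℝ) (δ : ℝ) : ℕ → ℝ × ℝ
  | 0 => (0, δ)
  | j + 1 =>
    let a := (bisectInterval l δ j).1
    let b := (bisectInterval l δ j).2
    let c := (a + b) / 2
    open Classical in if l b - l c < l c - l a then (c, b) else (a, c)

/-- The points at which the bisection tests the right derivative: the left end point `0`, and
then the midpoints of the successive intervals. -/
def bisectPoint (l : ℝ → ℝ) (δ : ℝ) : ℕ → ℝ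
  | 0 => 0
  | j + 1 => ((bisectInterval l δ j).1 + (bisectInterval l δ j).2) / 2

/-- The bisection returns `r` after `c` tests (one oracle call each); `neg r` is the outcome of
the test at `r`. -/
def BisectReturns (l : ℝ → ℝ) (neg : ℝ → Prop) (δ r : ℝ) (c : ℕ) : Prop :=
  ∃ j : ℕ, c = j + 1 ∧ (∀ i < j, ¬ neg (bisectPoint l δ i)) ∧ neg (bisectPoint l δ j) ∧
    r = bisectPoint l δ j

/-- The condition under which the loop of the deterministic subroutine, called at `z`,
goes on. -/
def BisecContinue {n : ℕ} (f g : Vec n → ℝ) (δ ε : ℝ) (z ζ : Vec n) : Prop :=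
  ε < ‖ζ‖ ∧
    subproblem f g z z - subproblem f g z (z - δ • (‖ζ‖⁻¹ • ζ)) < δ * ε / 3

/-- The point `z(r) = z + (r - δ) ζ / ‖ζ‖`. -/
def linePoint {n : ℕ} (δ : ℝ) (z ζ : Vec n) (r : ℝ) : Vec n :=
  z + (r - δ) • (‖ζ‖⁻¹ • ζ)

/-- `BisecReaches … z v₀ ζ N`: the deterministic subroutine, called at `z` with first query
direction `v₀`, comes to its stopping test with the vector `ζ`, having made `N` oracle calls.  In
each pass the bisection is applied to `l(r) = h_z(z(r)) - ε r / 2`. -/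
inductive BisecReaches {n : ℕ} (f g : Vec n → ℝ) (F G : Vec n → Vec n → Vec n) (δ ε : ℝ)
    (z v₀ : Vec n) : Vec n → ℕ → Prop
  | start : BisecReaches f g F G δ ε z v₀ (dirOracle f g F G z z v₀) 1
  | step (ζ : Vec n) (N c : ℕ) (r : ℝ) (hζ : BisecReaches f g F G δ ε z v₀ ζ N)
      (hcont : BisecContinue f g δ ε z ζ)
      (hbis : BisectReturns
        (fun ρ => subproblem f g z (linePoint δ z ζ ρ) - ε * ρ / 2)
        (fun ρ => inner ℝ (dirOracle f g F G z (linePoint δ z ζ ρ) (‖ζ‖⁻¹ • ζ)) (‖ζ‖⁻¹ • ζ)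
          - ε / 2 < 0) δ r c) :
      BisecReaches f g F G δ ε z v₀
        (segMin ζ (dirOracle f g F G z (linePoint δ z ζ r) (‖ζ‖⁻¹ • ζ))) (N + c)

/-- The deterministic subroutine called at `z` returns `ζ` after `c` oracle calls. -/
def BisecSearchReturns {n : ℕ} (f g : Vec n → ℝ) (F G : Vec n → Vec n → Vec n) (δ ε : ℝ)
    (v₀ z ζ : Vec n) (c : ℕ) : Prop :=
  BisecReaches f g F G δ ε z v₀ ζ c ∧ ¬ BisecContinue f g δ ε z ζ

end

/-!
The proof has a common part and one argument for each subroutine.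

*Stationarity.*  A vector returned by a subroutine called at a feasible `x` is a convex combination
of subgradients of `f` and of the constraint `g` at points of the ball `B(x, δ)`; grouping the
terms gives the multipliers.  A subgradient of `g` is used only at a point `z` with
`g z ≥ f z - f x ≥ -M δ`, so that `|g| ≤ 3 M δ` on the ball if the multiplier of `g` is not zero
(`isGFJ_of_mem_convexHull`).  Since `h_x(x) = 0` at a feasible `x`, a decrease of `h_x` by `c` makes
the next point feasible and decreases `f` by `c`, which bounds the number of steps
(`OuterReaches.descent`).

*Inner loop.*  If the new subgradient `u` satisfies `⟪u, ζ⟫ ≤ ‖ζ‖² / 2`, at least in expectation,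
then the squared norm `b` of the shortest vector of the segment is at most `b - b² / (4 M²)`, and
hence `b ≤ 4 M² / (t + 4)` after `t` passes (`norm_segMin_sq_descent`, `tangent_rate_le`).

*Deterministic subroutine.*  Let `s` be convex and `K`-Lipschitz with `l + s` convex.  A failed test
at the left end point of an interval forces the slope of `s` to vary over this interval by at least
the rate of decrease of `l`.  When an interval is halved, either the rate on the half kept doubles,
or the slope of `s` also varies on the half discarded.  Therefore the variation of the slope of `s`
minus the rate of decrease of `l` drops by a fixed amount in each halving (`bisect_potential`);
it starts below `2 K` and stays nonnegative.

*Randomized subroutine.*  Off a null set the oracles agree with the gradients of globally Lipschitz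
extensions of `f` and `g`, which are measurable and bounded.  Random queries avoid null sets, by
Fubini's theorem and scaling (`ae_ae_ray_notMem`), so that the method almost surely follows the
same path as the one with measurable oracles (`randIter_eq_innerVec`, `outerReaches_outerPoint`).
For the latter, the fundamental theorem of calculus along almost every segment gives the expected
decrease (`lintegral_segMin_sq_le`); as the draws are independent of the past it can be integrated
(`setLIntegral_innerVec_succ_le`), and Markov's inequality bounds the probability that a call
survives `⌈64 M² / ε²⌉` more passes by `1 / 16` (`measure_inter_activeSet_le`).  A union bound over
the calls, of which there are at most `⌈X⌉` because the decrease in each step is strict, concludes.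
-/

noncomputable section

/-! ### Goldstein Fritz-John stationarity from a convex combination of oracle values -/

theorem mem_feasibleSet_iff {n m : ℕ} (hm : 0 < m) (g : Fin m → Vec n → ℝ) (x : Vec n) :
    x ∈ feasibleSet g ↔ maxConstraint g x ≤ 0 := by
  have : Nonempty (Fin m) := ⟨⟨0, hm⟩⟩
  exact (ciSup_le_iff (Set.finite_range fun i => g i x).bddAbove).symm

theorem lipschitzOnWith_maxConstraint {n m : ℕ} (hm : 0 < m) {g : Fin m → Vec n → ℝ} {M : ℝ≥0}
    {S : Set (Vec n)} (hg : ∀ i, LipschitzOnWith M (g i) S) :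
    LipschitzOnWith M (maxConstraint g) S := by
  have : Nonempty (Fin m) := ⟨⟨0, hm⟩⟩
  refine LipschitzOnWith.of_le_add_mul M fun x hx y hy => ciSup_le fun i => ?_
  have h1 : g i x ≤ g i y + M * dist x y := (hg i).le_add_mul hx hy
  have h2 : g i y ≤ maxConstraint g y :=
    le_ciSup (f := fun i => g i y) (Set.finite_range fun i => g i y).bddAbove i
  linarith

theorem closedBall_subset_thickening {n m : ℕ} {g : Fin m → Vec n → ℝ} {δ Δ : ℝ} (hδΔ : δ < Δ)
    {x : Vec n} (hx : x ∈ feasibleSet g) :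
    Metric.closedBall x δ ⊆ Metric.thickening Δ (feasibleSet g) := fun _ hy =>
  Metric.mem_thickening_iff.2 ⟨x, hx, (Metric.mem_closedBall.1 hy).trans_lt hδΔ⟩

/-- A short convex combination of subgradients at points of the ball certifies stationarity,
provided that a subgradient of the constraint is used only at points where the constraint is
at least `f z - f x`.  If it is used at all then `g ≥ -M δ` at such a point, so that the Lipschitz
bound gives `|g| ≤ 3 M δ` on the whole ball; if it is not used then the multiplier of the
constraint is zero. -/
theorem isGFJ_of_mem_convexHull {n : ℕ} {f g : Vec n → ℝ} {M : ℝ≥0} {δ ε : ℝ} {x ζ : Vec n}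
    (hδ : 0 ≤ δ) (hf : LipschitzOnWith M f (Metric.closedBall x δ))
    (hg : LipschitzOnWith M g (Metric.closedBall x δ)) (hx : g x ≤ 0)
    {Df Dg : Vec n → Set (Vec n)} (hDf : (goldstein Df δ x).Nonempty)
    (hDg : (goldstein Dg δ x).Nonempty)
    (hζ : ζ ∈ convexHull ℝ {u | ∃ z ∈ Metric.closedBall x δ,
      u ∈ Df z ∨ (u ∈ Dg z ∧ f z - f x ≤ g z)}) (hε : ‖ζ‖ ≤ ε) :
    IsGFJ Df (fun _ : Fin 1 => Dg) (fun _ => g) δ ε (3 * M * δ) x := by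
  have hxx : x ∈ Metric.closedBall x δ := Metric.mem_closedBall_self hδ
  have hdist : ∀ s : Set (Vec n), ζ ∈ s → Metric.infEDist (0 : Vec n) s ≤ ENNReal.ofReal ε := by
    intro s hs
    refine (Metric.infEDist_le_edist_of_mem hs).trans ?_
    rw [edist_dist, dist_zero_left]
    exact ENNReal.ofReal_le_ofReal hε
  have hMδ : 0 ≤ (M : ℝ) * δ := mul_nonneg M.2 hδ
  refine ⟨fun _ => hx, ?_⟩
  by_cases hB : ∃ z ∈ Metric.closedBall x δ, f z - f x ≤ g z
  · obtain ⟨z, hz, hfg⟩ := hB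
    have hball : ∀ y ∈ Metric.closedBall x δ, |g y| ≤ 3 * M * δ := by
      intro y hy
      have h1 : g y ≤ g x + M * dist y x := hg.le_add_mul hy hxx
      have h2 : f x ≤ f z + M * dist x z := hf.le_add_mul hxx hz
      have h3 : g z ≤ g y + M * dist z y := hg.le_add_mul hz hy
      rw [Metric.mem_closedBall] at hy hz
      have h4 : dist z y ≤ δ + δ :=
        (dist_triangle_right z y x).trans (add_le_add hz hy)
      rw [dist_comm] at h2
      have h5 := mul_le_mul_of_nonneg_left hy M.2
      have h6 := mul_le_mul_of_nonneg_left hz M.2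
      have h7 := mul_le_mul_of_nonneg_left h4 M.2
      simp only [NNReal.val_eq_coe] at h5 h6 h7
      rw [abs_le]
      constructor <;> nlinarith
    have hmem : ζ ∈ convexJoin ℝ (goldstein Df δ x) (goldstein Dg δ x) := by
      have hconv : ∀ D : Vec n → Set (Vec n), Convex ℝ (goldstein D δ x) :=
        fun D => convex_convexHull ℝ _
      rw [← (hconv Df).convexHull_union (hconv Dg) hDf hDg]
      refine convexHull_mono ?_ hζ
      rintro u ⟨z, hz, hu | ⟨hu, -⟩⟩
      · exact Or.inl (subset_convexHull ℝ _ (mem_iUnion₂.2 ⟨z, hz, hu⟩))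
      · exact Or.inr (subset_convexHull ℝ _ (mem_iUnion₂.2 ⟨z, hz, hu⟩))
    obtain ⟨u, hu, w, hw, a, b, ha, hb, hab, rfl⟩ := mem_convexJoin.1 hmem
    refine ⟨a, fun _ => b, ha, fun _ => hb, by simpa using hab, hdist _ ?_, ?_⟩
    · rw [Fin.sum_univ_one]
      exact Set.add_mem_add (Set.smul_mem_smul_set hu) (Set.smul_mem_smul_set hw)
    · intro _ y hy
      rw [abs_mul, abs_of_nonneg hb]
      exact (mul_le_of_le_one_left (abs_nonneg _) (by linarith)).trans (hball y hy)
  · have hmem : ζ ∈ goldstein Df δ x := by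
      refine convexHull_mono ?_ hζ
      rintro u ⟨z, hz, hu | ⟨-, hu⟩⟩
      · exact mem_iUnion₂.2 ⟨z, hz, hu⟩
      · exact (hB ⟨z, hz, hu⟩).elim
    obtain ⟨w, hw⟩ := hDg
    refine ⟨1, fun _ => 0, zero_le_one, fun _ => le_rfl, by simp, hdist _ ?_, ?_⟩
    · rw [Fin.sum_univ_one]
      have := Set.add_mem_add (Set.smul_mem_smul_set (a := (1 : ℝ)) hmem)
        (Set.smul_mem_smul_set (a := (0 : ℝ)) hw)
      simpa using this
    · intro _ y _
      rw [zero_mul, abs_zero]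
      nlinarith

/-! ### Descent along the outer loop -/

theorem subproblem_self {n : ℕ} {f g : Vec n → ℝ} {x : Vec n} (hx : g x ≤ 0) :
    subproblem f g x x = 0 := by
  simp [subproblem, hx]

theorem subproblem_lt {n : ℕ} {f g : Vec n → ℝ} {x y : Vec n} {c : ℝ} (hx : g x ≤ 0)
    (h : c < subproblem f g x x - subproblem f g x y) : f y < f x - c ∧ g y < -c := by
  rw [subproblem_self hx] at h
  have h' : subproblem f g x y < -c := by linarith
  obtain ⟨h1, h2⟩ := max_lt_iff.1 h'
  exact ⟨by linarith, h2⟩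

theorem subproblem_le {n : ℕ} {f g : Vec n → ℝ} {x y : Vec n} {c : ℝ} (hx : g x ≤ 0)
    (h : c ≤ subproblem f g x x - subproblem f g x y) : f y ≤ f x - c ∧ g y ≤ -c := by
  rw [subproblem_self hx] at h
  have h' : subproblem f g x y ≤ -c := by linarith
  obtain ⟨h1, h2⟩ := max_le_iff.1 h'
  exact ⟨by linarith, h2⟩

/-- If every step decreases `h_x` by at least `c`, then all iterates are feasible and `f` has
decreased by at least `k c` after `k` steps. -/
theorem OuterReaches.descent {n : ℕ} {A : ℕ → Vec n → Vec n → ℕ → Prop} {δ ε c : ℝ}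
    {x₀ : Vec n} {f g : Vec n → ℝ} (hx₀ : g x₀ ≤ 0) (hc : 0 ≤ c)
    (hA : ∀ k x ζ N, g x ≤ 0 → A k x ζ N → ε < ‖ζ‖ →
      c ≤ subproblem f g x x - subproblem f g x (x - δ • (‖ζ‖⁻¹ • ζ)))
    {k : ℕ} {x : Vec n} {N : ℕ} (h : OuterReaches A δ ε x₀ k x N) :
    g x ≤ 0 ∧ f x + k * c ≤ f x₀ := by
  induction h with
  | start => simpa using hx₀
  | step k x ζ N c' _ hAk hζ ih =>
    obtain ⟨h1, h2⟩ := subproblem_le ih.1 (hA k x ζ c' ih.1 hAk hζ)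
    refine ⟨by linarith, ?_⟩
    push_cast
    linarith [ih.2]

/-- A loop whose number of steps is bounded, and whose subroutine always returns, terminates. -/
theorem exists_outerReturns {n : ℕ} {A : ℕ → Vec n → Vec n → ℕ → Prop} {δ ε : ℝ}
    {x₀ : Vec n} {K : ℕ} (hK : ∀ k x N, OuterReaches A δ ε x₀ k x N → k ≤ K)
    (hA : ∀ k x N, OuterReaches A δ ε x₀ k x N → ∃ ζ c, A k x ζ c) :
    ∃ x N, OuterReturns A δ ε x₀ x N := by
  by_contra hcon
  have hall : ∀ k, ∃ x N, OuterReaches A δ ε x₀ k x N := by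
    intro k
    induction k with
    | zero => exact ⟨_, _, .start⟩
    | succ k ih =>
      obtain ⟨x, N, hx⟩ := ih
      obtain ⟨ζ, c, hζ⟩ := hA k x N hx
      refine ⟨_, _, .step k x ζ N c hx hζ (lt_of_not_ge fun hle => hcon ?_)⟩
      exact ⟨x, _, k, N, c, ζ, hx, hζ, hle, rfl⟩
  obtain ⟨x, N, hx⟩ := hall (K + 1)
  have := hK _ _ _ hx
  omega

theorem sub_smul_unit_mem_closedBall {n : ℕ} {δ : ℝ} (hδ : 0 ≤ δ) (z ζ : Vec n) {s : ℝ}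
    (hs : |s| ≤ δ) : z + s • (‖ζ‖⁻¹ • ζ) ∈ Metric.closedBall z δ := by
  rw [mem_closedBall_iff_norm, add_sub_cancel_left, norm_smul, Real.norm_eq_abs]
  have h1 : ‖‖ζ‖⁻¹ • ζ‖ ≤ 1 := by
    rw [norm_smul, norm_inv, norm_norm]
    exact inv_mul_le_one
  nlinarith [abs_nonneg s, norm_nonneg (‖ζ‖⁻¹ • ζ)]

/-! ### Arbitrary subroutines -/

/-- The method with an arbitrary subroutine, for a single constraint function. -/
theorem minNorm_method {n : ℕ} {f g : Vec n → ℝ} {M : ℝ≥0} {pstar δ ε C : ℝ} {x₀ : Vec n}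
    (hp : ∀ x, g x ≤ 0 → pstar ≤ f x)
    (hf : ∀ x, g x ≤ 0 → LipschitzOnWith M f (Metric.closedBall x δ))
    (hg : ∀ x, g x ≤ 0 → LipschitzOnWith M g (Metric.closedBall x δ))
    (hx₀ : g x₀ ≤ 0) (hε : 0 < ε) (hδ : 0 < δ) (hC : 0 < C)
    {Q : Type} {Gf Gg : Vec n → Q → Vec n} {Gh : Vec n → Vec n → Q → Vec n}
    {Df Dg : Vec n → Set (Vec n)} {A : ℕ → Vec n → Vec n → ℕ → Prop}
    (hsel : IsOracleSelection f g Gf Gg Gh)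
    (hD : ∀ x, g x ≤ 0 → ∀ z ∈ Metric.closedBall x δ, ∀ v, Gf z v ∈ Df z ∧ Gg z v ∈ Dg z)
    (hA : IsMinNormSubroutine f g Gh {x | g x ≤ 0} δ ε C A) :
    (∃ x N, OuterReturns A δ ε x₀ x N) ∧
      (∀ k x N, OuterReaches A δ ε x₀ k x N → k ≤ ⌈(f x₀ - pstar) / (C * δ * ε)⌉₊) ∧
      (∀ x N, OuterReturns A δ ε x₀ x N →
        IsGFJ Df (fun _ : Fin 1 => Dg) (fun _ => g) δ ε (3 * M * δ) x) := by
  have hc : 0 < C * δ * ε := by positivity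
  have hdesc : ∀ k x N, OuterReaches A δ ε x₀ k x N →
      g x ≤ 0 ∧ f x + k * (C * δ * ε) ≤ f x₀ := fun k x N h =>
    h.descent hx₀ hc.le fun k x ζ N hx hAx hζ =>
      ((hA k x hx).2 ζ N hAx).1.resolve_left (not_le.2 hζ)
  have hbound : ∀ k x N, OuterReaches A δ ε x₀ k x N →
      k ≤ ⌈(f x₀ - pstar) / (C * δ * ε)⌉₊ := by
    intro k x N h
    obtain ⟨h1, h2⟩ := hdesc k x N h
    have : (k : ℝ) ≤ (f x₀ - pstar) / (C * δ * ε) := by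
      rw [le_div_iff₀ hc]
      linarith [hp x h1]
    exact_mod_cast this.trans (Nat.le_ceil _)
  refine ⟨exists_outerReturns hbound fun k x N h => (hA k x (hdesc k x N h).1).1, hbound, ?_⟩
  rintro x N ⟨k, N', c, ζ, hR, hAx, hζ, -⟩
  have hx := (hdesc k x N' hR).1
  have hmem := ((hA k x hx).2 ζ c hAx).2
  have hxx : x ∈ Metric.closedBall x δ := Metric.mem_closedBall_self hδ.le
  obtain ⟨-, z, -, v, -⟩ := convexHull_nonempty_iff.1 ⟨ζ, hmem⟩
  refine isGFJ_of_mem_convexHull hδ.le (hf x hx) (hg x hx) hx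
    ⟨Gf x v, subset_convexHull ℝ _ (mem_iUnion₂.2 ⟨x, hxx, (hD x hx x hxx v).1⟩)⟩
    ⟨Gg x v, subset_convexHull ℝ _ (mem_iUnion₂.2 ⟨x, hxx, (hD x hx x hxx v).2⟩)⟩
    (convexHull_mono ?_ hmem) hζ
  rintro u ⟨z, hz, v, rfl⟩
  refine ⟨z, hz, ?_⟩
  obtain ⟨s1, s2, s3⟩ := hsel x z v
  rcases lt_trichotomy (f z - f x) (g z) with hlt | heq | hgt
  · exact Or.inr ⟨s3 hlt ▸ (hD x hx z hz v).2, hlt.le⟩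
  · rcases s2 heq with h | h
    · exact Or.inl (h ▸ (hD x hx z hz v).1)
    · exact Or.inr ⟨h ▸ (hD x hx z hz v).2, heq.le⟩
  · exact Or.inl (s1 hgt ▸ (hD x hx z hz v).1)

/-! ### Decrease of the norm in a pass of the inner loop -/

theorem norm_segMin_le_left {n : ℕ} (a b : Vec n) : ‖segMin a b‖ ≤ ‖a‖ :=
  (segMin_spec a b).2 a (left_mem_segment ℝ a b)

theorem norm_segMin_sq_le {n : ℕ} (a b : Vec n) {c : ℝ} (h0 : 0 ≤ c) (h1 : c ≤ 1) :
    ‖segMin a b‖ ^ 2 ≤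
      (1 - c) ^ 2 * ‖a‖ ^ 2 + 2 * c * (1 - c) * inner ℝ b a + c ^ 2 * ‖b‖ ^ 2 := by
  have h := (segMin_spec a b).2 ((1 - c) • a + c • b)
    ⟨1 - c, c, by linarith, h0, by ring, rfl⟩
  have h2 : ‖segMin a b‖ ^ 2 ≤ ‖(1 - c) • a + c • b‖ ^ 2 :=
    pow_le_pow_left₀ (norm_nonneg _) h 2
  refine h2.trans_eq ?_
  rw [norm_add_sq_real, norm_smul, norm_smul, inner_smul_left, inner_smul_right, mul_pow, mul_pow,
    Real.norm_eq_abs, Real.norm_eq_abs, sq_abs, sq_abs, real_inner_comm]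
  simp only [conj_trivial]
  ring

/-- One pass of the inner loop with a subgradient `b` whose component in the direction of the
current vector `a` is at most `‖a‖ / 2`. -/
theorem norm_segMin_sq_descent {n : ℕ} {a b : Vec n} {M : ℝ} (hM : 0 < M) (ha : ‖a‖ ≤ M)
    (hb : ‖b‖ ≤ M) (hab : inner ℝ b a ≤ ‖a‖ ^ 2 / 2) :
    ‖segMin a b‖ ^ 2 ≤ ‖a‖ ^ 2 - (‖a‖ ^ 2) ^ 2 / (4 * M ^ 2) := by
  have ha2 : ‖a‖ ^ 2 ≤ M ^ 2 := pow_le_pow_left₀ (norm_nonneg _) ha 2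
  have hb2 : ‖b‖ ^ 2 ≤ M ^ 2 := pow_le_pow_left₀ (norm_nonneg _) hb 2
  have hM2 : 0 < M ^ 2 := by positivity
  -- the value of the coefficient minimises `(1 - c) ‖a‖² + c² M²`
  set c := ‖a‖ ^ 2 / (2 * M ^ 2) with hc
  have hc0 : 0 ≤ c := by positivity
  have hc1 : c ≤ 1 := by
    rw [hc, div_le_one (by positivity)]; linarith
  have hcM : c * (2 * M ^ 2) = ‖a‖ ^ 2 := by rw [hc]; field_simp
  have h := norm_segMin_sq_le a b hc0 hc1
  have h1 : 2 * c * (1 - c) * inner ℝ b a ≤ 2 * c * (1 - c) * (‖a‖ ^ 2 / 2) :=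
    mul_le_mul_of_nonneg_left hab (by nlinarith)
  have h2 : c ^ 2 * ‖b‖ ^ 2 ≤ c ^ 2 * M ^ 2 := mul_le_mul_of_nonneg_left hb2 (sq_nonneg _)
  have h3 : (‖a‖ ^ 2) ^ 2 / (4 * M ^ 2) = c * ‖a‖ ^ 2 / 2 := by
    rw [hc]; field_simp; ring
  rw [h3]
  nlinarith

/-- The tangent of `x ↦ x - x² / (4 M²)` at `c` lies above this function. -/
theorem sub_sq_div_le_tangent {M : ℝ} (hM : 0 < M) (c x : ℝ) :
    x - x ^ 2 / (4 * M ^ 2) ≤ (1 - c / (2 * M ^ 2)) * x + c ^ 2 / (4 * M ^ 2) := by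
  have h : (1 - c / (2 * M ^ 2)) * x + c ^ 2 / (4 * M ^ 2) - (x - x ^ 2 / (4 * M ^ 2))
      = (x - c) ^ 2 / (4 * M ^ 2) := by
    field_simp; ring
  have : 0 ≤ (x - c) ^ 2 / (4 * M ^ 2) := by positivity
  linarith

/-- The recursion `x ↦ x - x² / (4 M²)` maps `4 M² / (t + 4)` below `4 M² / (t + 5)`; stated with
the tangent at `4 M² / (t + 4)`, so that expectations can be taken. -/
theorem tangent_rate_le {M : ℝ} (hM : 0 < M) (t : ℕ) {x p : ℝ} (hp : 0 ≤ p)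
    (hx : x ≤ 4 * M ^ 2 / (t + 4) * p) :
    (1 - 4 * M ^ 2 / (t + 4) / (2 * M ^ 2)) * x + (4 * M ^ 2 / (t + 4)) ^ 2 / (4 * M ^ 2) * p
      ≤ 4 * M ^ 2 / ((t + 1 : ℕ) + 4) * p := by
  have ht : (0 : ℝ) ≤ t := Nat.cast_nonneg t
  have h1 : 1 - 4 * M ^ 2 / (t + 4) / (2 * M ^ 2) = ((t : ℝ) + 2) / (t + 4) := by
    field_simp; ring
  have h2 : (4 * M ^ 2 / ((t : ℝ) + 4)) ^ 2 / (4 * M ^ 2) = 4 * M ^ 2 / (t + 4) ^ 2 := by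
    field_simp
  rw [h1, h2]
  have h3 : ((t : ℝ) + 2) / (t + 4) * x ≤ ((t : ℝ) + 2) / (t + 4) * (4 * M ^ 2 / (t + 4) * p) :=
    mul_le_mul_of_nonneg_left hx (by positivity)
  have h4 : ((t : ℝ) + 2) / (t + 4) * (4 * M ^ 2 / (t + 4) * p) + 4 * M ^ 2 / (t + 4) ^ 2 * p
      = 4 * M ^ 2 * p * (((t : ℝ) + 3) / (t + 4) ^ 2) := by
    field_simp; ring
  have h5 : ((t : ℝ) + 3) / (t + 4) ^ 2 ≤ 1 / (t + 5) := by
    rw [div_le_div_iff₀ (by positivity) (by positivity)]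
    nlinarith
  calc _ ≤ 4 * M ^ 2 * p * (((t : ℝ) + 3) / (t + 4) ^ 2) := by linarith
    _ ≤ 4 * M ^ 2 * p * (1 / (t + 5)) := mul_le_mul_of_nonneg_left h5 (by positivity)
    _ = _ := by push_cast; rw [add_assoc]; norm_num; field_simp

theorem sq_rate_le {M : ℝ} (hM : 0 < M) (t : ℕ) {x y : ℝ} (hx : x ≤ 4 * M ^ 2 / (t + 4))
    (hy : y ≤ x - x ^ 2 / (4 * M ^ 2)) : y ≤ 4 * M ^ 2 / ((t + 1 : ℕ) + 4) := by
  have h1 := sub_sq_div_le_tangent hM (4 * M ^ 2 / (t + 4)) x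
  have h2 := tangent_rate_le (x := x) hM t zero_le_one (by rwa [mul_one])
  linarith

/-! ### Bisection for a function with a convex correction -/

/-- The right derivative at `a` of a convex function `s` on `[0, δ]`, as the infimum of slopes. -/
def rightSlope (s : ℝ → ℝ) (δ a : ℝ) : ℝ :=
  sInf ((fun t => (s t - s a) / (t - a)) '' Ioc a δ)

/-- The left derivative at `b` of a convex function `s` on `[0, δ]`, as the supremum of slopes. -/
def leftSlope (s : ℝ → ℝ) (b : ℝ) : ℝ :=
  sSup ((fun t => (s b - s t) / (b - t)) '' Ico 0 b)

theorem abs_slope_le {s : ℝ → ℝ} {δ : ℝ} {K : ℝ≥0} (hL : LipschitzOnWith K s (Icc 0 δ))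
    {x y : ℝ} (hx : 0 ≤ x) (hxy : x < y) (hy : y ≤ δ) : |(s y - s x) / (y - x)| ≤ K := by
  have hpos : 0 < y - x := sub_pos.2 hxy
  rw [abs_div, abs_of_pos hpos, div_le_iff₀ hpos]
  have := hL.dist_le_mul y ⟨hx.trans hxy.le, hy⟩ x ⟨hx, hxy.le.trans hy⟩
  rwa [Real.dist_eq, Real.dist_eq, abs_of_pos hpos] at this

theorem rightSlope_le {s : ℝ → ℝ} {δ : ℝ} {K : ℝ≥0} (hL : LipschitzOnWith K s (Icc 0 δ))
    {a x : ℝ} (ha : 0 ≤ a) (hax : a < x) (hx : x ≤ δ) :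
    rightSlope s δ a ≤ (s x - s a) / (x - a) := by
  refine csInf_le ⟨-K, ?_⟩ ⟨x, ⟨hax, hx⟩, rfl⟩
  rintro _ ⟨t, ht, rfl⟩
  exact (abs_le.1 (abs_slope_le hL ha ht.1 ht.2)).1

theorem le_leftSlope {s : ℝ → ℝ} {δ : ℝ} {K : ℝ≥0} (hL : LipschitzOnWith K s (Icc 0 δ))
    {x b : ℝ} (hx : 0 ≤ x) (hxb : x < b) (hb : b ≤ δ) :
    (s b - s x) / (b - x) ≤ leftSlope s b := by
  refine le_csSup ⟨K, ?_⟩ ⟨x, ⟨hx, hxb⟩, rfl⟩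
  rintro _ ⟨t, ht, rfl⟩
  exact (abs_le.1 (abs_slope_le hL ht.1 ht.2 hb)).2

theorem leftSlope_sub_rightSlope_le {s : ℝ → ℝ} {δ : ℝ} {K : ℝ≥0}
    (hL : LipschitzOnWith K s (Icc 0 δ)) (hδ : 0 < δ) :
    leftSlope s δ - rightSlope s δ 0 ≤ 2 * K := by
  have h1 : leftSlope s δ ≤ K := by
    refine csSup_le ⟨_, 0, ⟨le_rfl, hδ⟩, rfl⟩ ?_
    rintro _ ⟨t, ht, rfl⟩
    exact (abs_le.1 (abs_slope_le hL ht.1 ht.2 le_rfl)).2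
  have h2 : -(K : ℝ) ≤ rightSlope s δ 0 := by
    refine le_csInf ⟨_, δ, ⟨hδ, le_rfl⟩, rfl⟩ ?_
    rintro _ ⟨t, ht, rfl⟩
    exact (abs_le.1 (abs_slope_le hL le_rfl ht.1 ht.2)).1
  linarith

theorem leftSlope_le_rightSlope {s : ℝ → ℝ} {δ c : ℝ} (hs : ConvexOn ℝ (Icc 0 δ) s)
    (hc0 : 0 < c) (hcδ : c < δ) : leftSlope s c ≤ rightSlope s δ c := by
  refine csSup_le ⟨_, 0, ⟨le_rfl, hc0⟩, rfl⟩ ?_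
  rintro _ ⟨x, hx, rfl⟩
  refine le_csInf ⟨_, δ, ⟨hcδ, le_rfl⟩, rfl⟩ ?_
  rintro _ ⟨y, hy, rfl⟩
  exact hs.slope_mono_adjacent ⟨hx.1, hx.2.le.trans hcδ.le⟩ ⟨hc0.le.trans hy.1.le, hy.2⟩ hx.2 hy.1

/-- If `l + s` is convex and `l` has a nonnegative right derivative at `a`, then any decrease of
`l` over an interval `[a, x]` is paid for by an increase of the slope of `s`. -/
theorem neg_slope_le_of_rightDeriv_nonneg {l s : ℝ → ℝ} {δ : ℝ} {K : ℝ≥0}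
    (hL : LipschitzOnWith K s (Icc 0 δ)) (hls : ConvexOn ℝ (Icc 0 δ) fun r => l r + s r)
    {a d : ℝ} (ha : 0 ≤ a) (hd : 0 ≤ d)
    (hder : Tendsto (fun t : ℝ => (l (a + t) - l a) / t) (𝓝[>] 0) (𝓝 d))
    {x : ℝ} (hax : a < x) (hx : x ≤ δ) :
    -((l x - l a) / (x - a)) ≤ (s x - s a) / (x - a) - rightSlope s δ a := by
  have hev : ∀ᶠ t : ℝ in 𝓝[>] 0, (l (a + t) - l a) / t ≤
      (l x - l a) / (x - a) + (s x - s a) / (x - a) - rightSlope s δ a := by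
    have hmem : Ioo (0 : ℝ) (x - a) ∈ 𝓝[>] (0 : ℝ) := Ioo_mem_nhdsGT (sub_pos.2 hax)
    filter_upwards [hmem] with t ht
    have h1 := rightSlope_le hL ha (show a < a + t by linarith [ht.1])
      (show a + t ≤ δ by linarith [ht.2])
    have h2 := hls.secant_mono (a := a) (x := a + t) (y := x) ⟨ha, hax.le.trans hx⟩
      ⟨by linarith [ht.1], by linarith [ht.2]⟩ ⟨ha.trans hax.le, hx⟩ (by linarith [ht.1])
      hax.ne' (by linarith [ht.2])
    rw [add_sub_cancel_left] at h1 h2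
    have h3 : (l (a + t) + s (a + t) - (l a + s a)) / t
        = (l (a + t) - l a) / t + (s (a + t) - s a) / t := by ring
    have h4 : (l x + s x - (l a + s a)) / (x - a)
        = (l x - l a) / (x - a) + (s x - s a) / (x - a) := by ring
    rw [h3, h4] at h2
    linarith
  have := le_of_tendsto hder hev
  linarith

theorem bisectInterval_mem {l : ℝ → ℝ} {δ : ℝ} (hδ : 0 < δ) (j : ℕ) :
    0 ≤ (bisectInterval l δ j).1 ∧ (bisectInterval l δ j).1 < (bisectInterval l δ j).2 ∧
      (bisectInterval l δ j).2 ≤ δ := by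
  induction j with
  | zero => exact ⟨le_rfl, hδ, le_rfl⟩
  | succ j ih =>
    obtain ⟨h1, h2, h3⟩ := ih
    simp only [bisectInterval]
    split_ifs
    · exact ⟨by dsimp only; linarith, by dsimp only; linarith, h3⟩
    · exact ⟨h1, by dsimp only; linarith, by dsimp only; linarith⟩

theorem bisectPoint_mem {l : ℝ → ℝ} {δ : ℝ} (hδ : 0 < δ) (j : ℕ) :
    bisectPoint l δ j ∈ Ico 0 δ := by
  cases j with
  | zero => exact ⟨le_rfl, hδ⟩
  | succ j =>
    obtain ⟨h1, h2, h3⟩ := bisectInterval_mem (l := l) hδ j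
    exact ⟨by simp only [bisectPoint]; linarith, by simp only [bisectPoint]; linarith⟩

/-- The bisection invariant.  On the current interval `[a, b]` the variation of the slope of `s`
plus the (negative) slope of `l` decreases by at least the initial rate `-σ` of decrease of `l` in
every halving: if the half kept is less than twice as steep as the whole, then `l` also
decreases on the discarded half, which uses up variation of the slope of `s` there. -/
theorem bisect_potential {l s : ℝ → ℝ} {δ σ : ℝ} {K : ℝ≥0} (hδ : 0 < δ)
    (hs : ConvexOn ℝ (Icc 0 δ) s) (hL : LipschitzOnWith K s (Icc 0 δ))
    (hls : ConvexOn ℝ (Icc 0 δ) fun r => l r + s r) (hσ : (l δ - l 0) / (δ - 0) ≤ σ)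
    {d : ℝ → ℝ}
    (hder : ∀ r ∈ Ico 0 δ, Tendsto (fun t : ℝ => (l (r + t) - l r) / t) (𝓝[>] 0) (𝓝 (d r)))
    (j : ℕ) (hj : ∀ i ≤ j, 0 ≤ d (bisectPoint l δ i)) :
    0 ≤ d (bisectInterval l δ j).1 ∧
    (l (bisectInterval l δ j).2 - l (bisectInterval l δ j).1) /
      ((bisectInterval l δ j).2 - (bisectInterval l δ j).1) ≤ σ ∧
    leftSlope s (bisectInterval l δ j).2 - rightSlope s δ (bisectInterval l δ j).1 +
      (l (bisectInterval l δ j).2 - l (bisectInterval l δ j).1) /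
      ((bisectInterval l δ j).2 - (bisectInterval l δ j).1) ≤ 2 * K + (j + 1) * σ := by
  induction j with
  | zero =>
    refine ⟨hj 0 le_rfl, hσ, ?_⟩
    simp only [bisectInterval]
    have := leftSlope_sub_rightSlope_le hL hδ
    push_cast
    linarith
  | succ j ih =>
    obtain ⟨hda, hsl, hpot⟩ := ih fun i hi => hj i (by omega)
    obtain ⟨h0, hab, hbδ⟩ := bisectInterval_mem (l := l) hδ j
    have hdc := hj (j + 1) le_rfl
    simp only [bisectPoint] at hdc
    simp only [bisectInterval]
    generalize (bisectInterval l δ j).1 = a at *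
    generalize (bisectInterval l δ j).2 = b at *
    set c := (a + b) / 2 with hc
    have hac : a < c := by rw [hc]; linarith
    have hcb : c < b := by rw [hc]; linarith
    have hlr := leftSlope_le_rightSlope hs (h0.trans_lt hac) (hcb.trans_le hbδ)
    have hL1 := le_leftSlope hL h0 hac (hcb.le.trans hbδ)
    have hL2 := le_leftSlope hL (h0.trans hac.le) hcb hbδ
    have hN1 := neg_slope_le_of_rightDeriv_nonneg hL hls h0 hda
      (hder a ⟨h0, by linarith⟩) hac (hcb.le.trans hbδ)
    have hN2 := neg_slope_le_of_rightDeriv_nonneg hL hls (h0.trans hac.le) hdc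
      (hder c ⟨by linarith, by linarith⟩) hcb hbδ
    -- the slope on an interval is the mean of the slopes on its halves
    have hmean : (l b - l a) / (b - a) =
        ((l c - l a) / (c - a) + (l b - l c) / (b - c)) / 2 := by
      have e1 : c - a = (b - a) / 2 := by rw [hc]; ring
      have e2 : b - c = (b - a) / 2 := by rw [hc]; ring
      have e3 : b - a ≠ 0 := by linarith
      rw [e1, e2]
      field_simp
      ring
    have hcmp : ∀ u v : ℝ, u ≤ v → u / ((b - a) / 2) ≤ v / ((b - a) / 2) := fun u v h =>
      div_le_div_of_nonneg_right h (by linarith)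
    have e1 : c - a = (b - a) / 2 := by rw [hc]; ring
    have e2 : b - c = (b - a) / 2 := by rw [hc]; ring
    push_cast
    split_ifs with hif
    · have hord : (l b - l c) / (b - c) ≤ (l c - l a) / (c - a) := by
        rw [e1, e2]; exact hcmp _ _ hif.le
      refine ⟨hdc, by dsimp only; linarith, ?_⟩
      dsimp only
      linarith
    · have hord : (l c - l a) / (c - a) ≤ (l b - l c) / (b - c) := by
        rw [e1, e2]; exact hcmp _ _ (not_lt.1 hif)
      refine ⟨hda, by dsimp only; linarith, ?_⟩
      dsimp only
      linarith

/-- If all tests up to number `j` fail then `j + 1` is at most `2 K / (-σ)`. -/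
theorem bisect_count {l s : ℝ → ℝ} {δ σ : ℝ} {K : ℝ≥0} (hδ : 0 < δ)
    (hs : ConvexOn ℝ (Icc 0 δ) s) (hL : LipschitzOnWith K s (Icc 0 δ))
    (hls : ConvexOn ℝ (Icc 0 δ) fun r => l r + s r) (hσ : (l δ - l 0) / (δ - 0) ≤ σ)
    {d : ℝ → ℝ}
    (hder : ∀ r ∈ Ico 0 δ, Tendsto (fun t : ℝ => (l (r + t) - l r) / t) (𝓝[>] 0) (𝓝 (d r)))
    (j : ℕ) (hj : ∀ i ≤ j, 0 ≤ d (bisectPoint l δ i)) :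
    (j + 1) * (-σ) ≤ 2 * K := by
  obtain ⟨hda, -, hpot⟩ := bisect_potential hδ hs hL hls hσ hder j hj
  obtain ⟨h0, hab, hbδ⟩ := bisectInterval_mem (l := l) hδ j
  have hL1 := le_leftSlope hL h0 hab hbδ
  have hN1 := neg_slope_le_of_rightDeriv_nonneg hL hls h0 hda (hder _ ⟨h0, by linarith⟩) hab hbδ
  linarith

/-- The bisection succeeds, and it makes at most `1 + ⌊2 Λ / ρ⌋` tests, where `ρ` is the average
rate of decrease of `l` and the convex correction may be chosen with a Lipschitz constant
arbitrarily close to `Λ`. -/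
theorem bisect_returns {l : ℝ → ℝ} {δ ρ Λ : ℝ} (hδ : 0 < δ) (hρ : 0 < ρ)
    (hdec : (l δ - l 0) / (δ - 0) ≤ -ρ)
    (hΛ : ∀ η : ℝ, 0 < η → ∃ (K : ℝ≥0) (s : ℝ → ℝ), (K : ℝ) ≤ Λ + η ∧
      ConvexOn ℝ (Icc 0 δ) s ∧ LipschitzOnWith K s (Icc 0 δ) ∧
      ConvexOn ℝ (Icc 0 δ) fun r => l r + s r)
    {d : ℝ → ℝ}
    (hder : ∀ r ∈ Ico 0 δ, Tendsto (fun t : ℝ => (l (r + t) - l r) / t) (𝓝[>] 0) (𝓝 (d r))) :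
    (∃ r c, BisectReturns l (fun r => d r < 0) δ r c) ∧
      ∀ r c, BisectReturns l (fun r => d r < 0) δ r c →
        r ∈ Ico 0 δ ∧ d r < 0 ∧ c ≤ 1 + ⌊2 * Λ / ρ⌋₊ := by
  have hcount : ∀ j : ℕ, (∀ i ≤ j, 0 ≤ d (bisectPoint l δ i)) → ((j : ℝ) + 1) ≤ 2 * Λ / ρ := by
    intro j hj
    rw [le_div_iff₀ hρ]
    refine le_of_forall_pos_le_add fun η hη => ?_
    obtain ⟨K, s, hK, hs, hL, hls⟩ := hΛ (η / 2) (by positivity)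
    have := bisect_count hδ hs hL hls hdec hder j hj
    linarith
  constructor
  · have hex : ∃ j, d (bisectPoint l δ j) < 0 := by
      by_contra! hcon
      obtain ⟨N, hN⟩ := exists_nat_gt (2 * Λ / ρ)
      have := hcount N fun i _ => hcon i
      linarith
    classical
    exact ⟨_, _, Nat.find hex, rfl, fun i hi => Nat.find_min hex hi, Nat.find_spec hex, rfl⟩
  · rintro r c ⟨j, rfl, hj, hneg, rfl⟩
    refine ⟨bisectPoint_mem hδ j, hneg, ?_⟩
    rw [add_comm]
    refine Nat.add_le_add_left (Nat.le_floor ?_) 1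
    cases j with
    | zero =>
      have hΛ0 : 0 ≤ Λ := by
        refine le_of_forall_pos_le_add fun η hη => ?_
        obtain ⟨K, s, hK, -⟩ := hΛ η hη
        exact K.2.trans hK
      simp only [Nat.cast_zero]
      positivity
    | succ j =>
      have := hcount j fun i hi => not_lt.1 (hj i (by omega))
      exact_mod_cast this

/-! ### Directional derivatives of the subproblem -/

theorem HasDirDeriv.tendsto_ray {n : ℕ} {h : Vec n → ℝ} {x v : Vec n} {d : ℝ}
    (hd : HasDirDeriv h x v d) : Tendsto (fun t : ℝ => h (x + t • v)) (𝓝[>] 0) (𝓝 (h x)) := by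
  have h0 : Tendsto (fun t : ℝ => t) (𝓝[>] 0) (𝓝 0) :=
    tendsto_nhdsWithin_of_tendsto_nhds tendsto_id
  have h1 := (h0.mul hd).add_const (h x)
  rw [zero_mul, zero_add] at h1
  refine h1.congr' ?_
  filter_upwards [self_mem_nhdsWithin] with t ht
  have : t ≠ 0 := (mem_Ioi.1 ht).ne'
  field_simp
  ring

theorem hasDirDeriv_subproblem {n : ℕ} {f g : Vec n → ℝ} {F G : Vec n → Vec n → Vec n}
    (hF : IsDirSubgradMap f F) (hG : IsDirSubgradMap g G) (x z v : Vec n) :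
    HasDirDeriv (subproblem f g x) z v (inner ℝ (dirOracle f g F G x z v) v) := by
  have hf := hF z v
  have hg := hG z v
  have hf1 := hf.tendsto_ray.sub_const (f x)
  have hg1 := hg.tendsto_ray
  unfold HasDirDeriv at hf hg ⊢
  rcases lt_trichotomy (g z) (f z - f x) with hlt | heq | hgt
  · rw [dirOracle, if_pos (Or.inl hlt)]
    refine hf.congr' ?_
    filter_upwards [hg1.eventually_lt hf1 hlt] with t ht
    rw [subproblem, subproblem, max_eq_left ht.le, max_eq_left hlt.le]
    ring
  · have hmax : inner ℝ (dirOracle f g F G x z v) v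
        = max (inner ℝ (F z v) v : ℝ) (inner ℝ (G z v) v) := by
      rw [dirOracle]
      split_ifs with hif
      · rcases hif with hif | hif
        · exact (hif.ne heq).elim
        · exact (max_eq_left hif.2).symm
      · refine (max_eq_right (le_of_not_ge fun hle => hif (Or.inr ⟨heq.symm, hle⟩))).symm
    rw [hmax]
    refine (hf.max hg).congr' ?_
    filter_upwards [self_mem_nhdsWithin] with t ht
    rw [max_div_div_right (mem_Ioi.1 ht).le, subproblem, subproblem, ← heq, max_self,
      show f z = g z + f x by linarith, ← max_sub_sub_right]
    ring_nf
  · rw [dirOracle, if_neg (by rintro (h | h) <;> linarith)]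
    refine hg.congr' ?_
    filter_upwards [hf1.eventually_lt hg1 hgt] with t ht
    rw [subproblem, subproblem, max_eq_right ht.le, max_eq_right hgt.le]

theorem exists_convex_correction {δ : ℝ} {l : ℝ → ℝ} (hl : concaveDeviation δ l ≠ ∞) {η : ℝ}
    (hη : 0 < η) : ∃ (K : ℝ≥0) (s : ℝ → ℝ), (K : ℝ) ≤ (concaveDeviation δ l).toReal + η ∧
      ConvexOn ℝ (Icc 0 δ) s ∧ LipschitzOnWith K s (Icc 0 δ) ∧
      ConvexOn ℝ (Icc 0 δ) fun r => l r + s r := by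
  have hlt : concaveDeviation δ l < ENNReal.ofReal ((concaveDeviation δ l).toReal + η) := by
    rw [ENNReal.lt_ofReal_iff_toReal_lt hl]
    linarith
  rw [concaveDeviation] at hlt
  simp only [iInf_lt_iff] at hlt
  obtain ⟨K, ⟨s, h1, h2, h3⟩, hK⟩ := hlt
  refine ⟨K, s, ?_, h1, h2, h3⟩
  have := (ENNReal.lt_ofReal_iff_toReal_lt ENNReal.coe_ne_top).1 hK
  exact this.le

theorem concaveDeviation_le_nonconvexityModulus {n : ℕ} (h : Vec n → ℝ) {δ : ℝ} {x y : Vec n}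
    (hxy : ‖x - y‖ ≤ δ) : concaveDeviation δ (fun r => h (x + (r / δ) • (y - x))) ≤
      nonconvexityModulus h δ :=
  le_iSup_of_le x (le_iSup_of_le y (le_iSup_of_le hxy le_rfl))

/-- A convex correction for `h_z` on a segment, up to a linear function, is the sum of the
corrections for `f` and `g`. -/
theorem exists_convex_correction_subproblem {n : ℕ} {f g : Vec n → ℝ} {δ ε : ℝ} (hδ : 0 < δ)
    (hf : nonconvexityModulus f δ ≠ ∞) (hg : nonconvexityModulus g δ ≠ ∞) (z : Vec n)
    {ζ : Vec n} (hζ : ζ ≠ 0) {η : ℝ} (hη : 0 < η) :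
    ∃ (K : ℝ≥0) (s : ℝ → ℝ),
      (K : ℝ) ≤ (nonconvexityModulus f δ).toReal + (nonconvexityModulus g δ).toReal + η ∧
      ConvexOn ℝ (Icc 0 δ) s ∧ LipschitzOnWith K s (Icc 0 δ) ∧
      ConvexOn ℝ (Icc 0 δ) fun r => subproblem f g z (linePoint δ z ζ r) - ε * r / 2 + s r := by
  have hline : ∀ r : ℝ, linePoint δ z ζ r =
      linePoint δ z ζ 0 + (r / δ) • (z - linePoint δ z ζ 0) := by
    intro r
    simp only [linePoint]
    match_scalars <;> field_simp <;> ring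
  have hdist : ‖linePoint δ z ζ 0 - z‖ ≤ δ := by
    have := sub_smul_unit_mem_closedBall hδ.le z ζ (s := 0 - δ) (by simp [abs_of_pos hδ])
    rwa [mem_closedBall_iff_norm] at this
  have key : ∀ h : Vec n → ℝ, nonconvexityModulus h δ ≠ ∞ → ∃ (K : ℝ≥0) (s : ℝ → ℝ),
      (K : ℝ) ≤ (nonconvexityModulus h δ).toReal + η / 2 ∧
      ConvexOn ℝ (Icc 0 δ) s ∧ LipschitzOnWith K s (Icc 0 δ) ∧
      ConvexOn ℝ (Icc 0 δ) fun r => h (linePoint δ z ζ r) + s r := by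
    intro h hh
    have hle := concaveDeviation_le_nonconvexityModulus h hdist
    simp only [← hline] at hle
    obtain ⟨K, s, h1, h2⟩ := exists_convex_correction (ne_top_of_le_ne_top hh hle) (half_pos hη)
    exact ⟨K, s, h1.trans (by gcongr), h2⟩
  obtain ⟨K₁, s₁, hK₁, hs₁, hL₁, hc₁⟩ := key f hf
  obtain ⟨K₂, s₂, hK₂, hs₂, hL₂, hc₂⟩ := key g hg
  refine ⟨K₁ + K₂, fun r => s₁ r + s₂ r, by push_cast; linarith, hs₁.add hs₂, hL₁.add hL₂, ?_⟩
  have hlin : ConvexOn ℝ (Icc 0 δ) fun r : ℝ => -(ε / 2) * r - f z := by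
    refine ⟨convex_Icc _ _, fun x _ y _ a b _ _ hab => le_of_eq ?_⟩
    simp only [smul_eq_mul]
    linear_combination f z * hab
  have hlin' : ConvexOn ℝ (Icc 0 δ) fun r : ℝ => -(ε / 2) * r := by
    refine ⟨convex_Icc _ _, fun x _ y _ a b _ _ _ => le_of_eq ?_⟩
    simp only [smul_eq_mul]
    ring
  have h1 := (hc₁.add hs₂).add hlin
  have h2 := (hc₂.add hs₁).add hlin'
  refine (h1.sup h2).congr fun r _ => ?_
  simp only [Pi.sup_apply, Pi.add_apply, subproblem]
  rw [← max_sub_sub_right, ← max_add_add_right]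
  congr 1 <;> ring

/-! ### The deterministic subroutine -/

theorem norm_dirOracle_le {n : ℕ} {f g : Vec n → ℝ} {F G : Vec n → Vec n → Vec n} {M : ℝ}
    {x z v : Vec n} (h : ‖F z v‖ ≤ M ∧ ‖G z v‖ ≤ M) : ‖dirOracle f g F G x z v‖ ≤ M := by
  rw [dirOracle]
  split_ifs
  exacts [h.1, h.2]

theorem norm_unit {n : ℕ} {ζ : Vec n} (hζ : ζ ≠ 0) : ‖‖ζ‖⁻¹ • ζ‖ = 1 := by
  rw [norm_smul, norm_inv, norm_norm, inv_mul_cancel₀ (norm_ne_zero_iff.2 hζ)]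

theorem linePoint_mem_closedBall {n : ℕ} {δ : ℝ} (z ζ : Vec n) {r : ℝ} (hr : r ∈ Ico 0 δ) :
    linePoint δ z ζ r ∈ Metric.closedBall z δ :=
  sub_smul_unit_mem_closedBall (hr.1.trans hr.2.le) z ζ
    (by rw [abs_le]; constructor <;> linarith [hr.1, hr.2])

/-- A pass of the deterministic subroutine: the bisection returns a point whose subgradient satisfies
the hypothesis of `norm_segMin_sq_descent`. -/
theorem bisec_pass {n : ℕ} {f g : Vec n → ℝ} {F G : Vec n → Vec n → Vec n} {δ ε : ℝ}
    (hε : 0 < ε) (hδ : 0 < δ) (hF : IsDirSubgradMap f F) (hG : IsDirSubgradMap g G)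
    (hf : nonconvexityModulus f δ ≠ ∞) (hg : nonconvexityModulus g δ ≠ ∞) {z ζ : Vec n}
    (hcont : BisecContinue f g δ ε z ζ) :
    (∃ r c, BisectReturns
        (fun ρ => subproblem f g z (linePoint δ z ζ ρ) - ε * ρ / 2)
        (fun ρ => inner ℝ (dirOracle f g F G z (linePoint δ z ζ ρ) (‖ζ‖⁻¹ • ζ)) (‖ζ‖⁻¹ • ζ)
          - ε / 2 < 0) δ r c) ∧
    ∀ r c, BisectReturns
        (fun ρ => subproblem f g z (linePoint δ z ζ ρ) - ε * ρ / 2)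
        (fun ρ => inner ℝ (dirOracle f g F G z (linePoint δ z ζ ρ) (‖ζ‖⁻¹ • ζ)) (‖ζ‖⁻¹ • ζ)
          - ε / 2 < 0) δ r c →
      r ∈ Ico 0 δ ∧
      inner ℝ (dirOracle f g F G z (linePoint δ z ζ r) (‖ζ‖⁻¹ • ζ)) ζ ≤ ‖ζ‖ ^ 2 / 2 ∧
      c ≤ 1 + ⌊12 * ((nonconvexityModulus f δ).toReal +
        (nonconvexityModulus g δ).toReal) / ε⌋₊ := by
  obtain ⟨hlong, hdec⟩ := hcont
  have hpos : 0 < ‖ζ‖ := hε.trans hlong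
  have hζ : ζ ≠ 0 := norm_pos_iff.1 hpos
  have hrate : ((fun ρ => subproblem f g z (linePoint δ z ζ ρ) - ε * ρ / 2) δ -
      (fun ρ => subproblem f g z (linePoint δ z ζ ρ) - ε * ρ / 2) 0) / (δ - 0) ≤ -(ε / 6) := by
    have e1 : linePoint δ z ζ δ = z := by simp [linePoint]
    have e2 : linePoint δ z ζ 0 = z - δ • (‖ζ‖⁻¹ • ζ) := by
      simp only [linePoint]
      module
    simp only [e1, e2]
    rw [div_le_iff₀ (by linarith)]
    linarith
  obtain ⟨h1, h2⟩ := bisect_returns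
    (d := fun ρ => inner ℝ (dirOracle f g F G z (linePoint δ z ζ ρ) (‖ζ‖⁻¹ • ζ)) (‖ζ‖⁻¹ • ζ)
          - ε / 2) hδ (by positivity) hrate
    (fun η hη => exists_convex_correction_subproblem hδ hf hg z hζ hη) (fun r _ => by
      have hd := hasDirDeriv_subproblem hF hG z (linePoint δ z ζ r) (‖ζ‖⁻¹ • ζ)
      refine (hd.sub_const (ε / 2)).congr' ?_
      filter_upwards [self_mem_nhdsWithin] with t ht
      have : t ≠ 0 := (mem_Ioi.1 ht).ne'
      have e : linePoint δ z ζ (r + t) = linePoint δ z ζ r + t • (‖ζ‖⁻¹ • ζ) := by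
        simp only [linePoint]
        module
      rw [e]
      field_simp
      ring)
  refine ⟨h1, fun r c hr => ?_⟩
  obtain ⟨hrm, hneg, hc⟩ := h2 r c hr
  refine ⟨hrm, ?_, ?_⟩
  · rw [real_inner_smul_right] at hneg
    generalize (inner ℝ (dirOracle f g F G z (linePoint δ z ζ r) (‖ζ‖⁻¹ • ζ)) ζ : ℝ) = q at *
    have h3 : ‖ζ‖⁻¹ * q < ‖ζ‖ / 2 := by linarith
    rw [inv_mul_lt_iff₀ hpos] at h3
    linarith
  · refine hc.trans_eq ?_
    congr 2
    field_simp
    ring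

/-- Every vector met by the deterministic subroutine is a convex combination of oracle values,
and after `t` passes its squared norm is at most `4 M² / (t + 4)`; since the passes before the last
one have met vectors longer than `ε`, this limits `t`. -/
theorem BisecReaches.invariant {n : ℕ} {f g : Vec n → ℝ} {F G : Vec n → Vec n → Vec n}
    {M δ ε : ℝ} (hM : 0 < M) (hε : 0 < ε) (hδ : 0 < δ) (hF : IsDirSubgradMap f F)
    (hG : IsDirSubgradMap g G) (hf : nonconvexityModulus f δ ≠ ∞)
    (hg : nonconvexityModulus g δ ≠ ∞) {z v₀ : Vec n} (hv₀ : ‖v₀‖ = 1)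
    (hb : ∀ w ∈ Metric.closedBall z δ, ∀ v, ‖v‖ = 1 → ‖F w v‖ ≤ M ∧ ‖G w v‖ ≤ M)
    {ζ : Vec n} {N : ℕ} (h : BisecReaches f g F G δ ε z v₀ ζ N) :
    ζ ∈ convexHull ℝ {u | ∃ w ∈ Metric.closedBall z δ, ∃ v, ‖v‖ = 1 ∧
      u = dirOracle f g F G z w v} ∧ ‖ζ‖ ≤ M ∧
    ∃ t : ℕ, ‖ζ‖ ^ 2 ≤ 4 * M ^ 2 / (t + 4) ∧
      N ≤ 1 + t * (1 + ⌊12 * ((nonconvexityModulus f δ).toReal +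
        (nonconvexityModulus g δ).toReal) / ε⌋₊) ∧
      (t = 0 ∨ (t : ℝ) + 3 < 4 * M ^ 2 / ε ^ 2) := by
  induction h with
  | start =>
    have hz : z ∈ Metric.closedBall z δ := Metric.mem_closedBall_self hδ.le
    have hle : ‖dirOracle f g F G z z v₀‖ ≤ M := norm_dirOracle_le (hb z hz v₀ hv₀)
    refine ⟨subset_convexHull ℝ _ ⟨z, hz, v₀, hv₀, rfl⟩, hle, 0, ?_, by simp, Or.inl rfl⟩
    have := pow_le_pow_left₀ (norm_nonneg _) hle 2
    norm_num
    linarith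
  | step ζ N c r _ hcont hbis ih =>
    obtain ⟨hmem, hle, t, ht, hN, -⟩ := ih
    obtain ⟨hr, hang, hc⟩ := (bisec_pass hε hδ hF hG hf hg hcont).2 r c hbis
    have hζ : ζ ≠ 0 := norm_pos_iff.1 (hε.trans hcont.1)
    have hw := linePoint_mem_closedBall z ζ hr
    have hu := norm_dirOracle_le (f := f) (g := g) (x := z) (hb _ hw _ (norm_unit hζ))
    refine ⟨?_, (norm_segMin_le_left _ _).trans hle, t + 1, ?_, ?_, Or.inr ?_⟩
    · exact (convex_convexHull ℝ _).segment_subset hmem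
        (subset_convexHull ℝ _ ⟨_, hw, _, norm_unit hζ, rfl⟩) (segMin_spec _ _).1
    · exact sq_rate_le hM t ht (norm_segMin_sq_descent hM hle hu hang)
    · rw [add_mul, one_mul]
      omega
    · have h1 : ε ^ 2 < 4 * M ^ 2 / (t + 4) :=
        (pow_lt_pow_left₀ hcont.1 hε.le two_ne_zero).trans_le ht
      rw [lt_div_iff₀ (by positivity)] at h1 ⊢
      push_cast
      linarith

theorem bisecSearch_returns {n : ℕ} {f g : Vec n → ℝ} {F G : Vec n → Vec n → Vec n}
    {M δ ε : ℝ} (hM : 0 < M) (hε : 0 < ε) (hδ : 0 < δ) (hF : IsDirSubgradMap f F)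
    (hG : IsDirSubgradMap g G) (hf : nonconvexityModulus f δ ≠ ∞)
    (hg : nonconvexityModulus g δ ≠ ∞) {z v₀ : Vec n} (hv₀ : ‖v₀‖ = 1)
    (hb : ∀ w ∈ Metric.closedBall z δ, ∀ v, ‖v‖ = 1 → ‖F w v‖ ≤ M ∧ ‖G w v‖ ≤ M) :
    ∃ ζ c, BisecSearchReturns f g F G δ ε v₀ z ζ c := by
  by_contra hcon
  have hall : ∀ t : ℕ, ∃ ζ N, BisecReaches f g F G δ ε z v₀ ζ N ∧
      ‖ζ‖ ^ 2 ≤ 4 * M ^ 2 / (t + 4) := by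
    intro t
    induction t with
    | zero =>
      have hz : z ∈ Metric.closedBall z δ := Metric.mem_closedBall_self hδ.le
      refine ⟨_, _, .start, ?_⟩
      have := pow_le_pow_left₀ (norm_nonneg _)
        (norm_dirOracle_le (f := f) (g := g) (x := z) (hb z hz v₀ hv₀)) 2
      norm_num
      linarith
    | succ t ih =>
      obtain ⟨ζ, N, hR, ht⟩ := ih
      have hcont : BisecContinue f g δ ε z ζ := by
        by_contra hhalt
        exact hcon ⟨ζ, N, hR, hhalt⟩
      obtain ⟨⟨r, c, hrc⟩, hpass⟩ := bisec_pass hε hδ hF hG hf hg hcont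
      obtain ⟨hr, hang, -⟩ := hpass r c hrc
      have hζ : ζ ≠ 0 := norm_pos_iff.1 (hε.trans hcont.1)
      have hu := norm_dirOracle_le (f := f) (g := g) (x := z)
        (hb _ (linePoint_mem_closedBall z ζ hr) _ (norm_unit hζ))
      exact ⟨_, _, .step ζ N c r hR hcont hrc, sq_rate_le hM t ht
        (norm_segMin_sq_descent hM (hR.invariant hM hε hδ hF hG hf hg hv₀ hb).2.1 hu hang)⟩
  obtain ⟨t, ht⟩ := exists_nat_gt (4 * M ^ 2 / ε ^ 2)
  obtain ⟨ζ, N, hR, hζ⟩ := hall t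
  have hhalt : ¬ BisecContinue f g δ ε z ζ := by
    intro hcont
    have h1 : ε ^ 2 < 4 * M ^ 2 / (t + 4) :=
      (pow_lt_pow_left₀ hcont.1 hε.le two_ne_zero).trans_le hζ
    rw [lt_div_iff₀ (by positivity)] at h1
    rw [div_lt_iff₀ (by positivity)] at ht
    nlinarith [sq_nonneg ε]
  exact hcon ⟨ζ, N, hR, hhalt⟩

/-- The method with the deterministic subroutine, for a single constraint function and for all
subdifferentials that contain the oracle values for unit directions.  A step may lead to a
minimiser of `f` after exactly `3 (f x₀ - p⋆) / (δ ε)` steps, so that the number of calls of the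
subroutine may exceed the first factor of the complexity bound by one; the second factor is
generous enough to cover the additional call. -/
theorem bisec_method {n : ℕ} {f g : Vec n → ℝ} {M : ℝ≥0} (hM : 0 < M) {pstar δ ε : ℝ}
    {x₀ : Vec n} (hp : ∀ x, g x ≤ 0 → pstar ≤ f x)
    (hLf : ∀ x, g x ≤ 0 → LipschitzOnWith M f (Metric.closedBall x δ))
    (hLg : ∀ x, g x ≤ 0 → LipschitzOnWith M g (Metric.closedBall x δ))
    (hx₀ : g x₀ ≤ 0) (hε : 0 < ε) (hδ : 0 < δ) {F G : Vec n → Vec n → Vec n}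
    (hF : IsDirSubgradMap f F) (hG : IsDirSubgradMap g G)
    (hb : ∀ x, g x ≤ 0 → ∀ w ∈ Metric.closedBall x δ, ∀ v, ‖v‖ = 1 → ‖F w v‖ ≤ M ∧ ‖G w v‖ ≤ M)
    (hf : nonconvexityModulus f δ ≠ ∞) (hg : nonconvexityModulus g δ ≠ ∞)
    {v₀ : ℕ → Vec n → Vec n} (hv₀ : ∀ k z, ‖v₀ k z‖ = 1) :
    ∃ x N, OuterReturns (fun k z => BisecSearchReturns f g F G δ ε (v₀ k z) z) δ ε x₀ x N ∧
      (∀ Df Dg : Vec n → Set (Vec n),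
        (∀ z v, ‖v‖ = 1 → F z v ∈ Df z ∧ G z v ∈ Dg z) →
        IsGFJ Df (fun _ : Fin 1 => Dg) (fun _ => g) δ ε (3 * M * δ) x) ∧
      N ≤ ⌈max 1 (3 * (f x₀ - pstar) / (δ * ε))⌉₊ * ⌈16 * (M : ℝ) ^ 2 / ε ^ 2⌉₊ *
        (1 + ⌊12 * ((nonconvexityModulus f δ).toReal +
          (nonconvexityModulus g δ).toReal) / ε⌋₊) := by
  have hM' : 0 < (M : ℝ) := hM
  have hc : 0 < δ * ε / 3 := by positivity
  set A : ℕ → Vec n → Vec n → ℕ → Prop :=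
    fun k z => BisecSearchReturns f g F G δ ε (v₀ k z) z with hAdef
  set B := 1 + ⌊12 * ((nonconvexityModulus f δ).toReal +
          (nonconvexityModulus g δ).toReal) / ε⌋₊ with hB
  set T := ⌈16 * (M : ℝ) ^ 2 / ε ^ 2⌉₊ with hT
  set K := ⌈max 1 (3 * (f x₀ - pstar) / (δ * ε))⌉₊ with hK
  have hK1 : 1 ≤ K := Nat.one_le_ceil_iff.2 (lt_max_of_lt_left one_pos)
  have hT1 : 1 ≤ T := Nat.one_le_ceil_iff.2 (by positivity)
  have hinv : ∀ k x ζ c, g x ≤ 0 → A k x ζ c → _ := fun k x ζ c hx hA =>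
    hA.1.invariant hM' hε hδ hF hG hf hg (hv₀ k x) (hb x hx)
  have hdesc : ∀ k x N, OuterReaches A δ ε x₀ k x N →
      g x ≤ 0 ∧ f x + k * (δ * ε / 3) ≤ f x₀ := fun k x N h =>
    h.descent hx₀ hc.le fun k x ζ N _ hA hζ => not_lt.1 fun hlt => hA.2 ⟨hζ, hlt⟩
  have hbound : ∀ k x N, OuterReaches A δ ε x₀ k x N → k ≤ K := by
    intro k x N h
    obtain ⟨h1, h2⟩ := hdesc k x N h
    have : (k : ℝ) ≤ 3 * (f x₀ - pstar) / (δ * ε) := by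
      rw [le_div_iff₀ (by positivity)]
      linarith [hp x h1]
    exact_mod_cast (this.trans (le_max_right _ _)).trans (Nat.le_ceil _)
  obtain ⟨x, N, hret⟩ := exists_outerReturns hbound fun k x N h =>
    bisecSearch_returns hM' hε hδ hF hG hf hg (hv₀ k x) (hb x (hdesc k x N h).1)
  refine ⟨x, N, hret, ?_, ?_⟩
  · intro Df Dg hD
    obtain ⟨k, N', c, ζ, hR, hA, hζ, -⟩ := hret
    have hx := (hdesc k x N' hR).1
    have hxx : x ∈ Metric.closedBall x δ := Metric.mem_closedBall_self hδ.le
    refine isGFJ_of_mem_convexHull hδ.le (hLf x hx) (hLg x hx) hx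
      ⟨F x (v₀ k x), subset_convexHull ℝ _ (mem_iUnion₂.2 ⟨x, hxx, (hD x _ (hv₀ k x)).1⟩)⟩
      ⟨G x (v₀ k x), subset_convexHull ℝ _ (mem_iUnion₂.2 ⟨x, hxx, (hD x _ (hv₀ k x)).2⟩)⟩
      (convexHull_mono ?_ (hinv k x ζ c hx hA).1) hζ
    rintro u ⟨w, hw, v, hv, rfl⟩
    refine ⟨w, hw, ?_⟩
    rw [dirOracle]
    split_ifs with hif
    · exact Or.inl (hD w v hv).1
    · refine Or.inr ⟨(hD w v hv).2, ?_⟩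
      rw [not_or] at hif
      exact not_lt.1 hif.1
  · rcases le_or_gt (M : ℝ) ε with hMε | hMε
    · -- the first vector is already short, and a single oracle call is made
      have hfirst : ∀ k x ζ c, g x ≤ 0 → A k x ζ c → ‖ζ‖ ≤ ε := fun k x ζ c hx hA =>
        (hinv k x ζ c hx hA).2.1.trans hMε
      obtain ⟨k, N', c, ζ, hR, hA, hζ, rfl⟩ := hret
      have hx := (hdesc k x N' hR).1
      have hN' : N' = 0 := by
        cases hR with
        | start => rfl
        | step k y ξ N c₁ hR₁ hA₁ hξ =>
          exact absurd (hfirst k y ξ c₁ (hdesc k y N hR₁).1 hA₁) (not_le.2 hξ)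
      have hc1 : c = 1 := by
        cases hA.1 with
        | start => rfl
        | step ζ' N' c' r h1 h2 h3 =>
          exact absurd ((h1.invariant hM' hε hδ hF hG hf hg (hv₀ k x) (hb x hx)).2.1.trans hMε)
            (not_le.2 h2.1)
      rw [hN', hc1, zero_add]
      exact Nat.mul_pos (Nat.mul_pos hK1 hT1) (by omega)
    · have hcall : ∀ k x ζ c, g x ≤ 0 → A k x ζ c → 2 * c ≤ T * B := by
        intro k x ζ c hx hA
        obtain ⟨-, -, t, -, hN, ht⟩ := hinv k x ζ c hx hA
        have hq : (1 : ℝ) < (M : ℝ) ^ 2 / ε ^ 2 := by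
          rw [one_lt_div (by positivity)]
          exact pow_lt_pow_left₀ hMε hε.le two_ne_zero
        have hTq : 16 * ((M : ℝ) ^ 2 / ε ^ 2) ≤ T := by
          rw [← mul_div_assoc]
          exact Nat.le_ceil _
        have h2 : (2 * t + 2 : ℝ) ≤ T := by
          rcases ht with rfl | ht
          · push_cast; linarith
          · rw [mul_div_assoc] at ht; linarith
        have h3 : 2 * t + 2 ≤ T := by exact_mod_cast h2
        have hB1 : 1 ≤ B := by omega
        calc 2 * c ≤ 2 * (1 + t * B) := Nat.mul_le_mul_left 2 hN
          _ ≤ (2 * t + 2) * B := by nlinarith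
          _ ≤ T * B := Nat.mul_le_mul_right _ h3
      have htot : ∀ k x N, OuterReaches A δ ε x₀ k x N → 2 * N ≤ k * (T * B) := by
        intro k x N h
        induction h with
        | start => simp
        | step k x ζ N c hR hA _ ih =>
          have := hcall k x ζ c (hdesc k x N hR).1 hA
          rw [add_mul, one_mul]
          omega
      obtain ⟨k, N', c, ζ, hR, hA, -, rfl⟩ := hret
      have h1 := htot k x N' hR
      have h2 := hcall k x ζ c (hdesc k x N' hR).1 hA
      have h3 : k * (T * B) ≤ K * (T * B) := Nat.mul_le_mul_right _ (hbound k x N' hR)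
      have h4 : T * B ≤ K * (T * B) := Nat.le_mul_of_pos_left _ hK1
      rw [mul_assoc]
      omega

/-! ### Gradients of Lipschitz functions -/

theorem norm_gradient_le {n : ℕ} {h : Vec n → ℝ} {M : ℝ≥0} (hh : LipschitzWith M h) (x : Vec n) :
    ‖gradient h x‖ ≤ M := by
  rw [gradient, LinearIsometryEquiv.norm_map]
  exact norm_fderiv_le_of_lipschitz ℝ hh

theorem measurable_gradient {n : ℕ} (h : Vec n → ℝ) : Measurable (gradient h) :=
  (LinearIsometryEquiv.continuous _).measurable.comp (measurable_fderiv ℝ h)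

theorem gradient_eq_of_le {n : ℕ} {p q : Vec n → ℝ} {s : Vec n} (hp : DifferentiableAt ℝ p s)
    (hq : DifferentiableAt ℝ q s) (hle : ∀ y, q y ≤ p y) (heq : q s = p s) :
    gradient q s = gradient p s := by
  have hmin : IsLocalMin (p - q) s := by
    refine Filter.Eventually.of_forall fun y => ?_
    simp only [Pi.sub_apply, heq, sub_self, sub_nonneg]
    exact hle y
  have h0 := hmin.fderiv_eq_zero
  rw [fderiv_sub hp hq, sub_eq_zero] at h0
  rw [gradient, gradient, h0]

/-- The gradient oracle of `h_z` returns the gradient of `h_z`, also at ties: the pieces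
`f - f z` and `g` minorise `h_z`, so that a piece that is active has the same gradient. -/
theorem gradOracle_gradient {n : ℕ} {f g : Vec n → ℝ} {z s : Vec n} (hf : DifferentiableAt ℝ f s)
    (hg : DifferentiableAt ℝ g s) (hh : DifferentiableAt ℝ (subproblem f g z) s) :
    gradOracle f g (gradient f) (gradient g) z s = gradient (subproblem f g z) s := by
  rw [gradOracle]
  split_ifs with hif
  · have h1 : gradient (fun y => f y - f z) s = gradient f s := by
      rw [gradient, gradient, fderiv_sub_const]
    rw [← h1]
    exact gradient_eq_of_le hh (hf.sub_const _) (fun y => le_max_left _ _) (max_eq_left hif).symm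
  · exact gradient_eq_of_le hh hg (fun y => le_max_right _ _)
      (max_eq_right (not_le.1 hif).le).symm

theorem norm_gradOracle_le {n : ℕ} {f g : Vec n → ℝ} {M : ℝ≥0} (hf : LipschitzWith M f)
    (hg : LipschitzWith M g) (z s : Vec n) :
    ‖gradOracle f g (gradient f) (gradient g) z s‖ ≤ M := by
  rw [gradOracle]
  split_ifs
  exacts [norm_gradient_le hf s, norm_gradient_le hg s]

theorem measurable_gradOracle {n : ℕ} {f g : Vec n → ℝ} (hf : Measurable f) (hg : Measurable g) :
    Measurable fun p : Vec n × Vec n => gradOracle f g (gradient f) (gradient g) p.1 p.2 := by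
  classical
  unfold gradOracle
  refine Measurable.ite (measurableSet_le (by fun_prop) (by fun_prop))
    ((measurable_gradient f).comp measurable_snd) ((measurable_gradient g).comp measurable_snd)

theorem lipschitzWith_subproblem {n : ℕ} {f g : Vec n → ℝ} {M : ℝ≥0} (hf : LipschitzWith M f)
    (hg : LipschitzWith M g) (z : Vec n) : LipschitzWith M (subproblem f g z) := by
  have h1 : LipschitzWith M fun y => f y - f z :=
    LipschitzWith.of_le_add_mul M fun x y => by linarith [hf.le_add_mul x y]
  have := h1.max hg
  rwa [max_self] at this

/-! ### Random points on random segments -/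

/-- A point on a segment that starts at `z` and has a random direction avoids a null set: for
almost every direction, almost every point of the line does. -/
theorem ae_ae_ray_notMem {n : ℕ} (hn : 0 < n) {N : Set (Vec n)} (hN : volume N = 0) (z : Vec n)
    {δ : ℝ} (hδ : 0 < δ) :
    ∀ᵐ y : Vec n, ∀ᵐ t : ℝ, z - (t * δ) • (‖y‖⁻¹ • y) ∉ N := by
  have : Nonempty (Fin n) := ⟨⟨0, hn⟩⟩
  set N' := toMeasurable volume N with hN'
  have hN'm : MeasurableSet N' := measurableSet_toMeasurable _ _
  have hN'0 : volume N' = 0 := by rw [hN', measure_toMeasurable, hN]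
  have hmeas : MeasurableSet {p : Vec n × ℝ | z - p.2 • p.1 ∉ N'} :=
    (hN'm.preimage (f := fun p : Vec n × ℝ => z - p.2 • p.1) (by fun_prop)).compl
  have hswap : ∀ᵐ y : Vec n, ∀ᵐ t : ℝ, z - t • y ∉ N' := by
    rw [Measure.ae_ae_comm (p := fun (y : Vec n) (t : ℝ) => z - t • y ∉ N') hmeas]
    have hne : ∀ᵐ t : ℝ, t ≠ 0 := Measure.ae_ne volume 0
    filter_upwards [hne] with t ht
    have hq : Measure.QuasiMeasurePreserving (fun y : Vec n => z - t • y) volume volume :=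
      (Measure.measurePreserving_sub_left volume z).quasiMeasurePreserving.comp
        (Measure.quasiMeasurePreserving_smul volume ht)
    exact measure_eq_zero_iff_ae_notMem.1 (hq.preimage_null hN'0)
  have hne : ∀ᵐ y : Vec n, y ≠ 0 := Measure.ae_ne volume 0
  filter_upwards [hswap, hne] with y hy hy0
  have hc : δ * ‖y‖⁻¹ ≠ 0 := mul_ne_zero hδ.ne' (inv_ne_zero (norm_ne_zero_iff.2 hy0))
  have hq := Measure.quasiMeasurePreserving_smul (volume : Measure ℝ) hc
  filter_upwards [hq.ae hy] with t ht hmem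
  refine ht (subset_toMeasurable _ _ ?_)
  convert hmem using 2
  rw [smul_smul, smul_eq_mul]
  ring_nf

/-- The fundamental theorem of calculus for `h_z` along a segment on which the gradient exists
almost everywhere. -/
theorem integral_inner_gradOracle {n : ℕ} {f g : Vec n → ℝ} {M : ℝ≥0} (hf : LipschitzWith M f)
    (hg : LipschitzWith M g) {z e : Vec n} {δ : ℝ} (hδ : 0 < δ)
    (he : ∀ᵐ t : ℝ, DifferentiableAt ℝ f (z - (t * δ) • e) ∧
      DifferentiableAt ℝ g (z - (t * δ) • e) ∧
      DifferentiableAt ℝ (subproblem f g z) (z - (t * δ) • e)) :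
    ∫ t in (0 : ℝ)..1, (inner ℝ
        (gradOracle f g (gradient f) (gradient g) z (z - (t * δ) • e)) e : ℝ)
      = (subproblem f g z z - subproblem f g z (z - δ • e)) / δ := by
  set h := subproblem f g z with hh
  have hlip : LipschitzWith M h := lipschitzWith_subproblem hf hg z
  have hline : LipschitzWith (‖δ • e‖₊) fun t : ℝ => z - (t * δ) • e := by
    refine LipschitzWith.of_dist_le_mul fun s t => ?_
    rw [dist_sub_left, dist_eq_norm, ← sub_smul, ← sub_mul, mul_smul, norm_smul, Real.dist_eq,
      coe_nnnorm, mul_comm, Real.norm_eq_abs]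
  have hac : AbsolutelyContinuousOnInterval (fun t : ℝ => h (z - (t * δ) • e)) 0 1 :=
    ((hlip.comp hline).lipschitzOnWith (s := uIcc 0 1)).absolutelyContinuousOnInterval
  have hftc := hac.integral_deriv_eq_sub
  have hcongr : ∫ t in (0 : ℝ)..1, deriv (fun t : ℝ => h (z - (t * δ) • e)) t
      = ∫ t in (0 : ℝ)..1, (-δ) * (inner ℝ
        (gradOracle f g (gradient f) (gradient g) z (z - (t * δ) • e)) e : ℝ) := by
    refine intervalIntegral.integral_congr_ae ?_
    filter_upwards [he] with t ht _
    rw [gradOracle_gradient ht.1 ht.2.1 ht.2.2]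
    have h1 : HasDerivAt (fun t : ℝ => z - (t * δ) • e) (-(δ • e)) t := by
      have := (((hasDerivAt_id t).mul_const δ).smul_const e).const_sub z
      simpa using this
    have h2 := (ht.2.2.hasFDerivAt.comp_hasDerivAt t h1).deriv
    rw [Function.comp_def] at h2
    rw [h2, map_neg, map_smul, ← inner_gradient_left, smul_eq_mul]
    ring
  rw [hcongr, intervalIntegral.integral_const_mul] at hftc
  simp only [zero_mul, zero_smul, sub_zero, one_mul] at hftc
  rw [eq_div_iff hδ.ne']
  linarith

/-- Perturbing `ζ` by less than the admissible radius changes its direction by at most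
`‖ζ‖ / (8 M)`. -/
theorem norm_unit_sub_unit_le {n : ℕ} {ζ y : Vec n} {M r : ℝ} (hM : 0 < M) (hζ : ζ ≠ 0)
    (hζM : ‖ζ‖ ≤ M) (hr : r < ‖ζ‖ * √(1 - (1 - ‖ζ‖ ^ 2 / (128 * M ^ 2)) ^ 2))
    (hy : ‖y - ζ‖ ≤ r) (hy0 : y ≠ 0) :
    ‖‖y‖⁻¹ • y - ‖ζ‖⁻¹ • ζ‖ ≤ ‖ζ‖ / (8 * M) := by
  have hpos : 0 < ‖ζ‖ := norm_pos_iff.2 hζ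
  have hypos : 0 < ‖y‖ := norm_pos_iff.2 hy0
  set a := ‖ζ‖ ^ 2 / (128 * M ^ 2) with ha
  have ha0 : 0 ≤ a := by positivity
  have ha1 : a ≤ 1 := by
    rw [ha, div_le_one (by positivity)]
    nlinarith [pow_le_pow_left₀ hpos.le hζM 2, pow_pos hM 2]
  have hsq : ‖y - ζ‖ ^ 2 ≤ ‖ζ‖ ^ 2 * (1 - (1 - a) ^ 2) := by
    have h1 : ‖y - ζ‖ ≤ ‖ζ‖ * √(1 - (1 - a) ^ 2) := hy.trans hr.le
    have h2 := pow_le_pow_left₀ (norm_nonneg _) h1 2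
    rwa [mul_pow, Real.sq_sqrt (by nlinarith)] at h2
  have hinner : (1 - a) * (‖y‖ * ‖ζ‖) ≤ inner ℝ y ζ := by
    rw [norm_sub_sq_real] at hsq
    nlinarith [sq_nonneg (‖y‖ - (1 - a) * ‖ζ‖)]
  have hdist : ‖‖y‖⁻¹ • y - ‖ζ‖⁻¹ • ζ‖ ^ 2 ≤ (‖ζ‖ / (8 * M)) ^ 2 := by
    rw [norm_sub_sq_real, norm_unit hy0, norm_unit hζ, real_inner_smul_left, real_inner_smul_right]
    have h3 : 1 - a ≤ ‖y‖⁻¹ * (‖ζ‖⁻¹ * inner ℝ y ζ) := by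
      rw [← mul_assoc, ← mul_inv, inv_mul_eq_div, le_div_iff₀ (by positivity)]
      exact hinner
    have h4 : (‖ζ‖ / (8 * M)) ^ 2 = 2 * a := by
      rw [ha]; field_simp; norm_num
    rw [h4]
    linarith
  exact le_of_sq_le_sq hdist (by positivity)

/-- Expected decrease of the squared norm in a pass of the randomized subroutine, for a fixed
perturbed direction and a uniform point of the segment. -/
theorem lintegral_segMin_sq_le {n : ℕ} {f g : Vec n → ℝ} {M : ℝ≥0} (hM : 0 < M)
    (hf : LipschitzWith M f) (hg : LipschitzWith M g) {z ζ y : Vec n} {δ r : ℝ} (hδ : 0 < δ)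
    (hζ : ζ ≠ 0) (hζM : ‖ζ‖ ≤ M)
    (hdec : subproblem f g z z - subproblem f g z (z - δ • (‖ζ‖⁻¹ • ζ)) ≤ δ * ‖ζ‖ / 4)
    (hr : r < ‖ζ‖ * √(1 - (1 - ‖ζ‖ ^ 2 / (128 * (M : ℝ) ^ 2)) ^ 2))
    (hy : ‖y - ζ‖ ≤ r) (hy0 : y ≠ 0)
    (he : ∀ᵐ t : ℝ, DifferentiableAt ℝ f (z - (t * δ) • (‖y‖⁻¹ • y)) ∧
      DifferentiableAt ℝ g (z - (t * δ) • (‖y‖⁻¹ • y)) ∧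
      DifferentiableAt ℝ (subproblem f g z) (z - (t * δ) • (‖y‖⁻¹ • y))) :
    ∫⁻ t in Icc (0 : ℝ) 1, ENNReal.ofReal (‖segMin ζ
        (gradOracle f g (gradient f) (gradient g) z (z - (t * δ) • (‖y‖⁻¹ • y)))‖ ^ 2)
      ≤ ENNReal.ofReal (‖ζ‖ ^ 2 - (‖ζ‖ ^ 2) ^ 2 / (4 * (M : ℝ) ^ 2)) := by
  have hM' : 0 < (M : ℝ) := hM
  have hpos : 0 < ‖ζ‖ := norm_pos_iff.2 hζ
  have hang := norm_unit_sub_unit_le hM' hζ hζM hr hy hy0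
  set e := ‖y‖⁻¹ • y with hedef
  set w := ‖ζ‖⁻¹ • ζ with hwdef
  set γ : ℝ → Vec n := fun t => gradOracle f g (gradient f) (gradient g) z (z - (t * δ) • e) with hγ
  have hγM : ∀ t, ‖γ t‖ ≤ M := fun t => norm_gradOracle_le hf hg _ _
  have hγm : Measurable γ :=
    (measurable_gradOracle hf.continuous.measurable hg.continuous.measurable).comp
      (g := fun p : Vec n × Vec n => gradOracle f g (gradient f) (gradient g) p.1 p.2)
      (f := fun t : ℝ => (z, z - (t * δ) • e)) (by fun_prop)
  have hint : ∀ v : Vec n, IntegrableOn (fun t => (inner ℝ (γ t) v : ℝ)) (Icc 0 1) := by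
    intro v
    refine Measure.integrableOn_of_bounded (M := M * ‖v‖) (by simp)
      (hγm.inner_const.aestronglyMeasurable) (Filter.Eventually.of_forall fun t => ?_)
    exact (norm_inner_le_norm _ _).trans (mul_le_mul_of_nonneg_right (hγM t) (norm_nonneg _))
  have hconst : ∀ a : ℝ, IntegrableOn (fun _ : ℝ => a) (Icc 0 1) := fun a =>
    continuous_const.integrableOn_Icc
  have hw1 : ‖ζ‖ • w = ζ := smul_inv_smul₀ hpos.ne' ζ
  -- the mean slope along the perturbed direction is small
  have hmean : ∫ t in Icc (0 : ℝ) 1, (inner ℝ (γ t) ζ : ℝ) ≤ ‖ζ‖ ^ 2 / 2 := by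
    have h1 := integral_inner_gradOracle hf hg hδ he
    rw [intervalIntegral.integral_of_le zero_le_one, ← integral_Icc_eq_integral_Ioc] at h1
    have h2 : ∀ t, (inner ℝ (γ t) ζ : ℝ) ≤ ‖ζ‖ * inner ℝ (γ t) e + ‖ζ‖ * (‖ζ‖ / 8) := by
      intro t
      have e1 : ζ = ‖ζ‖ • e - ‖ζ‖ • (e - w) := by
        rw [smul_sub, hw1, sub_sub_cancel]
      have e2 : -(inner ℝ (γ t) (e - w) : ℝ) ≤ ‖ζ‖ / 8 := by
        have h3 := neg_le_of_abs_le (abs_real_inner_le_norm (γ t) (e - w))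
        have h4 : ‖γ t‖ * ‖e - w‖ ≤ M * (‖ζ‖ / (8 * M)) :=
          mul_le_mul (hγM t) hang (norm_nonneg _) hM'.le
        have h5 : (M : ℝ) * (‖ζ‖ / (8 * M)) = ‖ζ‖ / 8 := by field_simp
        linarith
      have e3 : (inner ℝ (γ t) ζ : ℝ) = ‖ζ‖ * inner ℝ (γ t) e - ‖ζ‖ * inner ℝ (γ t) (e - w) := by
        conv_lhs => rw [e1]
        rw [inner_sub_right, real_inner_smul_right (γ t) e, real_inner_smul_right (γ t) (e - w)]
      rw [e3]
      nlinarith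
    have h3 : ∫ t in Icc (0 : ℝ) 1, (inner ℝ (γ t) ζ : ℝ)
        ≤ ∫ t in Icc (0 : ℝ) 1, (‖ζ‖ * inner ℝ (γ t) e + ‖ζ‖ * (‖ζ‖ / 8)) :=
      setIntegral_mono (hint ζ) (((hint e).const_mul _).add (hconst _)) h2
    rw [integral_add ((hint e).const_mul _) (hconst _), integral_const_mul, h1] at h3
    simp only [integral_const, MeasurableSet.univ, measureReal_restrict_apply, univ_inter,
      Real.volume_real_Icc, sub_zero, zero_le_one, sup_of_le_left, one_smul] at h3
    have h4 : (subproblem f g z z - subproblem f g z (z - δ • e)) / δ ≤ ‖ζ‖ / 4 + ‖ζ‖ / 8 := by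
      rw [div_le_iff₀ hδ]
      have h5 := (lipschitzWith_subproblem hf hg z).le_add_mul (z - δ • w) (z - δ • e)
      rw [dist_sub_left, dist_eq_norm, ← smul_sub, norm_smul, Real.norm_of_nonneg hδ.le,
        norm_sub_rev] at h5
      have h6 : (M : ℝ) * (δ * ‖e - w‖) ≤ M * (δ * (‖ζ‖ / (8 * M))) := by gcongr
      have h7 : (M : ℝ) * (δ * (‖ζ‖ / (8 * M))) = δ * ‖ζ‖ / 8 := by field_simp
      linarith
    nlinarith [mul_le_mul_of_nonneg_left h4 hpos.le]
  have hb2 : ‖ζ‖ ^ 2 ≤ (M : ℝ) ^ 2 := pow_le_pow_left₀ hpos.le hζM 2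
  set c := ‖ζ‖ ^ 2 / (2 * (M : ℝ) ^ 2) with hc
  have hc0 : 0 ≤ c := by positivity
  have hc1 : c ≤ 1 := by
    rw [hc, div_le_one (by positivity)]; nlinarith [sq_nonneg (M : ℝ)]
  have hcM : c * (2 * (M : ℝ) ^ 2) = ‖ζ‖ ^ 2 := by rw [hc]; field_simp
  set q : ℝ → ℝ := fun t => (1 - c) ^ 2 * ‖ζ‖ ^ 2 + c ^ 2 * (M : ℝ) ^ 2 +
    2 * c * (1 - c) * inner ℝ (γ t) ζ with hq
  have hle : ∀ t, ‖segMin ζ (γ t)‖ ^ 2 ≤ q t := by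
    intro t
    have h1 := norm_segMin_sq_le ζ (γ t) hc0 hc1
    have h2 : c ^ 2 * ‖γ t‖ ^ 2 ≤ c ^ 2 * (M : ℝ) ^ 2 :=
      mul_le_mul_of_nonneg_left (pow_le_pow_left₀ (norm_nonneg _) (hγM t) 2) (sq_nonneg _)
    rw [hq]
    linarith
  have hqint : IntegrableOn q (Icc 0 1) :=
    IntegrableOn.add (hconst _) ((hint ζ).const_mul _)
  have hqval : ∫ t in Icc (0 : ℝ) 1, q t ≤ ‖ζ‖ ^ 2 - (‖ζ‖ ^ 2) ^ 2 / (4 * (M : ℝ) ^ 2) := by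
    rw [hq, integral_add (hconst _) ((hint ζ).const_mul _), integral_const_mul]
    simp only [integral_const, MeasurableSet.univ, measureReal_restrict_apply, univ_inter,
      Real.volume_real_Icc, sub_zero, zero_le_one, sup_of_le_left, one_smul]
    have h1 := mul_le_mul_of_nonneg_left hmean (show 0 ≤ 2 * c * (1 - c) by nlinarith)
    have h3 : (‖ζ‖ ^ 2) ^ 2 / (4 * (M : ℝ) ^ 2) = c * ‖ζ‖ ^ 2 / 2 := by
      rw [hc]; field_simp; ring
    rw [h3]
    nlinarith
  calc _ ≤ ∫⁻ t in Icc (0 : ℝ) 1, ENNReal.ofReal (q t) :=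
        lintegral_mono fun t => ENNReal.ofReal_le_ofReal (hle t)
    _ = ENNReal.ofReal (∫ t in Icc (0 : ℝ) 1, q t) :=
        (ofReal_integral_eq_lintegral_ofReal hqint
          (Filter.Eventually.of_forall fun t => (sq_nonneg _).trans (hle t))).symm
    _ ≤ _ := ENNReal.ofReal_le_ofReal hqval

/-! ### Independence of a draw from the past -/

/-- If `X` is known and `Y` is independent of what is known, then `Y` may be integrated out. -/
theorem setLIntegral_of_indep {Ω α β : Type*} {m mΩ : MeasurableSpace Ω} {P : Measure Ω}
    [IsProbabilityMeasure P] (hm : m ≤ mΩ) [MeasurableSpace α]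
    [mβ : MeasurableSpace β] {X : Ω → α} {Y : Ω → β} (hX : Measurable[m] X) (hY : Measurable Y)
    (hind : Indep (mβ.comap Y) m P) {Ψ : α × β → ℝ≥0∞} (hΨ : Measurable Ψ) {D : Set Ω}
    (hD : MeasurableSet[m] D) :
    ∫⁻ ω in D, Ψ (X ω, Y ω) ∂P = ∫⁻ ω in D, ∫⁻ y, Ψ (X ω, y) ∂(P.map Y) ∂P := by
  have hDΩ : MeasurableSet D := hm D hD
  have hXΩ : Measurable X := hX.mono hm le_rfl
  set d : Ω → ℝ≥0∞ := D.indicator fun _ => 1 with hd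
  have hdm : Measurable[m] d := measurable_const.indicator hD
  have hXd : Measurable[m] fun ω => (X ω, d ω) := Measurable.prodMk (m := m) hX hdm
  have hXdΩ : Measurable fun ω => (X ω, d ω) := hXd.mono hm le_rfl
  have hindep : IndepFun (fun ω => (X ω, d ω)) Y P := by
    rw [IndepFun_iff_Indep]
    exact (indep_of_indep_of_le_right hind hXd.comap_le).symm
  have hmap := (indepFun_iff_map_prod_eq_prod_map_map hXdΩ.aemeasurable hY.aemeasurable).1 hindep
  have hfun : Measurable fun p : (α × ℝ≥0∞) × β => p.1.2 * Ψ (p.1.1, p.2) :=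
    (measurable_snd.comp measurable_fst).mul
      (hΨ.comp ((measurable_fst.comp measurable_fst).prodMk measurable_snd))
  have : IsProbabilityMeasure (P.map Y) := Measure.isProbabilityMeasure_map hY.aemeasurable
  have hind : ∀ φ : Ω → ℝ≥0∞, ∫⁻ ω in D, φ ω ∂P = ∫⁻ ω, d ω * φ ω ∂P := by
    intro φ
    rw [← lintegral_indicator hDΩ]
    refine lintegral_congr fun ω => ?_
    by_cases h : ω ∈ D <;> simp [hd, h]
  calc ∫⁻ ω in D, Ψ (X ω, Y ω) ∂P
      = ∫⁻ p, p.1.2 * Ψ (p.1.1, p.2) ∂(P.map fun ω => ((X ω, d ω), Y ω)) := by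
        rw [hind, lintegral_map hfun (hXdΩ.prodMk hY)]
    _ = ∫⁻ a, ∫⁻ y, a.2 * Ψ (a.1, y) ∂(P.map Y) ∂(P.map fun ω => (X ω, d ω)) := by
        rw [hmap, lintegral_prod _ hfun.aemeasurable]
    _ = ∫⁻ ω, ∫⁻ y, d ω * Ψ (X ω, y) ∂(P.map Y) ∂P := by
        rw [lintegral_map hfun.lintegral_prod_right' hXdΩ]
    _ = _ := by
        rw [hind]
        refine lintegral_congr fun ω => ?_
        exact lintegral_const_mul _ (hΨ.comp measurable_prodMk_left)

/-- A property that a draw has almost surely for every fixed past holds almost surely. -/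
theorem ae_of_indep {Ω α β : Type*} {m mΩ : MeasurableSpace Ω} {P : Measure Ω}
    [IsProbabilityMeasure P] (hm : m ≤ mΩ) [MeasurableSpace α]
    [mβ : MeasurableSpace β] {X : Ω → α} {Y : Ω → β} (hX : Measurable[m] X) (hY : Measurable Y)
    (hind : Indep (mβ.comap Y) m P) {S : Set (α × β)} (hS : MeasurableSet S) {D : Set Ω}
    (hD : MeasurableSet[m] D) (h : ∀ ω ∈ D, ∀ᵐ y ∂(P.map Y), (X ω, y) ∈ S) :
    ∀ᵐ ω ∂P, ω ∈ D → (X ω, Y ω) ∈ S := by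
  have hDΩ : MeasurableSet D := hm D hD
  have hXY : Measurable fun ω => (X ω, Y ω) := (hX.mono hm le_rfl).prodMk hY
  have hΨ : Measurable (Sᶜ.indicator (1 : α × β → ℝ≥0∞)) := measurable_one.indicator hS.compl
  have h1 := setLIntegral_of_indep hm hX hY hind hΨ hD
  have h2 : ∫⁻ ω in D, ∫⁻ y, Sᶜ.indicator (1 : α × β → ℝ≥0∞) (X ω, y) ∂(P.map Y) ∂P = 0 := by
    rw [setLIntegral_congr_fun (g := fun _ => 0) hDΩ, lintegral_zero]
    intro ω hω
    dsimp only
    refine (lintegral_eq_zero_iff (hΨ.comp measurable_prodMk_left)).2 ?_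
    filter_upwards [h ω hω] with y hy
    simp [hy]
  have h3 := (lintegral_eq_zero_iff (hΨ.comp hXY)).1 (h1.trans h2)
  filter_upwards [(ae_restrict_iff' hDΩ).1 h3] with ω hω hωD
  by_contra hcon
  have := hω hωD
  simp [hcon] at this

/-! ### One draw of the randomized subroutine -/

/-- The point that the randomized subroutine queries at `z`: the direction is that of
`ζ + r u`, and `t` gives the position on the segment. -/
def raySample {n : ℕ} (δ : ℝ) (z ζ : Vec n) (r : ℝ) (u : Vec n) (t : ℝ) : Vec n :=
  z - (t * δ) • (‖ζ + r • u‖⁻¹ • (ζ + r • u))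

theorem measurable_raySample {n : ℕ} (δ : ℝ) : Measurable
    fun p : (Vec n × Vec n × ℝ) × (Vec n × ℝ) => raySample δ p.1.1 p.1.2.1 p.1.2.2 p.2.1 p.2.2 := by
  unfold raySample
  fun_prop

theorem raySample_mem_closedBall {n : ℕ} {δ : ℝ} (hδ : 0 ≤ δ) (z ζ : Vec n) (r : ℝ) (u : Vec n)
    {t : ℝ} (ht : t ∈ Icc (0 : ℝ) 1) : raySample δ z ζ r u t ∈ Metric.closedBall z δ := by
  have := sub_smul_unit_mem_closedBall hδ z (ζ + r • u) (s := -(t * δ)) (by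
    rw [abs_neg, abs_of_nonneg (mul_nonneg ht.1 hδ)]
    exact mul_le_of_le_one_left hδ ht.2)
  rwa [neg_smul, ← sub_eq_add_neg] at this

/-- The uniform distribution of the pairs of draws. -/
def drawLaw (n : ℕ) : Measure (Vec n × ℝ) :=
  (cond volume (Metric.closedBall 0 1)).prod (cond volume (Icc 0 1))

instance isProbabilityMeasure_condUnitBall (n : ℕ) :
    IsProbabilityMeasure (cond (volume : Measure (Vec n)) (Metric.closedBall 0 1)) :=
  cond_isProbabilityMeasure_of_finite (Metric.measure_closedBall_pos volume 0 one_pos).ne'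
    measure_closedBall_lt_top.ne

theorem cond_volume_Icc : cond (volume : Measure ℝ) (Icc 0 1) = volume.restrict (Icc 0 1) := by
  simp [ProbabilityTheory.cond]

instance isProbabilityMeasure_condIcc :
    IsProbabilityMeasure (cond (volume : Measure ℝ) (Icc 0 1)) :=
  cond_isProbabilityMeasure_of_finite (by simp) (by simp)

instance isProbabilityMeasure_drawLaw (n : ℕ) : IsProbabilityMeasure (drawLaw n) := by
  unfold drawLaw
  infer_instance

theorem ae_cond_unitBall {n : ℕ} {ζ : Vec n} {r : ℝ} (hr : r ≠ 0) {p : Vec n → Prop}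
    (hp : ∀ᵐ y : Vec n, p y) :
    ∀ᵐ u ∂(cond (volume : Measure (Vec n)) (Metric.closedBall 0 1)),
      u ∈ Metric.closedBall (0 : Vec n) 1 ∧ p (ζ + r • u) := by
  have hq : Measure.QuasiMeasurePreserving (fun u : Vec n => ζ + r • u) volume volume :=
    (measurePreserving_add_left volume ζ).quasiMeasurePreserving.comp
      (Measure.quasiMeasurePreserving_smul volume hr)
  filter_upwards [(cond_absolutelyContinuous (s := Metric.closedBall 0 1)).ae_le (hq.ae hp),
    ae_cond_mem Metric.isClosed_closedBall.measurableSet] with u h1 h2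
  exact ⟨h2, h1⟩

/-- The point queried avoids a null set. -/
theorem ae_raySample_notMem {n : ℕ} (hn : 0 < n) {N : Set (Vec n)} (hNm : MeasurableSet N)
    (hN : volume N = 0) (z ζ : Vec n) {δ r : ℝ} (hδ : 0 < δ) (hr : 0 < r) :
    ∀ᵐ p ∂(drawLaw n), raySample δ z ζ r p.1 p.2 ∉ N := by
  have hmeas : MeasurableSet {p : Vec n × ℝ | raySample δ z ζ r p.1 p.2 ∉ N} :=
    (hNm.preimage ((measurable_raySample δ).comp (measurable_prodMk_left (x := (z, ζ, r))))).compl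
  rw [drawLaw, Measure.ae_prod_iff_ae_ae hmeas]
  filter_upwards [ae_cond_unitBall (ζ := ζ) hr.ne' (ae_ae_ray_notMem hn hN z hδ)] with u hu
  exact cond_absolutelyContinuous.ae_le hu.2

/-- Expected decrease of the squared norm in a pass of the randomized subroutine, for a fixed
past. -/
theorem lintegral_drawLaw_segMin_sq_le {n : ℕ} (hn : 0 < n) {f g : Vec n → ℝ} {M : ℝ≥0}
    (hM : 0 < M) (hf : LipschitzWith M f) (hg : LipschitzWith M g) {z ζ : Vec n} {δ ε r : ℝ}
    (hδ : 0 < δ) (hε : 0 < ε) (hζM : ‖ζ‖ ≤ M) (hcont : RandContinue f g δ ε z ζ) (hr0 : 0 < r)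
    (hr : r < ‖ζ‖ * √(1 - (1 - ‖ζ‖ ^ 2 / (128 * (M : ℝ) ^ 2)) ^ 2)) :
    ∫⁻ p, ENNReal.ofReal (‖segMin ζ (gradOracle f g (gradient f) (gradient g) z
        (raySample δ z ζ r p.1 p.2))‖ ^ 2) ∂(drawLaw n)
      ≤ ENNReal.ofReal (‖ζ‖ ^ 2 - (‖ζ‖ ^ 2) ^ 2 / (4 * (M : ℝ) ^ 2)) := by
  have : Nonempty (Fin n) := ⟨⟨0, hn⟩⟩
  have hζ : ζ ≠ 0 := norm_pos_iff.1 (hε.trans hcont.1)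
  rw [drawLaw]
  refine (lintegral_prod_le _).trans ?_
  have hdiff : ∀ᵐ s : Vec n, DifferentiableAt ℝ f s ∧ DifferentiableAt ℝ g s ∧
      DifferentiableAt ℝ (subproblem f g z) s :=
    (hf.ae_differentiableAt).and (hg.ae_differentiableAt.and
      (lipschitzWith_subproblem hf hg z).ae_differentiableAt)
  have hray := ae_ae_ray_notMem hn (N := {s | ¬ (DifferentiableAt ℝ f s ∧ DifferentiableAt ℝ g s ∧
      DifferentiableAt ℝ (subproblem f g z) s)}) hdiff z hδ
  have hray' : ∀ᵐ y : Vec n, y ≠ 0 ∧ ∀ᵐ t : ℝ, z - (t * δ) • (‖y‖⁻¹ • y) ∉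
      {s | ¬ (DifferentiableAt ℝ f s ∧ DifferentiableAt ℝ g s ∧
      DifferentiableAt ℝ (subproblem f g z) s)} := (Measure.ae_ne volume 0).and hray
  refine (lintegral_mono_ae (g := fun _ => ENNReal.ofReal
    (‖ζ‖ ^ 2 - (‖ζ‖ ^ 2) ^ 2 / (4 * (M : ℝ) ^ 2))) ?_).trans_eq (by simp)
  filter_upwards [ae_cond_unitBall (ζ := ζ) hr0.ne' hray'] with u hu
  rw [cond_volume_Icc]
  refine lintegral_segMin_sq_le hM hf hg hδ hζ hζM hcont.2 hr ?_ hu.2.1 ?_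
  · rw [add_sub_cancel_left, norm_smul, Real.norm_of_nonneg hr0.le]
    exact mul_le_of_le_one_right hr0.le (mem_closedBall_zero_iff.1 hu.1)
  · filter_upwards [hu.2.2] with t ht
    simpa using ht

/-! ### The randomized method with measurable gradient oracles -/

theorem measurable_segMin {n : ℕ} : Measurable fun p : Vec n × Vec n => segMin p.1 p.2 := by
  unfold segMin
  fun_prop

/-- The vectors of the randomized subroutine called at `z`, with the gradients of `f` and `g` as
oracles. -/
def gradIter {n : ℕ} (f g : Vec n → ℝ) (δ : ℝ) (z : Vec n) (U : ℕ → Vec n) (θ r : ℕ → ℝ) :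
    ℕ → Vec n :=
  randIter (gradOracle f g (gradient f) (gradient g) z) δ z U θ r

theorem norm_gradIter_le {n : ℕ} {f g : Vec n → ℝ} {M : ℝ≥0} (hf : LipschitzWith M f)
    (hg : LipschitzWith M g) (δ : ℝ) (z : Vec n) (U : ℕ → Vec n) (θ r : ℕ → ℝ) (t : ℕ) :
    ‖gradIter f g δ z U θ r t‖ ≤ M := by
  induction t with
  | zero => exact norm_gradOracle_le hf hg _ _
  | succ t ih => exact (norm_segMin_le_left _ _).trans ih

/-- The point that the outer loop moves to from `z` when the subroutine produces the vectors `ζ`;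
it is `z` if the stopping test never succeeds. -/
def nextPoint {n : ℕ} (f g : Vec n → ℝ) (δ ε : ℝ) (z : Vec n) (ζ : ℕ → Vec n) : Vec n :=
  open Classical in
  if h : ∃ T, ¬ RandContinue f g δ ε z (ζ T) then
    z - δ • (‖ζ (Nat.find h)‖⁻¹ • ζ (Nat.find h)) else z

theorem nextPoint_eq {n : ℕ} {f g : Vec n → ℝ} {δ ε : ℝ} {z : Vec n} {ζ : ℕ → Vec n} {T : ℕ}
    (hlt : ∀ t < T, RandContinue f g δ ε z (ζ t)) (hT : ¬ RandContinue f g δ ε z (ζ T)) :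
    nextPoint f g δ ε z ζ = z - δ • (‖ζ T‖⁻¹ • ζ T) := by
  classical
  have h : ∃ T, ¬ RandContinue f g δ ε z (ζ T) := ⟨T, hT⟩
  have hfind : Nat.find h = T :=
    (Nat.find_eq_iff h).2 ⟨hT, fun t ht => not_not.2 (hlt t ht)⟩
  rw [nextPoint, dif_pos h]
  convert rfl <;> exact hfind.symm

section Measurability

variable {n : ℕ} {f g : Vec n → ℝ} {δ ε : ℝ} {Ω : Type*} [MeasurableSpace Ω]

theorem measurable_gradIter (hf : Measurable f) (hg : Measurable g) {Z : Ω → Vec n}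
    {U : ℕ → Ω → Vec n} {θ r : ℕ → Ω → ℝ} (hZ : Measurable Z) (t : ℕ)
    (hU : ∀ i ≤ t, Measurable (U i)) (hθ : ∀ i ≤ t, Measurable (θ i))
    (hr : ∀ i ≤ t, Measurable (r i)) :
    Measurable fun ω =>
      gradIter f g δ (Z ω) (fun i => U i ω) (fun i => θ i ω) (fun i => r i ω) t := by
  induction t with
  | zero =>
    have h0 := hU 0 le_rfl
    exact (measurable_gradOracle hf hg).comp
      (hZ.prodMk (f := Z) (g := fun ω => Z ω + δ • U 0 ω) (by fun_prop))
  | succ t ih =>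
    have h1 := ih (fun i hi => hU i (by omega)) (fun i hi => hθ i (by omega))
      (fun i hi => hr i (by omega))
    have h2 := (measurable_raySample (n := n) δ).comp
      ((hZ.prodMk (h1.prodMk (hr (t + 1) le_rfl))).prodMk ((hU (t + 1) le_rfl).prodMk (hθ (t + 1) le_rfl)))
    exact measurable_segMin.comp (h1.prodMk ((measurable_gradOracle hf hg).comp (hZ.prodMk h2)))

theorem measurableSet_randContinue (hf : Measurable f) (hg : Measurable g) {Z ζ : Ω → Vec n}
    (hZ : Measurable Z) (hζ : Measurable ζ) :
    MeasurableSet {ω | RandContinue f g δ ε (Z ω) (ζ ω)} := by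
  have h1 : MeasurableSet {ω | ε < ‖ζ ω‖} := measurableSet_lt measurable_const hζ.norm
  have h2 : MeasurableSet {ω | subproblem f g (Z ω) (Z ω) -
      subproblem f g (Z ω) (Z ω - δ • (‖ζ ω‖⁻¹ • ζ ω)) ≤ δ * ‖ζ ω‖ / 4} := by
    unfold subproblem
    exact measurableSet_le (by fun_prop) (by fun_prop)
  exact h1.inter h2

theorem measurable_nextPoint (hf : Measurable f) (hg : Measurable g) {Z : Ω → Vec n}
    {ζ : ℕ → Ω → Vec n} (hZ : Measurable Z) (hζ : ∀ t, Measurable (ζ t)) :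
    Measurable fun ω => nextPoint f g δ ε (Z ω) fun t => ζ t ω := by
  classical
  have hC : ∀ t, MeasurableSet {ω | RandContinue f g δ ε (Z ω) (ζ t ω)} := fun t =>
    measurableSet_randContinue hf hg hZ (hζ t)
  -- the stopping index, made total by taking `0` if the test never succeeds
  have hex : ∀ ω, ∃ T, ¬ RandContinue f g δ ε (Z ω) (ζ T ω) ∨
      ∀ t, RandContinue f g δ ε (Z ω) (ζ t ω) := fun ω => by
    by_cases h : ∃ T, ¬ RandContinue f g δ ε (Z ω) (ζ T ω)
    · exact ⟨_, Or.inl h.choose_spec⟩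
    · exact ⟨0, Or.inr fun t => not_not.1 fun ht => h ⟨t, ht⟩⟩
  have hmeas : ∀ T, MeasurableSet {ω | ¬ RandContinue f g δ ε (Z ω) (ζ T ω) ∨
      ∀ t, RandContinue f g δ ε (Z ω) (ζ t ω)} := fun T => by
    have : MeasurableSet {ω | ∀ t, RandContinue f g δ ε (Z ω) (ζ t ω)} := by
      rw [Set.ofPred_forall]
      exact MeasurableSet.iInter hC
    exact (hC T).compl.union this
  have hfun : ∀ T, Measurable fun ω => if RandContinue f g δ ε (Z ω) (ζ T ω) then Z ω else
      Z ω - δ • (‖ζ T ω‖⁻¹ • ζ T ω) := fun T => by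
    have := hζ T
    exact Measurable.ite (hC T) hZ (by fun_prop)
  convert Measurable.find hfun hmeas hex using 2 with ω
  by_cases h : ∃ T, ¬ RandContinue f g δ ε (Z ω) (ζ T ω)
  · have hhalt : ¬ RandContinue f g δ ε (Z ω) (ζ (Nat.find (hex ω)) ω) := by
      rcases Nat.find_spec (hex ω) with h1 | h1
      · exact h1
      · exact (h.choose_spec (h1 _)).elim
    rw [if_neg hhalt]
    exact nextPoint_eq (ζ := fun t => ζ t ω)
      (fun t ht => not_not.1 fun hcon => Nat.find_min (hex ω) ht (Or.inl hcon)) hhalt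
  · rw [nextPoint, dif_neg h, if_pos (not_not.1 fun hcon => h ⟨_, hcon⟩)]

end Measurability

section Iterates

variable {n : ℕ} {Ω : Type*} (f g : Vec n → ℝ) (δ ε : ℝ) (x₀ : Vec n)
  (U : ℕ → ℕ → Ω → Vec n) (θ r : ℕ → ℕ → Ω → ℝ)

/-- The point at which the `k`-th call of the randomized subroutine is made; meaningful on
`aliveSet` only. -/
def outerPoint : ℕ → Ω → Vec n
  | 0, _ => x₀
  | k + 1, ω => nextPoint f g δ ε (outerPoint k ω) (gradIter f g δ (outerPoint k ω)
      (fun t => U k t ω) (fun t => θ k t ω) (fun t => r k t ω))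

/-- The vector after `t` passes of the `k`-th call of the randomized subroutine. -/
def innerVec (k t : ℕ) (ω : Ω) : Vec n :=
  gradIter f g δ (outerPoint f g δ ε x₀ U θ r k ω)
    (fun t => U k t ω) (fun t => θ k t ω) (fun t => r k t ω) t

/-- The event that the stopping test after `t` passes of the `k`-th call fails. -/
def continueSet (k t : ℕ) : Set Ω :=
  {ω | RandContinue f g δ ε (outerPoint f g δ ε x₀ U θ r k ω) (innerVec f g δ ε x₀ U θ r k t ω)}

/-- The event that the `k`-th call of the randomized subroutine is made. -/
def aliveSet : ℕ → Set Ω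
  | 0 => univ
  | k + 1 => aliveSet k ∩ ⋃ T, (⋂ t < T, continueSet f g δ ε x₀ U θ r k t) \
      continueSet f g δ ε x₀ U θ r k T ∩ {ω | ε < ‖innerVec f g δ ε x₀ U θ r k T ω‖}

/-- The event that the `k`-th call makes more than `t` passes. -/
def activeSet (k t : ℕ) : Set Ω :=
  aliveSet f g δ ε x₀ U θ r k ∩ ⋂ i ≤ t, continueSet f g δ ε x₀ U θ r k i

variable {f g δ ε x₀ U θ r} {mΩ : MeasurableSpace Ω} {P : Measure Ω}
  {ℱ : Filtration (ℕ ×ₗ ℕ) mΩ}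

theorem toLex_le_of_le {k s t : ℕ} (h : s ≤ t) : toLex (k, s) ≤ toLex (k, t) :=
  Prod.Lex.toLex_le_toLex.2 (Or.inr ⟨rfl, h⟩)

theorem toLex_le_succ (k s : ℕ) : toLex (k, s) ≤ toLex (k + 1, 0) :=
  Prod.Lex.toLex_le_toLex.2 (Or.inl (Nat.lt_succ_self k))

theorem measurable_innerVec_of (hf : Measurable f) (hg : Measurable g)
    (hR : IsSearchRandomness P ℱ U θ r) {k : ℕ}
    (hZ : Measurable[ℱ (toLex (k, 0))] (outerPoint f g δ ε x₀ U θ r k)) (t : ℕ) :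
    Measurable[ℱ (toLex (k, t + 1))] (innerVec f g δ ε x₀ U θ r k t) :=
  @measurable_gradIter n f g δ Ω (ℱ (toLex (k, t + 1))) hf hg _ _ _ _
    (hZ.mono (ℱ.mono (toLex_le_of_le (Nat.zero_le _))) le_rfl) t
    (fun i hi => (hR.measurable_U k i).mono (ℱ.mono (toLex_le_of_le (by omega))) le_rfl)
    (fun i hi => (hR.measurable_θ k i).mono (ℱ.mono (toLex_le_of_le (by omega))) le_rfl)
    (fun i hi => (hR.measurable_r k i).mono (ℱ.mono (toLex_le_of_le (by omega))) le_rfl)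

theorem measurable_outerPoint (hf : Measurable f) (hg : Measurable g)
    (hR : IsSearchRandomness P ℱ U θ r) (k : ℕ) :
    Measurable[ℱ (toLex (k, 0))] (outerPoint f g δ ε x₀ U θ r k) := by
  induction k with
  | zero => exact measurable_const
  | succ k ih =>
    exact @measurable_nextPoint n f g δ ε Ω (ℱ (toLex (k + 1, 0))) hf hg _
      (innerVec f g δ ε x₀ U θ r k) (ih.mono (ℱ.mono (toLex_le_succ _ _)) le_rfl) fun t =>
      (measurable_innerVec_of hf hg hR ih t).mono (ℱ.mono (toLex_le_succ _ _)) le_rfl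

theorem measurable_innerVec (hf : Measurable f) (hg : Measurable g)
    (hR : IsSearchRandomness P ℱ U θ r) (k t : ℕ) :
    Measurable[ℱ (toLex (k, t + 1))] (innerVec f g δ ε x₀ U θ r k t) :=
  measurable_innerVec_of hf hg hR (measurable_outerPoint hf hg hR k) t

theorem measurableSet_continueSet (hf : Measurable f) (hg : Measurable g)
    (hR : IsSearchRandomness P ℱ U θ r) (k t : ℕ) :
    MeasurableSet[ℱ (toLex (k, t + 1))] (continueSet f g δ ε x₀ U θ r k t) :=
  @measurableSet_randContinue n f g δ ε Ω (ℱ (toLex (k, t + 1))) hf hg _ _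
    ((measurable_outerPoint hf hg hR k).mono (ℱ.mono (toLex_le_of_le (Nat.zero_le _))) le_rfl)
    (measurable_innerVec hf hg hR k t)

theorem measurableSet_aliveSet (hf : Measurable f) (hg : Measurable g)
    (hR : IsSearchRandomness P ℱ U θ r) (k : ℕ) :
    MeasurableSet[ℱ (toLex (k, 0))] (aliveSet f g δ ε x₀ U θ r k) := by
  induction k with
  | zero => exact MeasurableSet.univ
  | succ k ih =>
    have hC : ∀ t, MeasurableSet[ℱ (toLex (k + 1, 0))] (continueSet f g δ ε x₀ U θ r k t) :=
      fun t => ℱ.mono (toLex_le_succ _ _) _ (measurableSet_continueSet hf hg hR k t)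
    have hI : ∀ T, MeasurableSet[ℱ (toLex (k + 1, 0))]
        {ω | ε < ‖innerVec f g δ ε x₀ U θ r k T ω‖} := fun T =>
      ℱ.mono (toLex_le_succ _ _) _
        (measurable_innerVec hf hg hR k T
          (measurableSet_lt measurable_const measurable_norm : MeasurableSet {v : Vec n | ε < ‖v‖}))
    exact (ℱ.mono (toLex_le_succ _ _) _ ih).inter (MeasurableSet.iUnion fun T =>
      ((MeasurableSet.iInter fun t => MeasurableSet.iInter fun _ => hC t).diff (hC T)).inter (hI T))

theorem measurableSet_activeSet (hf : Measurable f) (hg : Measurable g)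
    (hR : IsSearchRandomness P ℱ U θ r) (k t : ℕ) :
    MeasurableSet[ℱ (toLex (k, t + 1))] (activeSet f g δ ε x₀ U θ r k t) :=
  (ℱ.mono (toLex_le_of_le (Nat.zero_le _)) _ (measurableSet_aliveSet hf hg hR k)).inter
    (MeasurableSet.iInter fun i => MeasurableSet.iInter fun hi =>
      ℱ.mono (toLex_le_of_le (by omega)) _ (measurableSet_continueSet hf hg hR k i))

theorem activeSet_anti (k : ℕ) {s t : ℕ} (h : s ≤ t) :
    activeSet f g δ ε x₀ U θ r k t ⊆ activeSet f g δ ε x₀ U θ r k s :=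
  inter_subset_inter_right _ (biInter_subset_biInter_left fun _ hi => le_trans hi h)

theorem map_draw (hR : IsSearchRandomness P ℱ U θ r) [IsProbabilityMeasure P] (k t : ℕ) :
    P.map (fun ω => (U k t ω, θ k t ω)) = drawLaw n := by
  have hU : Measurable (U k t) := (hR.measurable_U k t).mono (ℱ.le _) le_rfl
  have hθ : Measurable (θ k t) := (hR.measurable_θ k t).mono (ℱ.le _) le_rfl
  rw [(indepFun_iff_map_prod_eq_prod_map_map hU.aemeasurable hθ.aemeasurable).1
    (hR.indep_draws k t)]
  have h1 := hR.uniform_U k t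
  have h2 := hR.uniform_θ k t
  rw [pdf.IsUniform] at h1 h2
  rw [h1, h2, drawLaw]

theorem measurable_draw (hR : IsSearchRandomness P ℱ U θ r) (k t : ℕ) :
    Measurable fun ω => (U k t ω, θ k t ω) :=
  ((hR.measurable_U k t).mono (ℱ.le _) le_rfl).prodMk
    ((hR.measurable_θ k t).mono (ℱ.le _) le_rfl)

end Iterates

/-! ### Probability that a call of the randomized subroutine is long -/

section Survival

variable {n : ℕ} {Ω : Type*} {f g : Vec n → ℝ} {δ ε : ℝ} {x₀ : Vec n}
  {U : ℕ → ℕ → Ω → Vec n} {θ r : ℕ → ℕ → Ω → ℝ} {mΩ : MeasurableSpace Ω} {P : Measure Ω}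
  {ℱ : Filtration (ℕ ×ₗ ℕ) mΩ} {M : ℝ≥0}

/-- The event that the radius of the draw after `t` passes of the `k`-th call is admissible. -/
def radiusSet (f g : Vec n → ℝ) (δ ε : ℝ) (x₀ : Vec n) (U : ℕ → ℕ → Ω → Vec n)
    (θ r : ℕ → ℕ → Ω → ℝ) (M : ℝ≥0) (k t : ℕ) : Set Ω :=
  {ω | 0 < r k (t + 1) ω ∧ r k (t + 1) ω < ‖innerVec f g δ ε x₀ U θ r k t ω‖ *
    √(1 - (1 - ‖innerVec f g δ ε x₀ U θ r k t ω‖ ^ 2 / (128 * (M : ℝ) ^ 2)) ^ 2)}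

theorem measurableSet_radiusSet (hf : Measurable f) (hg : Measurable g)
    (hR : IsSearchRandomness P ℱ U θ r) (k t : ℕ) :
    MeasurableSet[ℱ (toLex (k, t + 1))] (radiusSet f g δ ε x₀ U θ r M k t) := by
  have hS : MeasurableSet {p : ℝ × Vec n | 0 < p.1 ∧
      p.1 < ‖p.2‖ * √(1 - (1 - ‖p.2‖ ^ 2 / (128 * (M : ℝ) ^ 2)) ^ 2)} :=
    MeasurableSet.inter (s₁ := {p : ℝ × Vec n | 0 < p.1})
      (s₂ := {p | p.1 < ‖p.2‖ * √(1 - (1 - ‖p.2‖ ^ 2 / (128 * (M : ℝ) ^ 2)) ^ 2)})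
      (measurableSet_lt (by fun_prop) (by fun_prop)) (measurableSet_lt (by fun_prop) (by fun_prop))
  exact Measurable.prodMk (hR.measurable_r k (t + 1)) (measurable_innerVec hf hg hR k t) hS

variable [IsProbabilityMeasure P]

/-- Expected decrease of the squared norm in a pass, on an event that belongs to the past. -/
theorem setLIntegral_innerVec_succ_le (hn : 0 < n) (hM : 0 < M) (hf : LipschitzWith M f)
    (hg : LipschitzWith M g) (hδ : 0 < δ) (hε : 0 < ε) (hR : IsSearchRandomness P ℱ U θ r)
    {k t : ℕ} (hrad : ∀ᵐ ω ∂P, ω ∈ activeSet f g δ ε x₀ U θ r k t →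
      ω ∈ radiusSet f g δ ε x₀ U θ r M k t)
    {D : Set Ω} (hD : MeasurableSet[ℱ (toLex (k, t + 1))] D)
    (hDa : D ⊆ activeSet f g δ ε x₀ U θ r k t) :
    ∫⁻ ω in D, ENNReal.ofReal (‖innerVec f g δ ε x₀ U θ r k (t + 1) ω‖ ^ 2) ∂P ≤
      ∫⁻ ω in D, ENNReal.ofReal (‖innerVec f g δ ε x₀ U θ r k t ω‖ ^ 2 -
        (‖innerVec f g δ ε x₀ U θ r k t ω‖ ^ 2) ^ 2 / (4 * (M : ℝ) ^ 2)) ∂P := by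
  have hfm := hf.continuous.measurable
  have hgm := hg.continuous.measurable
  set D' := D ∩ radiusSet f g δ ε x₀ U θ r M k t with hD'
  have hD'm : MeasurableSet[ℱ (toLex (k, t + 1))] D' :=
    hD.inter (measurableSet_radiusSet hfm hgm hR k t)
  have hDD' : D =ᵐ[P] D' := by
    filter_upwards [hrad] with ω hω
    exact propext ⟨fun h => ⟨h, hω (hDa h)⟩, fun h => h.1⟩
  have hX : Measurable[ℱ (toLex (k, t + 1))] fun ω => (outerPoint f g δ ε x₀ U θ r k ω,
      innerVec f g δ ε x₀ U θ r k t ω, r k (t + 1) ω) :=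
    Measurable.prodMk
      ((measurable_outerPoint hfm hgm hR k).mono (ℱ.mono (toLex_le_of_le (Nat.zero_le _))) le_rfl)
      (Measurable.prodMk (measurable_innerVec hfm hgm hR k t) (hR.measurable_r k (t + 1)))
  have hseg : Measurable fun p : (Vec n × Vec n × ℝ) × (Vec n × ℝ) => segMin p.1.2.1
      (gradOracle f g (gradient f) (gradient g) p.1.1
        (raySample δ p.1.1 p.1.2.1 p.1.2.2 p.2.1 p.2.2)) :=
    measurable_segMin.comp ((show Measurable fun p : (Vec n × Vec n × ℝ) × (Vec n × ℝ) =>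
      p.1.2.1 by fun_prop).prodMk ((measurable_gradOracle hfm hgm).comp
        ((show Measurable fun p : (Vec n × Vec n × ℝ) × (Vec n × ℝ) => p.1.1 by fun_prop).prodMk
          (measurable_raySample δ))))
  have hΨ : Measurable fun p : (Vec n × Vec n × ℝ) × (Vec n × ℝ) => ENNReal.ofReal
      (‖segMin p.1.2.1 (gradOracle f g (gradient f) (gradient g) p.1.1
        (raySample δ p.1.1 p.1.2.1 p.1.2.2 p.2.1 p.2.2))‖ ^ 2) :=
    (hseg.norm.pow_const 2).ennreal_ofReal
  rw [setLIntegral_congr hDD', setLIntegral_congr hDD']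
  have h1 := setLIntegral_of_indep (ℱ.le _) hX (measurable_draw hR k (t + 1))
    (hR.indep_past k (t + 1)) hΨ hD'm
  refine (le_of_eq h1).trans (setLIntegral_mono' (ℱ.le _ _ hD'm) fun ω hω => ?_)
  rw [map_draw hR]
  exact lintegral_drawLaw_segMin_sq_le hn hM hf hg hδ hε (norm_gradIter_le hf hg _ _ _ _ _ _)
    (mem_iInter₂.1 (hDa hω.1).2 t le_rfl) hω.2.1 hω.2.2

/-- On the event `A` of the past of the pass `t₀`, the expected squared norm after `s` more passes
is at most `4 M² / (s + 4)`.  The recursion of the expectations uses tangents, in place of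
Jensen's inequality. -/
theorem setLIntegral_innerVec_le (hn : 0 < n) (hM : 0 < M) (hf : LipschitzWith M f)
    (hg : LipschitzWith M g) (hδ : 0 < δ) (hε : 0 < ε) (hR : IsSearchRandomness P ℱ U θ r)
    {k t₀ : ℕ} (hrad : ∀ t, ∀ᵐ ω ∂P, ω ∈ activeSet f g δ ε x₀ U θ r k t →
      ω ∈ radiusSet f g δ ε x₀ U θ r M k t)
    {A : Set Ω} (hA : MeasurableSet[ℱ (toLex (k, t₀ + 1))] A) (s : ℕ) :
    ∫⁻ ω in A ∩ activeSet f g δ ε x₀ U θ r k (t₀ + s),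
      ENNReal.ofReal (‖innerVec f g δ ε x₀ U θ r k (t₀ + s) ω‖ ^ 2) ∂P ≤
      ENNReal.ofReal (4 * (M : ℝ) ^ 2 / (s + 4)) * P A := by
  have hM' : 0 < (M : ℝ) := hM
  have hfm := hf.continuous.measurable
  have hgm := hg.continuous.measurable
  induction s with
  | zero =>
    have hle : ∀ ω, ENNReal.ofReal (‖innerVec f g δ ε x₀ U θ r k (t₀ + 0) ω‖ ^ 2) ≤
        ENNReal.ofReal (4 * (M : ℝ) ^ 2 / ((0 : ℕ) + 4)) := fun ω => by
      refine ENNReal.ofReal_le_ofReal ?_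
      have := pow_le_pow_left₀ (norm_nonneg _)
        (norm_gradIter_le hf hg δ (outerPoint f g δ ε x₀ U θ r k ω) (fun t => U k t ω)
          (fun t => θ k t ω) (fun t => r k t ω) (t₀ + 0)) 2
      refine this.trans_eq ?_
      push_cast
      ring
    refine (lintegral_mono hle).trans ?_
    rw [setLIntegral_const]
    gcongr
    exact inter_subset_left
  | succ s ih =>
    set E := activeSet f g δ ε x₀ U θ r k (t₀ + s) with hE
    set c : ℝ := 4 * (M : ℝ) ^ 2 / (s + 4) with hc
    have hc0 : 0 ≤ c := by positivity
    have hα : 0 ≤ 1 - c / (2 * (M : ℝ) ^ 2) := by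
      have h1 : c / (2 * (M : ℝ) ^ 2) = 2 / (s + 4) := by
        rw [hc]; field_simp; norm_num
      rw [h1, sub_nonneg, div_le_one (by positivity)]
      have : (0 : ℝ) ≤ s := Nat.cast_nonneg s
      linarith
    have hβ : 0 ≤ c ^ 2 / (4 * (M : ℝ) ^ 2) := by positivity
    have hDm : MeasurableSet[ℱ (toLex (k, t₀ + s + 1))] (A ∩ E) :=
      (ℱ.mono (toLex_le_of_le (by omega)) _ hA).inter
        (measurableSet_activeSet hfm hgm hR k (t₀ + s))
    calc ∫⁻ ω in A ∩ activeSet f g δ ε x₀ U θ r k (t₀ + (s + 1)),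
          ENNReal.ofReal (‖innerVec f g δ ε x₀ U θ r k (t₀ + (s + 1)) ω‖ ^ 2) ∂P
        ≤ ∫⁻ ω in A ∩ E, ENNReal.ofReal (‖innerVec f g δ ε x₀ U θ r k (t₀ + s + 1) ω‖ ^ 2) ∂P :=
          lintegral_mono_set (inter_subset_inter_right _ (activeSet_anti k (by omega)))
      _ ≤ ∫⁻ ω in A ∩ E, ENNReal.ofReal (‖innerVec f g δ ε x₀ U θ r k (t₀ + s) ω‖ ^ 2 -
            (‖innerVec f g δ ε x₀ U θ r k (t₀ + s) ω‖ ^ 2) ^ 2 / (4 * (M : ℝ) ^ 2)) ∂P :=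
          setLIntegral_innerVec_succ_le hn hM hf hg hδ hε hR (hrad _) hDm inter_subset_right
      _ ≤ ∫⁻ ω in A ∩ E, (ENNReal.ofReal (1 - c / (2 * (M : ℝ) ^ 2)) *
            ENNReal.ofReal (‖innerVec f g δ ε x₀ U θ r k (t₀ + s) ω‖ ^ 2) +
            ENNReal.ofReal (c ^ 2 / (4 * (M : ℝ) ^ 2))) ∂P := by
          refine lintegral_mono fun ω => ?_
          rw [← ENNReal.ofReal_mul hα, ← ENNReal.ofReal_add (mul_nonneg hα (sq_nonneg _)) hβ]
          exact ENNReal.ofReal_le_ofReal (sub_sq_div_le_tangent hM' c _)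
      _ = ENNReal.ofReal (1 - c / (2 * (M : ℝ) ^ 2)) *
            ∫⁻ ω in A ∩ E, ENNReal.ofReal (‖innerVec f g δ ε x₀ U θ r k (t₀ + s) ω‖ ^ 2) ∂P +
            ENNReal.ofReal (c ^ 2 / (4 * (M : ℝ) ^ 2)) * P (A ∩ E) := by
          rw [lintegral_add_right _ measurable_const, setLIntegral_const,
            lintegral_const_mul' _ _ ENNReal.ofReal_ne_top]
      _ ≤ ENNReal.ofReal (1 - c / (2 * (M : ℝ) ^ 2)) * (ENNReal.ofReal c * P A) +
            ENNReal.ofReal (c ^ 2 / (4 * (M : ℝ) ^ 2)) * P A := by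
          gcongr
          exact inter_subset_left
      _ = ENNReal.ofReal ((1 - c / (2 * (M : ℝ) ^ 2)) * c + c ^ 2 / (4 * (M : ℝ) ^ 2)) * P A := by
          rw [← mul_assoc, ← add_mul, ← ENNReal.ofReal_mul hα,
            ← ENNReal.ofReal_add (mul_nonneg hα hc0) hβ]
      _ ≤ _ := by
          gcongr
          have := tangent_rate_le (x := c) hM' s zero_le_one (by rw [mul_one])
          rwa [mul_one, mul_one] at this

/-- At least 15 of 16 calls end within `s` more passes, for `s` of order `64 M² / ε²`. -/
theorem measure_inter_activeSet_le (hn : 0 < n) (hM : 0 < M) (hf : LipschitzWith M f)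
    (hg : LipschitzWith M g) (hδ : 0 < δ) (hε : 0 < ε) (hR : IsSearchRandomness P ℱ U θ r)
    {k t₀ : ℕ} (hrad : ∀ t, ∀ᵐ ω ∂P, ω ∈ activeSet f g δ ε x₀ U θ r k t →
      ω ∈ radiusSet f g δ ε x₀ U θ r M k t)
    {A : Set Ω} (hA : MeasurableSet[ℱ (toLex (k, t₀ + 1))] A) {s : ℕ}
    (hs : 64 * (M : ℝ) ^ 2 / ε ^ 2 ≤ s + 4) :
    P (A ∩ activeSet f g δ ε x₀ U θ r k (t₀ + s)) ≤ 16⁻¹ * P A := by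
  have h1 := setLIntegral_innerVec_le hn hM hf hg hδ hε hR hrad hA s
  have hm : MeasurableSet (A ∩ activeSet f g δ ε x₀ U θ r k (t₀ + s)) :=
    (ℱ.le _ _ hA).inter (ℱ.le _ _ (measurableSet_activeSet hf.continuous.measurable
      hg.continuous.measurable hR k (t₀ + s)))
  have h2 : ENNReal.ofReal (ε ^ 2) * P (A ∩ activeSet f g δ ε x₀ U θ r k (t₀ + s)) ≤
      ENNReal.ofReal (4 * (M : ℝ) ^ 2 / (s + 4)) * P A := by
    refine le_trans ?_ h1
    rw [← setLIntegral_const]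
    refine setLIntegral_mono' hm fun ω hω => ENNReal.ofReal_le_ofReal ?_
    have hc : RandContinue f g δ ε _ _ := mem_iInter₂.1 hω.2.2 (t₀ + s) le_rfl
    exact pow_le_pow_left₀ hε.le hc.1.le 2
  have h3 : 4 * (M : ℝ) ^ 2 / (s + 4) ≤ ε ^ 2 * 16⁻¹ := by
    rw [div_le_iff₀ (by positivity)] at hs ⊢
    linarith
  have h4 : ENNReal.ofReal (ε ^ 2) * P (A ∩ activeSet f g δ ε x₀ U θ r k (t₀ + s)) ≤
      ENNReal.ofReal (ε ^ 2) * (16⁻¹ * P A) := by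
    refine h2.trans ?_
    rw [← mul_assoc]
    gcongr
    refine (ENNReal.ofReal_le_ofReal h3).trans_eq ?_
    rw [ENNReal.ofReal_mul (sq_nonneg _), ENNReal.ofReal_inv_of_pos (by norm_num)]
    norm_num
  exact (ENNReal.mul_le_mul_iff_right (ENNReal.ofReal_pos.2 (by positivity)).ne'
    ENNReal.ofReal_ne_top).1 h4

/-- The number of oracle calls in a call of the randomized subroutine exceeds `L T` with
probability at most `16⁻ᴸ`, for `T` of order `64 M² / ε²`. -/
theorem measure_activeSet_le (hn : 0 < n) (hM : 0 < M) (hf : LipschitzWith M f)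
    (hg : LipschitzWith M g) (hδ : 0 < δ) (hε : 0 < ε) (hR : IsSearchRandomness P ℱ U θ r)
    {k : ℕ} (hrad : ∀ t, ∀ᵐ ω ∂P, ω ∈ activeSet f g δ ε x₀ U θ r k t →
      ω ∈ radiusSet f g δ ε x₀ U θ r M k t)
    {T : ℕ} (hT0 : 1 ≤ T) (hT : 64 * (M : ℝ) ^ 2 / ε ^ 2 ≤ T) {L : ℕ} (hL : 1 ≤ L) :
    P (activeSet f g δ ε x₀ U θ r k (L * T - 1)) ≤ 16⁻¹ ^ L := by
  induction L, hL using Nat.le_induction with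
  | base =>
    have h := measure_inter_activeSet_le hn hM hf hg hδ hε hR hrad (t₀ := 0) (s := T - 1)
      MeasurableSet.univ (by rw [Nat.cast_sub hT0]; push_cast; linarith)
    simpa using h
  | succ L hL ih =>
    have hLT : 1 ≤ L * T := Nat.mul_pos hL hT0
    have h := measure_inter_activeSet_le hn hM hf hg hδ hε hR hrad (s := T)
      (A := activeSet f g δ ε x₀ U θ r k (L * T - 1))
      (measurableSet_activeSet hf.continuous.measurable hg.continuous.measurable hR k (L * T - 1))
      (by linarith)
    have e : L * T - 1 + T = (L + 1) * T - 1 := by rw [add_mul, one_mul]; omega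
    rw [e, inter_eq_right.2 (activeSet_anti k (by rw [← e]; omega))] at h
    calc _ ≤ 16⁻¹ * P (activeSet f g δ ε x₀ U θ r k (L * T - 1)) := h
      _ ≤ 16⁻¹ * 16⁻¹ ^ L := by gcongr
      _ = _ := (pow_succ' _ _).symm

end Survival

/-! ### Paths of the randomized method -/

theorem gradient_mem_clarke {n : ℕ} {h : Vec n → ℝ} {x : Vec n} (hx : DifferentiableAt ℝ h x) :
    gradient h x ∈ clarke h x :=
  subset_convexHull ℝ _ ⟨fun _ => x, tendsto_const_nhds, fun _ => hx, tendsto_const_nhds⟩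

section Path

variable {n : ℕ} {Ω : Type*} {f g f' g' : Vec n → ℝ} {Gf Gg : Vec n → Vec n} {δ ε : ℝ}
  {x₀ : Vec n} {U : ℕ → ℕ → Ω → Vec n} {θ r : ℕ → ℕ → Ω → ℝ} {S N : Set (Vec n)} {M : ℝ≥0}

/-- Near feasible points the problem is that of `f'` and `g'`, and off the exceptional set `N` the
oracles return gradients. -/
structure IsSurrogate (f g f' g' : Vec n → ℝ) (Gf Gg : Vec n → Vec n) (δ : ℝ)
    (S N : Set (Vec n)) : Prop where
  isOpen : IsOpen S
  ball_subset : ∀ x, g x ≤ 0 → Metric.closedBall x δ ⊆ S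
  eqOn_f : EqOn f f' S
  eqOn_g : EqOn g g' S
  diff_f : ∀ s ∈ S, s ∉ N → DifferentiableAt ℝ f s
  diff_g : ∀ s ∈ S, s ∉ N → DifferentiableAt ℝ g s
  oracle_f : ∀ s ∈ S, s ∉ N → Gf s = gradient f s
  oracle_g : ∀ s ∈ S, s ∉ N → Gg s = gradient g s

theorem IsSurrogate.gradOracle_eq (hs : IsSurrogate f g f' g' Gf Gg δ S N) (hδ : 0 ≤ δ)
    {x s : Vec n} (hx : g x ≤ 0) (hsx : s ∈ Metric.closedBall x δ) (hsN : s ∉ N) :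
    gradOracle f g Gf Gg x s = gradOracle f' g' (gradient f') (gradient g') x s := by
  have hxS := hs.ball_subset x hx (Metric.mem_closedBall_self hδ)
  have hsS := hs.ball_subset x hx hsx
  have e1 : gradient f s = gradient f' s :=
    (hs.eqOn_f.eventuallyEq_of_mem (hs.isOpen.mem_nhds hsS)).gradient_eq
  have e2 : gradient g s = gradient g' s :=
    (hs.eqOn_g.eventuallyEq_of_mem (hs.isOpen.mem_nhds hsS)).gradient_eq
  rw [gradOracle, gradOracle, hs.oracle_f s hsS hsN, hs.oracle_g s hsS hsN, e1, e2,
    hs.eqOn_f hsS, hs.eqOn_g hsS, hs.eqOn_f hxS]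

theorem IsSurrogate.gradOracle_mem (hs : IsSurrogate f g f' g' Gf Gg δ S N)
    {x s : Vec n} (hx : g x ≤ 0) (hsx : s ∈ Metric.closedBall x δ) (hsN : s ∉ N) :
    gradOracle f g Gf Gg x s ∈ {u | ∃ z ∈ Metric.closedBall x δ,
      u ∈ clarke f z ∨ (u ∈ clarke g z ∧ f z - f x ≤ g z)} := by
  have hsS := hs.ball_subset x hx hsx
  refine ⟨s, hsx, ?_⟩
  rw [gradOracle, hs.oracle_f s hsS hsN, hs.oracle_g s hsS hsN]
  split_ifs with hif
  · exact Or.inl (gradient_mem_clarke (hs.diff_f s hsS hsN))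
  · exact Or.inr ⟨gradient_mem_clarke (hs.diff_g s hsS hsN), (not_le.1 hif).le⟩

theorem IsSurrogate.randContinue_iff (hs : IsSurrogate f g f' g' Gf Gg δ S N) (hδ : 0 ≤ δ)
    {x ζ : Vec n} (hx : g x ≤ 0) :
    RandContinue f g δ ε x ζ ↔ RandContinue f' g' δ ε x ζ := by
  have hxS := hs.ball_subset x hx (Metric.mem_closedBall_self hδ)
  have hy : x - δ • (‖ζ‖⁻¹ • ζ) ∈ S := by
    have := sub_smul_unit_mem_closedBall hδ x ζ (s := -δ) (by rw [abs_neg, abs_of_nonneg hδ])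
    rw [neg_smul, ← sub_eq_add_neg] at this
    exact hs.ball_subset x hx this
  simp only [RandContinue, subproblem, hs.eqOn_f hxS, hs.eqOn_g hxS, hs.eqOn_f hy, hs.eqOn_g hy]

/-- The draws lie in the ball and the interval, and all queries avoid `N`. -/
def IsRegularPath (f' g' : Vec n → ℝ) (δ ε : ℝ) (x₀ : Vec n) (U : ℕ → ℕ → Ω → Vec n)
    (θ r : ℕ → ℕ → Ω → ℝ) (N : Set (Vec n)) (ω : Ω) : Prop :=
  (∀ k t, U k t ω ∈ Metric.closedBall (0 : Vec n) 1 ∧ θ k t ω ∈ Icc (0 : ℝ) 1) ∧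
  (∀ k, outerPoint f' g' δ ε x₀ U θ r k ω + δ • U k 0 ω ∉ N) ∧
  ∀ k t, 0 < r k (t + 1) ω → raySample δ (outerPoint f' g' δ ε x₀ U θ r k ω)
    (innerVec f' g' δ ε x₀ U θ r k t ω) (r k (t + 1) ω) (U k (t + 1) ω) (θ k (t + 1) ω) ∉ N

theorem ae_isRegularPath {mΩ : MeasurableSpace Ω} {P : Measure Ω} [IsProbabilityMeasure P]
    {ℱ : Filtration (ℕ ×ₗ ℕ) mΩ} (hn : 0 < n) (hf : Measurable f') (hg : Measurable g')
    (hδ : 0 < δ) (hR : IsSearchRandomness P ℱ U θ r) (hNm : MeasurableSet N)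
    (hN : volume N = 0) : ∀ᵐ ω ∂P, IsRegularPath f' g' δ ε x₀ U θ r N ω := by
  have hlaw : ∀ k t, ∀ {p : Vec n × ℝ → Prop}, (∀ᵐ y ∂(drawLaw n), p y) →
      ∀ᵐ y ∂(P.map fun ω => (U k t ω, θ k t ω)), p y := fun k t p hp => by
    rwa [map_draw hR]
  have h1 : ∀ᵐ ω ∂P, ∀ k t, U k t ω ∈ Metric.closedBall (0 : Vec n) 1 ∧
      θ k t ω ∈ Icc (0 : ℝ) 1 := by
    refine ae_all_iff.2 fun k => ae_all_iff.2 fun t => ?_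
    have hU : P.map (U k t) = cond volume (Metric.closedBall 0 1) := hR.uniform_U k t
    have hθ : P.map (θ k t) = cond volume (Icc 0 1) := hR.uniform_θ k t
    have e1 : ∀ᵐ u ∂(P.map (U k t)), u ∈ Metric.closedBall (0 : Vec n) 1 := by
      rw [hU]; exact ae_cond_mem Metric.isClosed_closedBall.measurableSet
    have e2 : ∀ᵐ s ∂(P.map (θ k t)), s ∈ Icc (0 : ℝ) 1 := by
      rw [hθ]; exact ae_cond_mem measurableSet_Icc
    exact (ae_of_ae_map ((measurable_draw hR k t).fst).aemeasurable e1).and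
      (ae_of_ae_map ((measurable_draw hR k t).snd).aemeasurable e2)
  have h2 : ∀ᵐ ω ∂P, ∀ k, outerPoint f' g' δ ε x₀ U θ r k ω + δ • U k 0 ω ∉ N := by
    refine ae_all_iff.2 fun k => ?_
    have hS : MeasurableSet {p : Vec n × (Vec n × ℝ) | p.1 + δ • p.2.1 ∉ N} :=
      (hNm.preimage (f := fun p : Vec n × (Vec n × ℝ) => p.1 + δ • p.2.1) (by fun_prop)).compl
    have := ae_of_indep (ℱ.le _) (measurable_outerPoint (δ := δ) (ε := ε) (x₀ := x₀) hf hg hR k)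
      (measurable_draw hR k 0) (hR.indep_past k 0) hS MeasurableSet.univ fun ω _ =>
        hlaw k 0 (Measure.quasiMeasurePreserving_fst.ae
          ((ae_cond_unitBall (ζ := outerPoint f' g' δ ε x₀ U θ r k ω) hδ.ne'
            (measure_eq_zero_iff_ae_notMem.1 hN)).mono fun u hu => hu.2))
    filter_upwards [this] with ω hω
    exact hω trivial
  have h3 : ∀ᵐ ω ∂P, ∀ k t, 0 < r k (t + 1) ω →
      raySample δ (outerPoint f' g' δ ε x₀ U θ r k ω) (innerVec f' g' δ ε x₀ U θ r k t ω)
        (r k (t + 1) ω) (U k (t + 1) ω) (θ k (t + 1) ω) ∉ N := by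
    refine ae_all_iff.2 fun k => ae_all_iff.2 fun t => ?_
    have hX : Measurable[ℱ (toLex (k, t + 1))] fun ω => (outerPoint f' g' δ ε x₀ U θ r k ω,
        innerVec f' g' δ ε x₀ U θ r k t ω, r k (t + 1) ω) :=
      Measurable.prodMk
        ((measurable_outerPoint hf hg hR k).mono (ℱ.mono (toLex_le_of_le (Nat.zero_le _))) le_rfl)
        (Measurable.prodMk (measurable_innerVec hf hg hR k t) (hR.measurable_r k (t + 1)))
    have hD : MeasurableSet[ℱ (toLex (k, t + 1))] {ω | 0 < r k (t + 1) ω} :=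
      hR.measurable_r k (t + 1) measurableSet_Ioi
    exact ae_of_indep (ℱ.le _) hX (measurable_draw hR k (t + 1)) (hR.indep_past k (t + 1))
      (hNm.preimage (measurable_raySample δ)).compl hD fun ω hω =>
        hlaw k (t + 1) (ae_raySample_notMem hn hNm hN _ _ hδ hω)
  filter_upwards [h1, h2, h3] with ω e1 e2 e3
  exact ⟨e1, e2, e3⟩

/-- The radii chosen along the path are admissible in every pass that is made. -/
def HasAdmissibleRadii (f g : Vec n → ℝ) (Gf Gg : Vec n → Vec n) (δ ε : ℝ) (x₀ : Vec n)
    (U : ℕ → ℕ → Ω → Vec n) (θ r : ℕ → ℕ → Ω → ℝ) (M : ℝ≥0) (ω : Ω) : Prop :=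
  ∀ k z N t, OuterReaches (fun k => RandSearchReturns f g Gf Gg δ ε
      (fun t => U k t ω) (fun t => θ k t ω) (fun t => r k t ω)) δ ε x₀ k z N →
    ∀ ζ : ℕ → Vec n,
    ζ = randIter (gradOracle f g Gf Gg z) δ z
      (fun t => U k t ω) (fun t => θ k t ω) (fun t => r k t ω) →
    (∀ t' ≤ t, RandContinue f g δ ε z (ζ t')) →
      0 < r k (t + 1) ω ∧
      r k (t + 1) ω < ‖ζ t‖ * √(1 - (1 - ‖ζ t‖ ^ 2 / (128 * (M : ℝ) ^ 2)) ^ 2)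

variable {ω : Ω}

/-- As long as the stopping test fails, the subroutine with the given oracles produces the same
vectors as the one with the measurable oracles, and they are convex combinations of gradients. -/
theorem randIter_eq_innerVec (hs : IsSurrogate f g f' g' Gf Gg δ S N) (hδ : 0 < δ)
    (hω : IsRegularPath f' g' δ ε x₀ U θ r N ω)
    (hrad : HasAdmissibleRadii f g Gf Gg δ ε x₀ U θ r M ω) {k N' : ℕ}
    (hk : OuterReaches (fun k => RandSearchReturns f g Gf Gg δ ε
      (fun t => U k t ω) (fun t => θ k t ω) (fun t => r k t ω)) δ ε x₀ k
      (outerPoint f' g' δ ε x₀ U θ r k ω) N')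
    (hz : g (outerPoint f' g' δ ε x₀ U θ r k ω) ≤ 0) (t : ℕ)
    (ht : ∀ i < t, ω ∈ continueSet f' g' δ ε x₀ U θ r k i) :
    randIter (gradOracle f g Gf Gg (outerPoint f' g' δ ε x₀ U θ r k ω)) δ
        (outerPoint f' g' δ ε x₀ U θ r k ω)
        (fun t => U k t ω) (fun t => θ k t ω) (fun t => r k t ω) t =
      innerVec f' g' δ ε x₀ U θ r k t ω ∧
    innerVec f' g' δ ε x₀ U θ r k t ω ∈ convexHull ℝ {u | ∃ z ∈ Metric.closedBall
      (outerPoint f' g' δ ε x₀ U θ r k ω) δ, u ∈ clarke f z ∨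
        (u ∈ clarke g z ∧ f z - f (outerPoint f' g' δ ε x₀ U θ r k ω) ≤ g z)} := by
  set z := outerPoint f' g' δ ε x₀ U θ r k ω with hzdef
  induction t using Nat.strong_induction_on with
  | _ t ih =>
    cases t with
    | zero =>
      have hball : z + δ • U k 0 ω ∈ Metric.closedBall z δ := by
        rw [mem_closedBall_iff_norm, add_sub_cancel_left, norm_smul, Real.norm_of_nonneg hδ.le]
        exact mul_le_of_le_one_right hδ.le (mem_closedBall_zero_iff.1 (hω.1 k 0).1)
      have heq := hs.gradOracle_eq hδ.le hz hball (hω.2.1 k)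
      have hmem := hs.gradOracle_mem hz hball (hω.2.1 k)
      refine ⟨heq, subset_convexHull ℝ _ ?_⟩
      rw [heq] at hmem
      exact hmem
    | succ t =>
      have hprev : ∀ i ≤ t, _ := fun i hi => ih i (by omega) fun j hj => ht j (by omega)
      have hr0 : 0 < r k (t + 1) ω := by
        refine (hrad k z N' t hk _ rfl fun i hi => ?_).1
        rw [(hprev i hi).1, hs.randContinue_iff hδ.le hz]
        exact ht i (by omega)
      have hN := hω.2.2 k t hr0
      rw [← hzdef] at hN
      have hball := raySample_mem_closedBall hδ.le z (innerVec f' g' δ ε x₀ U θ r k t ω)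
        (r k (t + 1) ω) (U k (t + 1) ω) (hω.1 k (t + 1)).2
      have heq := hs.gradOracle_eq hδ.le hz hball hN
      have hmem := hs.gradOracle_mem hz hball hN
      have hsucc : innerVec f' g' δ ε x₀ U θ r k (t + 1) ω =
          segMin (innerVec f' g' δ ε x₀ U θ r k t ω) (gradOracle f g Gf Gg z
            (raySample δ z (innerVec f' g' δ ε x₀ U θ r k t ω)
              (r k (t + 1) ω) (U k (t + 1) ω) (θ k (t + 1) ω))) := by
        rw [heq]
        rfl
      constructor
      · rw [hsucc, ← (hprev t le_rfl).1]
        rfl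
      · rw [hsucc]
        exact (convex_convexHull ℝ _).segment_subset (hprev t le_rfl).2
          (subset_convexHull ℝ _ hmem) (segMin_spec _ _).1

/-- The given method is at the point `outerPoint k` when it makes its `k`-th call, and `f` has
decreased by more than `δ ε / 4` in each of its steps. -/
theorem outerReaches_outerPoint (hs : IsSurrogate f g f' g' Gf Gg δ S N) (hδ : 0 < δ)
    (hε : 0 < ε) (hx₀ : g x₀ ≤ 0) (hω : IsRegularPath f' g' δ ε x₀ U θ r N ω)
    (hrad : HasAdmissibleRadii f g Gf Gg δ ε x₀ U θ r M ω) {B : ℕ} (hB : 1 ≤ B) (k : ℕ)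
    (hk : ω ∈ aliveSet f' g' δ ε x₀ U θ r k) :
    ∃ N', OuterReaches (fun k => RandSearchReturns f g Gf Gg δ ε
        (fun t => U k t ω) (fun t => θ k t ω) (fun t => r k t ω)) δ ε x₀ k
        (outerPoint f' g' δ ε x₀ U θ r k ω) N' ∧
      g (outerPoint f' g' δ ε x₀ U θ r k ω) ≤ 0 ∧
      f (outerPoint f' g' δ ε x₀ U θ r k ω) + k * (δ * ε / 4) ≤ f x₀ ∧
      (k = 0 ∨ f (outerPoint f' g' δ ε x₀ U θ r k ω) + k * (δ * ε / 4) < f x₀) ∧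
      ((∀ j < k, ω ∉ activeSet f' g' δ ε x₀ U θ r j (B - 1)) → N' ≤ k * B) := by
  induction k with
  | zero => exact ⟨0, .start, hx₀, by simp [outerPoint], Or.inl rfl, by simp⟩
  | succ k ih =>
    obtain ⟨hka, hhalt⟩ := hk
    obtain ⟨T, ⟨hlt, hT⟩, hlong⟩ := mem_iUnion.1 hhalt
    obtain ⟨N', hreach, hz, hdec, -, hN'⟩ := ih hka
    have hcont : ∀ t < T, ω ∈ continueSet f' g' δ ε x₀ U θ r k t := fun t ht =>
      mem_iInter₂.1 hlt t ht
    have hiter : ∀ t ≤ T, _ := fun t ht => randIter_eq_innerVec hs hδ hω hrad hreach hz t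
      fun i hi => hcont i (by omega)
    have hnext : outerPoint f' g' δ ε x₀ U θ r (k + 1) ω = outerPoint f' g' δ ε x₀ U θ r k ω -
        δ • (‖innerVec f' g' δ ε x₀ U θ r k T ω‖⁻¹ • innerVec f' g' δ ε x₀ U θ r k T ω) :=
      nextPoint_eq hcont hT
    have hnot : ¬ RandContinue f g δ ε (outerPoint f' g' δ ε x₀ U θ r k ω)
        (innerVec f' g' δ ε x₀ U θ r k T ω) := by
      rw [hs.randContinue_iff hδ.le hz]
      exact hT
    have hret : RandSearchReturns f g Gf Gg δ ε (fun t => U k t ω) (fun t => θ k t ω)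
        (fun t => r k t ω) (outerPoint f' g' δ ε x₀ U θ r k ω)
        (innerVec f' g' δ ε x₀ U θ r k T ω) (T + 1) := by
      refine ⟨T, rfl, fun t ht => ?_, ?_, ((hiter T le_rfl).1).symm⟩
      · rw [(hiter t ht.le).1, hs.randContinue_iff hδ.le hz]
        exact hcont t ht
      · rw [(hiter T le_rfl).1]
        exact hnot
    have hgap := not_le.1 fun hle => hnot ⟨hlong, hle⟩
    obtain ⟨hf1, hg1⟩ := subproblem_lt hz hgap
    have hlong' : ε < ‖innerVec f' g' δ ε x₀ U θ r k T ω‖ := hlong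
    have hbig : δ * ε / 4 < δ * ‖innerVec f' g' δ ε x₀ U θ r k T ω‖ / 4 := by
      have := mul_lt_mul_of_pos_left hlong' hδ
      linarith
    have hδε : 0 < δ * ε := mul_pos hδ hε
    have hstrict : f (outerPoint f' g' δ ε x₀ U θ r (k + 1) ω) + ((k + 1 : ℕ) : ℝ) * (δ * ε / 4)
        < f x₀ := by
      rw [hnext]
      push_cast
      linarith
    refine ⟨N' + (T + 1), ?_, ?_, hstrict.le, Or.inr hstrict, ?_⟩
    · rw [hnext]
      exact .step k _ _ N' (T + 1) hreach hret hlong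
    · rw [hnext]
      linarith
    · intro hj
      have h1 := hN' fun j hjk => hj j (by omega)
      have h2 : T < B := by
        by_contra hTB
        refine hj k (Nat.lt_succ_self k) ⟨hka, mem_iInter₂.2 fun i hi => hcont i (by omega)⟩
      rw [add_mul, one_mul]
      omega

/-- If none of the first `K` calls makes `B` or more passes, then the method terminates at a
stationary point within `K B` oracle calls. -/
theorem exists_outerReturns_randomized (hs : IsSurrogate f g f' g' Gf Gg δ S N) (hδ : 0 < δ)
    (hε : 0 < ε) (hx₀ : g x₀ ≤ 0) {pstar : ℝ} (hp : ∀ x, g x ≤ 0 → pstar ≤ f x)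
    (hf : LipschitzOnWith M f S) (hg : LipschitzOnWith M g S)
    (hω : IsRegularPath f' g' δ ε x₀ U θ r N ω)
    (hrad : HasAdmissibleRadii f g Gf Gg δ ε x₀ U θ r M ω) {B K : ℕ} (hB : 1 ≤ B) (hK : 1 ≤ K)
    (hKX : 4 * (f x₀ - pstar) / (δ * ε) ≤ K)
    (hshort : ∀ j < K, ω ∉ activeSet f' g' δ ε x₀ U θ r j (B - 1)) :
    ∃ x N', OuterReturns (fun k => RandSearchReturns f g Gf Gg δ ε
        (fun t => U k t ω) (fun t => θ k t ω) (fun t => r k t ω)) δ ε x₀ x N' ∧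
      IsGFJ (clarke f) (fun _ : Fin 1 => clarke g) (fun _ => g) δ ε (3 * M * δ) x ∧
      N' ≤ K * B := by
  have hδε : 0 < δ * ε := mul_pos hδ hε
  have hlt : ∀ k, ω ∈ aliveSet f' g' δ ε x₀ U θ r k → k < K := by
    intro k hk
    obtain ⟨-, -, hz, -, hdec, -⟩ := outerReaches_outerPoint hs hδ hε hx₀ hω hrad hB k hk
    rcases hdec with rfl | hdec
    · omega
    · rw [div_le_iff₀ hδε] at hKX
      have h1 := hp _ hz
      have h2 : (k : ℝ) * (δ * ε) < K * (δ * ε) := by linarith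
      exact_mod_cast lt_of_mul_lt_mul_right h2 hδε.le
  by_contra hcon
  have hall : ∀ k, ω ∈ aliveSet f' g' δ ε x₀ U θ r k := by
    intro k
    induction k with
    | zero => trivial
    | succ k hk =>
      have hkK := hlt k hk
      obtain ⟨N', hreach, hz, -, -, hN'⟩ := outerReaches_outerPoint hs hδ hε hx₀ hω hrad hB k hk
      have hex : ∃ T, ω ∉ continueSet f' g' δ ε x₀ U θ r k T ∧ T < B := by
        by_contra! hno
        refine hshort k hkK ⟨hk, mem_iInter₂.2 fun i hi => ?_⟩
        by_contra hi'
        have := hno i hi'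
        omega
      classical
      have hex' : ∃ T, ω ∉ continueSet f' g' δ ε x₀ U θ r k T := ⟨_, hex.choose_spec.1⟩
      obtain ⟨T₁, hT₁, hT₁B⟩ := hex
      set T := Nat.find hex' with hTdef
      have hTB : T < B := (Nat.find_min' hex' hT₁).trans_lt hT₁B
      have hcont : ∀ t < T, ω ∈ continueSet f' g' δ ε x₀ U θ r k t := fun t ht =>
        not_not.1 (Nat.find_min hex' ht)
      have hT : ω ∉ continueSet f' g' δ ε x₀ U θ r k T := Nat.find_spec hex'
      refine ⟨hk, mem_iUnion.2 ⟨T, ⟨mem_iInter₂.2 hcont, hT⟩,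
        show ε < _ from lt_of_not_ge fun hle => hcon ?_⟩⟩
      have hiter : ∀ t ≤ T, _ := fun t ht => randIter_eq_innerVec hs hδ hω hrad hreach hz t
        fun i hi => hcont i (by omega)
      have hball : outerPoint f' g' δ ε x₀ U θ r k ω + δ • U k 0 ω ∈
          Metric.closedBall (outerPoint f' g' δ ε x₀ U θ r k ω) δ := by
        rw [mem_closedBall_iff_norm, add_sub_cancel_left, norm_smul, Real.norm_of_nonneg hδ.le]
        exact mul_le_of_le_one_right hδ.le (mem_closedBall_zero_iff.1 (hω.1 k 0).1)
      have hsub := hs.ball_subset _ hz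
      refine ⟨outerPoint f' g' δ ε x₀ U θ r k ω, N' + (T + 1), ⟨k, N', T + 1,
        innerVec f' g' δ ε x₀ U θ r k T ω, hreach, ⟨T, rfl, fun t ht => ?_, ?_,
        ((hiter T le_rfl).1).symm⟩, hle, rfl⟩, ?_, ?_⟩
      · rw [(hiter t ht.le).1, hs.randContinue_iff hδ.le hz]
        exact hcont t ht
      · rw [(hiter T le_rfl).1, hs.randContinue_iff hδ.le hz]
        exact hT
      · exact isGFJ_of_mem_convexHull hδ.le (hf.mono hsub) (hg.mono hsub) hz
          ⟨_, subset_convexHull ℝ _ (mem_iUnion₂.2 ⟨_, hball,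
            gradient_mem_clarke (hs.diff_f _ (hsub hball) (hω.2.1 k))⟩)⟩
          ⟨_, subset_convexHull ℝ _ (mem_iUnion₂.2 ⟨_, hball,
            gradient_mem_clarke (hs.diff_g _ (hsub hball) (hω.2.1 k))⟩)⟩
          (hiter T le_rfl).2 hle
      · have h1 := hN' fun j hj => hshort j (hj.trans hkK)
        calc N' + (T + 1) ≤ k * B + B := by omega
          _ = (k + 1) * B := by ring
          _ ≤ K * B := Nat.mul_le_mul_right _ hkK
  exact lt_irrefl K (hlt K (hall K))

theorem mem_radiusSet_of_mem_activeSet (hs : IsSurrogate f g f' g' Gf Gg δ S N) (hδ : 0 < δ)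
    (hε : 0 < ε) (hx₀ : g x₀ ≤ 0) (hω : IsRegularPath f' g' δ ε x₀ U θ r N ω)
    (hrad : HasAdmissibleRadii f g Gf Gg δ ε x₀ U θ r M ω) {k t : ℕ}
    (hkt : ω ∈ activeSet f' g' δ ε x₀ U θ r k t) :
    ω ∈ radiusSet f' g' δ ε x₀ U θ r M k t := by
  obtain ⟨hk, hcont⟩ := hkt
  have hcont' : ∀ i ≤ t, ω ∈ continueSet f' g' δ ε x₀ U θ r k i := fun i hi =>
    mem_iInter₂.1 hcont i hi
  obtain ⟨N', hreach, hz, -⟩ := outerReaches_outerPoint hs hδ hε hx₀ hω hrad le_rfl k hk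
  have hiter : ∀ i ≤ t, _ := fun i hi => randIter_eq_innerVec hs hδ hω hrad hreach hz i
    fun j hj => hcont' j (by omega)
  have h := hrad k _ N' t hreach _ rfl fun i hi => by
    rw [(hiter i hi).1, hs.randContinue_iff hδ.le hz]
    exact hcont' i hi
  rwa [(hiter t le_rfl).1] at h

end Path

/-! ### The three subroutines -/

theorem ceil_mul_inv_pow_le {X τ : ℝ} (hX : 1 ≤ X) (hτ0 : 0 < τ) (hτ1 : τ < 1) :
    (⌈X⌉₊ : ℝ≥0∞) * 16⁻¹ ^ ⌈2 * Real.log (X / τ)⌉₊ ≤ ENNReal.ofReal τ := by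
  set L := ⌈2 * Real.log (X / τ)⌉₊ with hL
  have hXτ : 1 < X / τ := by rw [one_lt_div hτ0]; linarith
  have hlog : 0 < Real.log (X / τ) := Real.log_pos hXτ
  have hL1 : 1 ≤ L := Nat.one_le_ceil_iff.2 (by positivity)
  have hLlog : Real.log (X / τ) ≤ L := by
    have := Nat.le_ceil (2 * Real.log (X / τ))
    linarith
  have h1 : (4⁻¹ : ℝ) ^ L ≤ 4⁻¹ := pow_le_of_le_one (by norm_num) (by norm_num) (by omega)
  have h2 : (4⁻¹ : ℝ) ^ L ≤ τ / X := by
    have he : (4⁻¹ : ℝ) ≤ Real.exp (-1) := by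
      rw [Real.exp_neg]
      exact inv_anti₀ (Real.exp_pos 1) (by linarith [Real.exp_one_lt_three])
    calc (4⁻¹ : ℝ) ^ L ≤ Real.exp (-1) ^ L := pow_le_pow_left₀ (by norm_num) he L
      _ = Real.exp (-L) := by rw [← Real.exp_nat_mul]; ring_nf
      _ ≤ Real.exp (-Real.log (X / τ)) := Real.exp_le_exp.2 (by linarith)
      _ = τ / X := by rw [Real.exp_neg, Real.exp_log (by linarith), inv_div]
  have h3 : (⌈X⌉₊ : ℝ) ≤ 2 * X := by
    have := Nat.ceil_lt_add_one (zero_le_one.trans hX)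
    linarith
  have h4 : (⌈X⌉₊ : ℝ) * 16⁻¹ ^ L ≤ τ := by
    have h5 : (16⁻¹ : ℝ) ^ L = 4⁻¹ ^ L * 4⁻¹ ^ L := by rw [← mul_pow]; norm_num
    rw [h5]
    calc (⌈X⌉₊ : ℝ) * (4⁻¹ ^ L * 4⁻¹ ^ L) ≤ 2 * X * (4⁻¹ * (τ / X)) := by gcongr
      _ = τ / 2 := by field_simp; norm_num
      _ ≤ τ := by linarith
  refine le_trans (le_of_eq ?_) (ENNReal.ofReal_le_ofReal h4)
  rw [ENNReal.ofReal_mul (Nat.cast_nonneg _), ENNReal.ofReal_natCast,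
    ENNReal.ofReal_pow (by norm_num), ENNReal.ofReal_inv_of_pos (by norm_num)]
  norm_num

/-- Almost sure termination and the complexity bound of the method with the randomized
subroutine, for a single constraint function. -/
theorem randomized_method {n : ℕ} (hn : 0 < n) {f g : Vec n → ℝ} {M : ℝ≥0} (hM : 0 < M)
    {pstar δ ε : ℝ} {x₀ : Vec n} {S : Set (Vec n)} (hS : IsOpen S)
    (hball : ∀ x, g x ≤ 0 → Metric.closedBall x δ ⊆ S)
    (hp : ∀ x, g x ≤ 0 → pstar ≤ f x) (hf : LipschitzOnWith M f S) (hg : LipschitzOnWith M g S)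
    (hx₀ : g x₀ ≤ 0) (hε : 0 < ε) (hδ : 0 < δ) {Gf Gg : Vec n → Vec n}
    (hGf : ∀ᵐ x ∂(volume : Measure (Vec n)), DifferentiableAt ℝ f x → Gf x = gradient f x)
    (hGg : ∀ᵐ x ∂(volume : Measure (Vec n)), DifferentiableAt ℝ g x → Gg x = gradient g x)
    {Ω : Type*} {mΩ : MeasurableSpace Ω} {P : Measure Ω} [IsProbabilityMeasure P]
    {ℱ : Filtration (ℕ ×ₗ ℕ) mΩ} {U : ℕ → ℕ → Ω → Vec n} {θ r : ℕ → ℕ → Ω → ℝ}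
    (hR : IsSearchRandomness P ℱ U θ r)
    (hrad : ∀ᵐ ω ∂P, HasAdmissibleRadii f g Gf Gg δ ε x₀ U θ r M ω) {τ : ℝ} (hτ0 : 0 < τ)
    (hτ1 : τ < 1) :
    P {ω | ¬ ∃ x N, OuterReturns (fun k => RandSearchReturns f g Gf Gg δ ε
        (fun t => U k t ω) (fun t => θ k t ω) (fun t => r k t ω)) δ ε x₀ x N ∧
      IsGFJ (clarke f) (fun _ : Fin 1 => clarke g) (fun _ => g) δ ε (3 * M * δ) x ∧
      N ≤ ⌈max 1 (4 * (f x₀ - pstar) / (δ * ε))⌉₊ * ⌈64 * (M : ℝ) ^ 2 / ε ^ 2⌉₊ *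
        ⌈2 * Real.log (max 1 (4 * (f x₀ - pstar) / (δ * ε)) / τ)⌉₊} ≤ ENNReal.ofReal τ := by
  have hM' : 0 < (M : ℝ) := hM
  obtain ⟨f', hf', hff'⟩ := hf.extend_real
  obtain ⟨g', hg', hgg'⟩ := hg.extend_real
  have hfm := hf'.continuous.measurable
  have hgm := hg'.continuous.measurable
  set good : Set (Vec n) := {s | s ∈ S → DifferentiableAt ℝ f s ∧ DifferentiableAt ℝ g s ∧
    Gf s = gradient f s ∧ Gg s = gradient g s} with hgood
  set N := toMeasurable volume goodᶜ with hN
  have hN0 : volume N = 0 := by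
    rw [hN, measure_toMeasurable]
    change ∀ᵐ s ∂volume, s ∈ good
    filter_upwards [hGf, hGg, hf'.ae_differentiableAt, hg'.ae_differentiableAt]
      with s h1 h2 h3 h4 hs
    have e1 : DifferentiableAt ℝ f s :=
      h3.congr_of_eventuallyEq (hff'.eventuallyEq_of_mem (hS.mem_nhds hs))
    have e2 : DifferentiableAt ℝ g s :=
      h4.congr_of_eventuallyEq (hgg'.eventuallyEq_of_mem (hS.mem_nhds hs))
    exact ⟨e1, e2, h1 e1, h2 e2⟩
  have hgoodN : ∀ s ∈ S, s ∉ N → DifferentiableAt ℝ f s ∧ DifferentiableAt ℝ g s ∧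
      Gf s = gradient f s ∧ Gg s = gradient g s := by
    intro s hs hsN
    by_contra hcon
    exact hsN (subset_toMeasurable _ _ fun h => hcon (h hs))
  have hsur : IsSurrogate f g f' g' Gf Gg δ S N :=
    ⟨hS, hball, hff', hgg', fun s h1 h2 => (hgoodN s h1 h2).1, fun s h1 h2 => (hgoodN s h1 h2).2.1,
      fun s h1 h2 => (hgoodN s h1 h2).2.2.1, fun s h1 h2 => (hgoodN s h1 h2).2.2.2⟩
  have hreg := ae_isRegularPath (ε := ε) (x₀ := x₀) hn hfm hgm hδ hR
    (measurableSet_toMeasurable volume goodᶜ) hN0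
  have hact : ∀ k t, ∀ᵐ ω ∂P, ω ∈ activeSet f' g' δ ε x₀ U θ r k t →
      ω ∈ radiusSet f' g' δ ε x₀ U θ r M k t := by
    intro k t
    filter_upwards [hreg, hrad] with ω h1 h2 h3
    exact mem_radiusSet_of_mem_activeSet hsur hδ hε hx₀ h1 h2 h3
  set X := max 1 (4 * (f x₀ - pstar) / (δ * ε)) with hX
  have hX1 : 1 ≤ X := le_max_left _ _
  set K := ⌈X⌉₊ with hK
  set T := ⌈64 * (M : ℝ) ^ 2 / ε ^ 2⌉₊ with hT
  set L := ⌈2 * Real.log (X / τ)⌉₊ with hL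
  have hK1 : 1 ≤ K := Nat.one_le_ceil_iff.2 (by linarith)
  have hT1 : 1 ≤ T := Nat.one_le_ceil_iff.2 (by positivity)
  have hL1 : 1 ≤ L := Nat.one_le_ceil_iff.2
    (mul_pos two_pos (Real.log_pos (by rw [one_lt_div hτ0]; linarith)))
  have hLT : 1 ≤ L * T := Nat.mul_pos hL1 hT1
  -- a call that is longer than allowed occurs with small probability
  have hbad : P (⋃ j ∈ Finset.range K, activeSet f' g' δ ε x₀ U θ r j (L * T - 1)) ≤
      ENNReal.ofReal τ := by
    refine (measure_biUnion_finset_le _ _).trans ?_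
    refine (Finset.sum_le_sum fun j _ => measure_activeSet_le hn hM hf' hg' hδ hε hR
      (fun t => hact j t) hT1 (Nat.le_ceil _) hL1).trans ?_
    rw [Finset.sum_const, Finset.card_range, nsmul_eq_mul]
    exact ceil_mul_inv_pow_le hX1 hτ0 hτ1
  refine (measure_mono_ae ?_).trans hbad
  filter_upwards [hreg, hrad] with ω h1 h2 hω
  by_contra hcon
  refine hω ?_
  obtain ⟨x, N', e1, e2, e3⟩ := exists_outerReturns_randomized hsur hδ hε hx₀ hp hf hg h1 h2 hLT
    hK1 ((le_max_right _ _).trans (Nat.le_ceil _)) fun j hj hmem =>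
      hcon (mem_iUnion₂.2 ⟨j, Finset.mem_range.2 hj, hmem⟩)
  exact ⟨x, N', e1, e2, e3.trans_eq (by ring)⟩

end

theorem theorem1 {n m : ℕ} (hn : 0 < n) (hm : 0 < m)
    (f : Vec n → ℝ) (g : Fin m → Vec n → ℝ)
    (pstar : ℝ) (hp : IsGLB (f '' feasibleSet g) pstar)
    (M : ℝ≥0) (hM : 0 < M) (Δ : ℝ)
    (hf : LipschitzOnWith M f (Metric.thickening Δ (feasibleSet g)))
    (hg : ∀ i, LipschitzOnWith M (g i) (Metric.thickening Δ (feasibleSet g)))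
    (x₀ : Vec n) (hx₀ : x₀ ∈ feasibleSet g)
    (ε δ : ℝ) (hε : 0 < ε) (hδ : 0 < δ) (hδΔ : δ < Δ) :
    -- any subroutine, any subdifferentials
    (∀ (Q : Type) (Gf Gg : Vec n → Q → Vec n) (Gh : Vec n → Vec n → Q → Vec n)
      (Df Dg : Vec n → Set (Vec n)) (C : ℝ) (A : ℕ → Vec n → Vec n → ℕ → Prop),
      IsOracleSelection f (maxConstraint g) Gf Gg Gh →
      (∀ x ∈ feasibleSet g, ∀ z ∈ Metric.closedBall x δ, ∀ v, Gf z v ∈ Df z ∧ Gg z v ∈ Dg z) →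
      0 < C →
      IsMinNormSubroutine f (maxConstraint g) Gh (feasibleSet g) δ ε C A →
        (∃ x N, OuterReturns A δ ε x₀ x N) ∧
        (∀ k x N, OuterReaches A δ ε x₀ k x N → k ≤ ⌈(f x₀ - pstar) / (C * δ * ε)⌉₊) ∧
        (∀ x N, OuterReturns A δ ε x₀ x N →
          IsGFJ Df (fun _ : Fin 1 => Dg) (fun _ => maxConstraint g) δ ε (3 * M * δ) x)) ∧
    -- the randomized subroutine, gradients almost everywhere
    (∀ (Gf Gg : Vec n → Vec n),
      (∀ᵐ x ∂(volume : Measure (Vec n)), DifferentiableAt ℝ f x → Gf x = gradient f x) →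
      (∀ᵐ x ∂(volume : Measure (Vec n)), DifferentiableAt ℝ (maxConstraint g) x →
        Gg x = gradient (maxConstraint g) x) →
      ∀ (Ω : Type*) (mΩ : MeasurableSpace Ω) (P : Measure Ω) (_ : IsProbabilityMeasure P)
        (ℱ : Filtration (ℕ ×ₗ ℕ) mΩ) (U : ℕ → ℕ → Ω → Vec n) (θ r : ℕ → ℕ → Ω → ℝ)
        (A : Ω → ℕ → Vec n → Vec n → ℕ → Prop),
      IsSearchRandomness P ℱ U θ r →
      (∀ ω k, A ω k = RandSearchReturns f (maxConstraint g) Gf Gg δ ε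
        (fun t => U k t ω) (fun t => θ k t ω) (fun t => r k t ω)) →
      -- the radii are admissible in every pass of the loop that is made
      (∀ᵐ ω ∂P, ∀ k z N t, OuterReaches (A ω) δ ε x₀ k z N →
        ∀ ζ : ℕ → Vec n,
        ζ = randIter (gradOracle f (maxConstraint g) Gf Gg z) δ z
          (fun t => U k t ω) (fun t => θ k t ω) (fun t => r k t ω) →
        (∀ t' ≤ t, RandContinue f (maxConstraint g) δ ε z (ζ t')) →
          0 < r k (t + 1) ω ∧
          r k (t + 1) ω < ‖ζ t‖ * √(1 - (1 - ‖ζ t‖ ^ 2 / (128 * (M : ℝ) ^ 2)) ^ 2)) →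
        (∀ᵐ ω ∂P, ∃ x N, OuterReturns (A ω) δ ε x₀ x N ∧
          IsGFJ (clarke f) (fun _ : Fin 1 => clarke (maxConstraint g))
            (fun _ => maxConstraint g) δ ε (3 * M * δ) x) ∧
        (∀ τ : ℝ, 0 < τ → τ < 1 →
          P {ω | ¬ ∃ x N, OuterReturns (A ω) δ ε x₀ x N ∧
            IsGFJ (clarke f) (fun _ : Fin 1 => clarke (maxConstraint g))
              (fun _ => maxConstraint g) δ ε (3 * M * δ) x ∧
            N ≤ ⌈max 1 (4 * (f x₀ - pstar) / (δ * ε))⌉₊ * ⌈64 * (M : ℝ) ^ 2 / ε ^ 2⌉₊ *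
              ⌈2 * Real.log (max 1 (4 * (f x₀ - pstar) / (δ * ε)) / τ)⌉₊}
            ≤ ENNReal.ofReal τ)) ∧
    -- the deterministic subroutine, directional subgradients
    (∀ (F G : Vec n → Vec n → Vec n),
      IsDirSubgradMap f F → IsDirSubgradMap (maxConstraint g) G →
      (∀ z ∈ Metric.thickening Δ (feasibleSet g), ∀ v, ‖v‖ = 1 → ‖F z v‖ ≤ M ∧ ‖G z v‖ ≤ M) →
      nonconvexityModulus f δ ≠ ∞ → nonconvexityModulus (maxConstraint g) δ ≠ ∞ →
      ∀ v₀ : ℕ → Vec n → Vec n, (∀ k z, ‖v₀ k z‖ = 1) →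
        ∃ x N, OuterReturns
            (fun k z => BisecSearchReturns f (maxConstraint g) F G δ ε (v₀ k z) z) δ ε x₀ x N ∧
          IsGFJ (dirSubdiff f) (fun _ : Fin 1 => dirSubdiff (maxConstraint g))
            (fun _ => maxConstraint g) δ ε (3 * M * δ) x ∧
          IsGFJ (fun z => {u | ∃ v, ‖v‖ = 1 ∧ u = F z v})
            (fun _ : Fin 1 => fun z => {u | ∃ v, ‖v‖ = 1 ∧ u = G z v})
            (fun _ => maxConstraint g) δ ε (3 * M * δ) x ∧
          N ≤ ⌈max 1 (3 * (f x₀ - pstar) / (δ * ε))⌉₊ * ⌈16 * (M : ℝ) ^ 2 / ε ^ 2⌉₊ *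
            (1 + ⌊12 * ((nonconvexityModulus f δ).toReal +
              (nonconvexityModulus (maxConstraint g) δ).toReal) / ε⌋₊)) := by
  have hmem : ∀ x, x ∈ feasibleSet g ↔ maxConstraint g x ≤ 0 := mem_feasibleSet_iff hm g
  have hset : feasibleSet g = {x | maxConstraint g x ≤ 0} := Set.ext hmem
  have hgmax := lipschitzOnWith_maxConstraint hm hg
  have hball : ∀ x, maxConstraint g x ≤ 0 →
      Metric.closedBall x δ ⊆ Metric.thickening Δ (feasibleSet g) := fun x hx =>
    closedBall_subset_thickening hδΔ ((hmem x).2 hx)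
  have hLf : ∀ x, maxConstraint g x ≤ 0 → LipschitzOnWith M f (Metric.closedBall x δ) :=
    fun x hx => hf.mono (hball x hx)
  have hLg : ∀ x, maxConstraint g x ≤ 0 →
      LipschitzOnWith M (maxConstraint g) (Metric.closedBall x δ) :=
    fun x hx => hgmax.mono (hball x hx)
  have hp' : ∀ x, maxConstraint g x ≤ 0 → pstar ≤ f x := fun x hx =>
    hp.1 ⟨x, (hmem x).2 hx, rfl⟩
  have hx₀' := (hmem x₀).1 hx₀
  refine ⟨?_, ?_, ?_⟩
  · intro Q Gf Gg Gh Df Dg C A hsel hD hC hA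
    rw [hset] at hA
    exact minNorm_method hp' hLf hLg hx₀' hε hδ hC hsel
      (fun x hx => hD x ((hmem x).2 hx)) hA
  · intro Gf Gg hGf hGg Ω mΩ P hP ℱ U θ r A hR hA hrad
    obtain rfl : A = fun ω k => RandSearchReturns f (maxConstraint g) Gf Gg δ ε
        (fun t => U k t ω) (fun t => θ k t ω) (fun t => r k t ω) :=
      funext fun ω => funext fun k => hA ω k
    have hprob := fun τ (h0 : 0 < τ) (h1 : τ < 1) => randomized_method hn hM
      Metric.isOpen_thickening hball hp' hf hgmax hx₀' hε hδ hGf hGg hR hrad h0 h1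
    refine ⟨?_, hprob⟩
    rw [ae_iff]
    refine le_antisymm (le_of_forall_gt fun c hc => ?_) zero_le
    obtain ⟨τ, hτ0, hτc⟩ := ENNReal.lt_iff_exists_nnreal_btwn.1 (lt_min hc one_pos)
    have hτ0' : 0 < (τ : ℝ) := by exact_mod_cast hτ0
    have hτ1 : (τ : ℝ) < 1 := by exact_mod_cast hτc.trans_le (min_le_right _ _)
    refine lt_of_le_of_lt (le_trans (measure_mono ?_) (hprob τ hτ0' hτ1)) ?_
    · intro ω hω hcon
      refine hω ?_
      obtain ⟨x, N, h1, h2, -⟩ := hcon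
      exact ⟨x, N, h1, h2⟩
    · rw [ENNReal.ofReal_coe_nnreal]
      exact hτc.trans_le (min_le_left _ _)
  · intro F G hF hG hb hΛf hΛg v₀ hv₀
    obtain ⟨x, N, hret, hGFJ, hN⟩ := bisec_method hM hp' hLf hLg hx₀' hε hδ hF hG
      (fun x hx w hw v hv => hb w (hball x hx hw) v hv) hΛf hΛg hv₀
    refine ⟨x, N, hret, hGFJ _ _ fun z v hv => ?_, hGFJ _ _ fun z v hv => ?_, hN⟩
    · have hv0 : v ≠ 0 := norm_pos_iff.1 (hv ▸ one_pos)
      exact ⟨⟨v, hv0, hF z v⟩, ⟨v, hv0, hG z v⟩⟩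
    · exact ⟨⟨v, hv, rfl⟩, ⟨v, hv, rfl⟩⟩
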